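/- **Setting.** Let $\mu$ be the uniform probability measure on $\mathbb S^2=\{\xi\in\mathbb R^3:|\xi|=1\}$ and, for $\xi\in\mathbb S^2$, let $\nu_\xi$ be the uniform probability measure on the great circle $\xi^\perp=\{\eta\in\mathbb S^2:\xi\cdot\eta=0\}$. The *spherical graphop* is $(Af)(\xi)=\int_{\xi^\perp} f\,d\nu_\xi$. Let $d\ge 1$, $L>0$, $\kappa>0$, let $U=[-\frac L2,\frac L2]^d$ be the flat torus (functions on $U$ are $L$-periodic in each coordinate), let $D\in W^{2,\infty}(U)$ be a periodic potential, and $\rho_\infty:=L^{-d}$. Consider $$\partial_t\rho=\kappa\,\mathrm{div}_x\big(\rho\,V[A](\rho)\big)+\Delta_x\rho,\qquad \rho(0)=\rho_0,\qquad V[A](\rho)(t,x,\xi)=\int_U\nabla D(x-y)\,(A\rho)(t,y,\xi)\,dy,$$ where $A$ acts on the variable $\xi$. Put $\hat H(u|\rho_\infty)=\int_{\mathbb S^2}\int_U u\log(u/\rho_\infty)\,dx\,d\mu(\xi)$. The initial datum $\rho_0$ (measurable in $(x,\xi)$) is *admissible* if $\rho_0(\cdot,\xi)\in H^{3+d}(U)$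 is a probability density for $\mu$-a.e. $\xi$ and $\rho_0(x,\cdot)\in L^\infty(\mathbb S^2,\mu)$ for every $x$. A *classical solution* is a measurable function $\rho(t,x,\xi)$, $t\ge0$, such that for $\mu$-a.e. $\xi$: $\rho(\cdot,\cdot,\xi)$ is $L$-periodic in each coordinate of $x$, continuous on $[0,\infty)\times\mathbb R^d$, of class $C^1$ in $t$ and $C^2$ in $x$ (with derivatives jointly continuous) for $t>0$, satisfies the equation pointwise for $t>0$ and the initial condition for a.e. $x$; and, so that the interaction term is defined, $(y,\eta)\mapsto\rho(t,y,\eta)$ is integrable with respect to $dy\otimes\nu_\xi$ on $U\times\mathbb S^2$ for each $t\ge0$, with $\int_U\int|\rho(t,y,\eta)|\,d\nu_\xi(\eta)\,dy$ bounded for $t$ in bounded intervals (this last condition is automatic when $\rho(t,\cdot,\eta)$ is a probability density for every $t\ge0$ and $\mu$-a.e. $\eta$). **Proposition.** (i) The formula for $A$ defines a bounded linear operator $A:L^2(\mathbb S^2,\mu)\to L^2(\mathbb S^2,\mu)$, and $\|A\|_{2\to2}=1$. (ii) Suppose $\kappa<\dfrac{2\pi^2}{L^2\|\Delta D\|_{L^\infty(U)}}$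 (no condition if $\|\Delta D\|_{L^\infty(U)}=0$). Then $\hat\alpha:=\dfrac{4\pi^2}{L^2}-2\kappa\|\Delta D\|_{L^\infty(U)}>0$, and for every admissible $\rho_0$ with $\hat H(\rho_0|\rho_\infty)<\infty$, every classical solution $\rho$ with initial datum $\rho_0$ satisfies, for all $t\ge0$, $$\hat H(\rho(t)|\rho_\infty)<\infty\quad\text{and}\quad \hat H(\rho(t)|\rho_\infty)\le e^{-\hat\alpha t}\,\hat H(\rho_0|\rho_\infty).$$ -/

import Mathlib

open MeasureTheory Set

noncomputable section

/-! ### The sphere and the spherical graphop -/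

/-- The uniform (normalised surface) probability measure on the unit sphere of a
finite-dimensional real inner product space `F`. -/
def uniformSphere (F : Type*) [NormedAddCommGroup F] [InnerProductSpace ℝ F]
    [FiniteDimensional ℝ F] [MeasurableSpace F] [BorelSpace F] :
    Measure (Metric.sphere (0 : F) 1) :=
  ((volume : Measure F).toSphere univ)⁻¹ • (volume : Measure F).toSphere

/-- Euclidean three-space. -/
abbrev E3 : Type := EuclideanSpace ℝ (Fin 3)

/-- The two-sphere `𝕊² = {ξ ∈ ℝ³ : |ξ| = 1}`. -/
abbrev S2 : Type := Metric.sphere (0 : E3) 1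

/-- The uniform probability measure on `𝕊²`. -/
def sphereMeasure : Measure S2 := uniformSphere E3

/-- The plane of vectors of `ℝ³` orthogonal to `ξ`. -/
abbrev perpPlane (ξ : S2) : Submodule ℝ E3 := (Submodule.span ℝ {(ξ : E3)})ᗮ

/-- The inclusion of the unit circle of the plane orthogonal to `ξ` into `𝕊²`; its range is the
`ξ`-equator `{η ∈ 𝕊² : ⟨ξ, η⟩ = 0}`. -/
def equatorIncl (ξ : S2) (v : Metric.sphere (0 : perpPlane ξ) 1) : S2 :=
  ⟨((v : perpPlane ξ) : E3), by
    have h := v.2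
    rw [mem_sphere_zero_iff_norm] at h ⊢
    exact h⟩

/-- The uniform probability measure `ν_ξ` on the `ξ`-equator, as a measure on `𝕊²`. -/
def equatorMeasure (ξ : S2) : Measure S2 :=
  (uniformSphere (perpPlane ξ)).map (equatorIncl ξ)

/-- The action of the spherical graphop on functions: `(A f)(ξ) = ∫ f dν_ξ`. -/
def sphericalAverage (f : S2 → ℝ) (ξ : S2) : ℝ :=
  ∫ η, f η ∂(equatorMeasure ξ)

/-! ### Functions on the flat torus

Functions on the `d`-dimensional flat torus of length `L` are functions on `Fin d → ℝ` that are
`L`-periodic in every coordinate. The space `Fin d → ℝ` carries Lebesgue measure; its norm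
plays no role below. -/

/-- `L`-periodicity in every coordinate. -/
def IsPeriodic {d : ℕ} (L : ℝ) (f : (Fin d → ℝ) → ℝ) : Prop :=
  ∀ x i, f (x + Pi.single i L) = f x

/-- The fundamental cell `U = [-L/2, L/2]^d`. -/
def cell (d : ℕ) (L : ℝ) : Set (Fin d → ℝ) :=
  univ.pi fun _ => Icc (-L / 2) (L / 2)

/-- Lebesgue measure on the fundamental cell. -/
def cellMeasure (d : ℕ) (L : ℝ) : Measure (Fin d → ℝ) :=
  volume.restrict (cell d L)

/-- The classical partial derivative in the `i`-th coordinate direction. -/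
def pd {d : ℕ} (i : Fin d) (f : (Fin d → ℝ) → ℝ) (x : Fin d → ℝ) : ℝ :=
  lineDeriv ℝ f x (Pi.single i 1)

/-- `g` is the weak (distributional) `i`-th partial derivative of `f`. -/
def HasWeakPartial {d : ℕ} (i : Fin d) (f g : (Fin d → ℝ) → ℝ) : Prop :=
  LocallyIntegrable f volume ∧ LocallyIntegrable g volume ∧
    ∀ φ : (Fin d → ℝ) → ℝ, ContDiff ℝ (⊤ : ℕ∞) φ → HasCompactSupport φ →
      ∫ x, f x * pd i φ x = -∫ x, g x * φ x

/-- The Sobolev space `H^m` of the torus: periodic functions all of whose weak derivatives of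
order at most `m` are square integrable over the cell. -/
def MemSobolev {d : ℕ} (L : ℝ) : ℕ → ((Fin d → ℝ) → ℝ) → Prop
  | 0, f => IsPeriodic L f ∧ MemLp f 2 (cellMeasure d L)
  | m + 1, f => (IsPeriodic L f ∧ MemLp f 2 (cellMeasure d L)) ∧
      ∀ i, ∃ g, HasWeakPartial i f g ∧ MemSobolev L m g

/-- `D` is a periodic potential of class `W^{2,∞}`, with weak gradient `G` and weak Hessian
`H`, i.e. `G i = ∂ᵢ D` and `H i j = ∂ⱼ ∂ᵢ D`. -/
structure IsW2InfPotential {d : ℕ} (L : ℝ) (D : (Fin d → ℝ) → ℝ)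
    (G : Fin d → (Fin d → ℝ) → ℝ) (H : Fin d → Fin d → (Fin d → ℝ) → ℝ) : Prop where
  periodic : IsPeriodic L D
  periodic_grad : ∀ i, IsPeriodic L (G i)
  periodic_hess : ∀ i j, IsPeriodic L (H i j)
  bdd : MemLp D ⊤ (cellMeasure d L)
  bdd_grad : ∀ i, MemLp (G i) ⊤ (cellMeasure d L)
  bdd_hess : ∀ i j, MemLp (H i j) ⊤ (cellMeasure d L)
  weak_grad : ∀ i, HasWeakPartial i D (G i)
  weak_hess : ∀ i j, HasWeakPartial j (G i) (H i j)

/-- `‖Δ D‖_{L^∞(U)}`, in terms of the weak Hessian `H` of `D`. -/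
def lapNorm {d : ℕ} (L : ℝ) (H : Fin d → Fin d → (Fin d → ℝ) → ℝ) : ℝ :=
  (eLpNorm (fun x => ∑ i, H i i x) ⊤ (cellMeasure d L)).toReal

/-- `f` is the density on `U` of an absolutely continuous probability measure. -/
def IsProbDensity {d : ℕ} (L : ℝ) (f : (Fin d → ℝ) → ℝ) : Prop :=
  (∀ᵐ x ∂(cellMeasure d L), 0 ≤ f x) ∧ Integrable f (cellMeasure d L) ∧
    ∫ x, f x ∂(cellMeasure d L) = 1

/-! ### The McKean-Vlasov equation with spherical graphop coupling -/

/-- Admissible initial data. -/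
structure IsAdmissible {d : ℕ} (L : ℝ) (ρ₀ : (Fin d → ℝ) → S2 → ℝ) : Prop where
  measurable : Measurable fun p : (Fin d → ℝ) × S2 => ρ₀ p.1 p.2
  sobolev : ∀ᵐ ξ ∂sphereMeasure,
    MemSobolev L (3 + d) (fun x => ρ₀ x ξ) ∧ IsProbDensity L (fun x => ρ₀ x ξ)
  bdd : ∀ x, MemLp (ρ₀ x) ⊤ sphereMeasure

/-- The `i`-th component of the Vlasov term
`V[A](u)(x, ξ) = ∫_U ∇D(x - y) (A u)(y, ξ) dy`, where `G = ∇D`. -/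
def vlasov {d : ℕ} (L : ℝ) (G : Fin d → (Fin d → ℝ) → ℝ) (u : (Fin d → ℝ) → S2 → ℝ)
    (i : Fin d) (x : Fin d → ℝ) (ξ : S2) : ℝ :=
  ∫ y, G i (x - y) * sphericalAverage (u y) ξ ∂(cellMeasure d L)

/-- For fixed `ξ`: `ρ(·, ·, ξ)` is a classical solution on the torus of
`∂ₜ ρ = κ div (ρ V[A](ρ)) + Δ ρ`, `ρ(0) = ρ₀`. -/
structure SolvesAt {d : ℕ} (L κ : ℝ) (G : Fin d → (Fin d → ℝ) → ℝ)
    (ρ₀ : (Fin d → ℝ) → S2 → ℝ) (ρ : ℝ → (Fin d → ℝ) → S2 → ℝ) (ξ : S2) : Prop where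
  periodic : ∀ t, 0 ≤ t → IsPeriodic L (fun x => ρ t x ξ)
  /-- continuity up to the initial time -/
  continuous : ContinuousOn (fun p : ℝ × (Fin d → ℝ) => ρ p.1 p.2 ξ) (Ici 0 ×ˢ univ)
  /-- the initial condition -/
  initial : ∀ᵐ x ∂(cellMeasure d L), ρ 0 x ξ = ρ₀ x ξ
  /-- for positive times `ρ` is continuously differentiable in `t` and twice continuously
  differentiable in `x` -/
  continuous_dt : ContinuousOn
    (fun p : ℝ × (Fin d → ℝ) => deriv (fun s => ρ s p.2 ξ) p.1) (Ioi 0 ×ˢ univ)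
  contDiff : ∀ t, 0 < t → ContDiff ℝ 2 (fun x => ρ t x ξ)
  continuous_dx : ∀ i, ContinuousOn
    (fun p : ℝ × (Fin d → ℝ) => pd i (fun x => ρ p.1 x ξ) p.2) (Ioi 0 ×ˢ univ)
  continuous_dxdx : ∀ i j, ContinuousOn
    (fun p : ℝ × (Fin d → ℝ) => pd j (pd i (fun x => ρ p.1 x ξ)) p.2) (Ioi 0 ×ˢ univ)
  /-- the interaction term is well defined: `∫_U ∫ |ρ(t, y, η)| dν_ξ(η) dy` is finite, locally
  boundedly in `t`. (Then, for a `W^{2,∞}` potential, `x ↦ V[A](ρ)(t, x, ξ)` is automatically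
  continuously differentiable, so that the divergence below is a classical one. The condition
  holds automatically if the `ρ(t, ·, η)` are probability densities.) -/
  interaction : ∀ T : ℝ, ∃ C : ℝ, ∀ t ∈ Icc 0 T,
    Integrable (fun p : (Fin d → ℝ) × S2 => ρ t p.1 p.2)
        ((cellMeasure d L).prod (equatorMeasure ξ)) ∧
      ∫ p : (Fin d → ℝ) × S2, |ρ t p.1 p.2| ∂((cellMeasure d L).prod (equatorMeasure ξ)) ≤ C
  /-- the equation -/
  equation : ∀ t, 0 < t → ∀ x, HasDerivAt (fun s => ρ s x ξ)
    (κ * ∑ i, pd i (fun y => ρ t y ξ * vlasov L G (ρ t) i y ξ) x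
      + ∑ i, pd i (pd i (fun y => ρ t y ξ)) x) t

/-- Classical solutions of the McKean-Vlasov equation with spherical graphop: measurable functions
`ρ(t, x, ξ)` that are classical solutions in `(t, x)` for almost every `ξ`. -/
structure IsClassicalSolution {d : ℕ} (L κ : ℝ) (G : Fin d → (Fin d → ℝ) → ℝ)
    (ρ₀ : (Fin d → ℝ) → S2 → ℝ) (ρ : ℝ → (Fin d → ℝ) → S2 → ℝ) : Prop where
  measurable : Measurable fun p : ℝ × (Fin d → ℝ) × S2 => ρ p.1 p.2.1 p.2.2
  solves : ∀ᵐ ξ ∂sphereMeasure, SolvesAt L κ G ρ₀ ρ ξ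

/-! ### Relative entropy -/

/-- The density `u log (u / ρ∞)` of the relative entropy, with `ρ∞ = 1 / L^d`. -/
def entropyDensity (d : ℕ) (L : ℝ) (u : ℝ) : ℝ :=
  u * Real.log (u / (1 / L ^ d))

/-- The relative entropy `Ĥ(u | ρ∞) = ∫ ∫_U u log (u / ρ∞) dx dμ(ξ)`. -/
def relEntropy {d : ℕ} (L : ℝ) (u : (Fin d → ℝ) → S2 → ℝ) : ℝ :=
  ∫ ξ, ∫ x, entropyDensity d L (u x ξ) ∂(cellMeasure d L) ∂sphereMeasure

/-- Finiteness of the relative entropy. -/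
def FiniteEntropy {d : ℕ} (L : ℝ) (u : (Fin d → ℝ) → S2 → ℝ) : Prop :=
  Integrable (fun p : (Fin d → ℝ) × S2 => entropyDensity d L (u p.1 p.2))
    ((cellMeasure d L).prod sphereMeasure)

end

/-! Part (i). A uniform point on a uniformly chosen great circle has a rotation-invariant law, and
the sphere carries only one such probability measure, so this law is uniform
(`measurePreserving_equatorParam`). Hence `A` preserves integrals. With Jensen's inequality on each
equator, `(Af)² ≤ A(f²)`, this gives `‖Af‖₂ ≤ ‖f‖₂`; constants are fixed, so the norm is exactly
one.

Part (ii). For fixed `ξ` the fibre `u = ρ(·, ·, ξ)` solves a linear Fokker–Planck equation whose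
drift is the Vlasov field. The minimum principle (`nonneg_of_solution`) and conservation of mass
keep it a probability density. Its entropy `h` satisfies, formally, `h' = -∫ |∇u|²/u + κ ∫ (u - ρ∞)
div V`. A logarithmic Sobolev inequality on the torus (`torus_logSobolev`) bounds the first term by
`-(4π²/L²) h`. Since the Hessian of `D` has mean zero, `ρ∞` may be subtracted inside `div V`. With
`p(ξ)` the `L¹` distance of the fibre to `ρ∞`, this yields `|div V| ≤ ‖ΔD‖ (Ap)(ξ)`
(`SolvesAt.abs_div_le`), so the interaction contributes at most `κ‖ΔD‖ (Ap) p`.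

After integration over the sphere the contraction property of `A` gives `∫ (Ap) p ≤ ∫ p²`, and
Pinsker's inequality (`sq_integral_abs_sub_le`) gives `∫ p² ≤ 2Ĥ`. Thus `Ĥ' ≤ -(4π²/L² - 2κ‖ΔD‖) Ĥ`,
and Grönwall's inequality concludes.

The formal computation is made rigorous by replacing `u log u` with `(u + ε) log (u + ε)`,
integrating in time from the continuous initial value, and letting `ε → 0` on each fibre
(`entropy_le`) before averaging over `ξ`. -/

noncomputable section

/-! ### Isometry invariance of the uniform measures on spheres. -/

section Sphere

variable {F F' : Type*} [NormedAddCommGroup F] [InnerProductSpace ℝ F]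
    [MeasurableSpace F] [BorelSpace F]
    [NormedAddCommGroup F'] [InnerProductSpace ℝ F']
    [MeasurableSpace F'] [BorelSpace F']

/-- The map induced by a linear isometry on unit spheres. -/
def sphereMap (J : F →ₗᵢ[ℝ] F') (v : Metric.sphere (0 : F) 1) : Metric.sphere (0 : F') 1 :=
  ⟨J v, by
    have h := v.2
    rw [mem_sphere_zero_iff_norm] at h ⊢
    rw [J.norm_map, h]⟩

lemma measurable_sphereMap (J : F →ₗᵢ[ℝ] F') : Measurable (sphereMap J) :=
  (J.continuous.measurable.comp measurable_subtype_coe).subtype_mk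

variable [FiniteDimensional ℝ F] [FiniteDimensional ℝ F']

lemma isProbabilityMeasure_uniformSphere (h : 0 < Module.finrank ℝ F) :
    IsProbabilityMeasure (uniformSphere F) := by
  have : Nontrivial F := Module.finrank_pos_iff.1 h
  constructor
  rw [uniformSphere, Measure.smul_apply, smul_eq_mul]
  refine ENNReal.inv_mul_cancel ?_ (measure_ne_top _ _)
  rw [Ne, Measure.measure_univ_eq_zero]
  exact Measure.toSphere_ne_zero _

/-- The surface measure of `s` is the dimension times the volume of the cone `Ioo 0 1 • s`; a linear
isometry carries cones to cones and preserves volume. -/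
lemma map_toSphere (e : F ≃ₗᵢ[ℝ] F') :
    ((volume : Measure F).toSphere).map (sphereMap e.toLinearIsometry)
      = (volume : Measure F').toSphere := by
  ext s hs
  have hm := measurable_sphereMap e.toLinearIsometry
  rw [Measure.map_apply hm hs, Measure.toSphere_apply' _ (hm hs), Measure.toSphere_apply' _ hs,
    e.toLinearEquiv.finrank_eq,
    ← e.measurePreserving.measure_preimage_equiv (f := e.toMeasurableEquiv)]
  congr 2
  ext x
  simp only [Set.mem_smul, mem_image, mem_preimage]
  constructor
  · rintro ⟨r, hr, _, ⟨v, hv, rfl⟩, rfl⟩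
    exact ⟨r, hr, _, ⟨_, hv, rfl⟩, by simp [sphereMap]⟩
  · rintro ⟨r, hr, _, ⟨v, hv, rfl⟩, hx⟩
    refine ⟨r, hr, _, ⟨sphereMap e.symm.toLinearIsometry v, ?_, rfl⟩, ?_⟩
    · convert hv
      ext
      simp [sphereMap]
    · apply e.injective
      simpa [sphereMap] using hx

lemma map_uniformSphere (e : F ≃ₗᵢ[ℝ] F') :
    (uniformSphere F).map (sphereMap e.toLinearIsometry) = uniformSphere F' := by
  have h := map_toSphere e
  have h2 : (volume : Measure F).toSphere univ = (volume : Measure F').toSphere univ := by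
    rw [← h, Measure.map_apply (measurable_sphereMap _) MeasurableSet.univ, preimage_univ]
  rw [uniformSphere, uniformSphere, Measure.map_smul, h, h2]

end Sphere

/-! ### Equators as images of a fixed circle. -/

instance : IsProbabilityMeasure sphereMeasure :=
  isProbabilityMeasure_uniformSphere (by simp)

/-- The plane. -/
abbrev E2 : Type := EuclideanSpace ℝ (Fin 2)

/-- The uniform probability measure on the unit circle. -/
def circleMeasure : Measure (Metric.sphere (0 : E2) 1) := uniformSphere E2

instance : IsProbabilityMeasure circleMeasure :=
  isProbabilityMeasure_uniformSphere (by simp)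

/-- A dimension count makes `J` an isometry onto `perpPlane ξ`, so any choice of `J` gives the same
measure. This freedom yields both rotation equivariance and a measurable dependence on `ξ`. -/
lemma equatorMeasure_eq_map (ξ : S2) (J : E2 →ₗᵢ[ℝ] E3)
    (hJ : ∀ v, inner ℝ (ξ : E3) (J v) = 0) :
    equatorMeasure ξ = circleMeasure.map (sphereMap J) := by
  have hmem : ∀ v, J v ∈ perpPlane ξ := fun v => by
    rw [Submodule.mem_orthogonal_singleton_iff_inner_right]
    exact hJ v
  let J' : E2 →ₗᵢ[ℝ] perpPlane ξ :=
    ⟨J.toLinearMap.codRestrict _ hmem, fun v => J.norm_map v⟩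
  have hξ : (ξ : E3) ≠ 0 := by
    intro h
    have := ξ.2
    rw [mem_sphere_zero_iff_norm, h, norm_zero] at this
    exact zero_ne_one this
  have hfin : Module.finrank ℝ E2 = Module.finrank ℝ (perpPlane ξ) := by
    have h1 := (Submodule.span ℝ {(ξ : E3)}).finrank_add_finrank_orthogonal
    rw [finrank_span_singleton hξ, finrank_euclideanSpace_fin] at h1
    rw [finrank_euclideanSpace_fin]
    change 2 = Module.finrank ℝ (Submodule.span ℝ {(ξ : E3)})ᗮ
    omega
  let e := J'.toLinearIsometryEquiv hfin
  have hmeas : Measurable (equatorIncl ξ) :=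
    (measurable_subtype_coe.comp measurable_subtype_coe).subtype_mk
  rw [equatorMeasure, ← map_uniformSphere e, Measure.map_map hmeas (measurable_sphereMap _)]
  rfl

lemma equatorMeasure_map (R : E3 ≃ₗᵢ[ℝ] E3) (ξ : S2) (J : E2 →ₗᵢ[ℝ] E3)
    (hJ : ∀ v, inner ℝ (ξ : E3) (J v) = 0) :
    equatorMeasure (sphereMap R.toLinearIsometry ξ)
      = (equatorMeasure ξ).map (sphereMap R.toLinearIsometry) := by
  rw [equatorMeasure_eq_map ξ J hJ, equatorMeasure_eq_map _ (R.toLinearIsometry.comp J),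
    Measure.map_map (measurable_sphereMap _) (measurable_sphereMap _)]
  · rfl
  · intro v
    simp only [sphereMap, LinearIsometryEquiv.coe_toLinearIsometry, LinearIsometry.coe_comp,
      Function.comp_apply, LinearIsometryEquiv.inner_map_map]
    exact hJ v

/-- First vector of a measurable orthonormal frame of the tangent plane. -/
def frameFst (x : E3) : E3 :=
  -- The eastward unit vector is undefined at the poles, which get a fixed frame. No continuous
  -- frame exists on the sphere; measurability suffices.
  if x 0 ^ 2 + x 1 ^ 2 = 0 then !₂[1, 0, 0] else
    !₂[-x 1 / √(x 0 ^ 2 + x 1 ^ 2), x 0 / √(x 0 ^ 2 + x 1 ^ 2), 0]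

/-- Second vector of a measurable orthonormal frame of the tangent plane. -/
def frameSnd (x : E3) : E3 :=
  if x 0 ^ 2 + x 1 ^ 2 = 0 then !₂[0, 1, 0] else
    !₂[-(x 0 * x 2) / √(x 0 ^ 2 + x 1 ^ 2), -(x 1 * x 2) / √(x 0 ^ 2 + x 1 ^ 2),
      √(x 0 ^ 2 + x 1 ^ 2)]

lemma measurable_vec3 {α : Type*} [MeasurableSpace α] {a b c : α → ℝ} (ha : Measurable a)
    (hb : Measurable b) (hc : Measurable c) : Measurable fun x => (!₂[a x, b x, c x] : E3) := by
  refine (MeasurableEquiv.toLp 2 (Fin 3 → ℝ)).measurable.comp (measurable_pi_lambda _ fun i => ?_)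
  fin_cases i <;> simpa

lemma measurable_frameFst : Measurable frameFst := by
  have h : ∀ i : Fin 3, Measurable fun x : E3 => x i := fun i => by fun_prop
  refine Measurable.ite ?_ measurable_const (measurable_vec3 ?_ ?_ ?_)
  · exact measurableSet_eq_fun (by fun_prop) measurable_const
  all_goals fun_prop

lemma measurable_frameSnd : Measurable frameSnd := by
  refine Measurable.ite ?_ measurable_const (measurable_vec3 ?_ ?_ ?_)
  · exact measurableSet_eq_fun (by fun_prop) measurable_const
  all_goals fun_prop

lemma frame_inner (x : E3) (hx : ‖x‖ = 1) :
    inner ℝ x (frameFst x) = 0 ∧ inner ℝ x (frameSnd x) = 0 ∧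
    inner ℝ (frameFst x) (frameSnd x) = 0 ∧ ‖frameFst x‖ = 1 ∧ ‖frameSnd x‖ = 1 := by
  have hn : x 0 ^ 2 + x 1 ^ 2 + x 2 ^ 2 = 1 := by
    have := EuclideanSpace.real_norm_sq_eq x
    rw [hx, Fin.sum_univ_three] at this
    linarith
  have hkey : ∀ y : E3, ‖y‖ = 1 ↔ y 0 ^ 2 + y 1 ^ 2 + y 2 ^ 2 = 1 := fun y => by
    rw [← sq_eq_sq₀ (norm_nonneg _) zero_le_one, EuclideanSpace.real_norm_sq_eq, Fin.sum_univ_three,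
      one_pow]
  rw [hkey, hkey]
  by_cases h : x 0 ^ 2 + x 1 ^ 2 = 0
  · have h0 : x 0 = 0 := by nlinarith [sq_nonneg (x 0), sq_nonneg (x 1)]
    have h1 : x 1 = 0 := by nlinarith [sq_nonneg (x 0), sq_nonneg (x 1)]
    simp [frameFst, frameSnd, PiLp.inner_apply, Fin.sum_univ_three, h0, h1]
  · have hr : √(x 0 ^ 2 + x 1 ^ 2) ≠ 0 := by
      rw [Ne, Real.sqrt_eq_zero (by positivity)]; exact h
    have hr2 : √(x 0 ^ 2 + x 1 ^ 2) ^ 2 = x 0 ^ 2 + x 1 ^ 2 := Real.sq_sqrt (by positivity)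
    simp only [frameFst, frameSnd, h, if_false, PiLp.inner_apply, Fin.sum_univ_three]
    simp
    generalize √(x 0 ^ 2 + x 1 ^ 2) = r at hr hr2
    refine ⟨by ring, ?_, ?_, ?_, ?_⟩
    · field_simp
      linear_combination (x 2) * hr2
    · ring
    · field_simp
      linear_combination -hr2
    · field_simp
      linear_combination (r ^ 2 - x 2 ^ 2) * hr2 + r ^ 2 * hn

/-- The linear isometry of the plane onto the plane orthogonal to `ξ`. -/
def frameIsometry (ξ : S2) : E2 →ₗᵢ[ℝ] E3 where
  toFun v := v 0 • frameFst ξ + v 1 • frameSnd ξ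
  map_add' v w := by simp only [PiLp.add_apply, add_smul]; abel
  map_smul' c v := by simp [mul_smul]
  norm_map' v := by
    obtain ⟨-, -, h3, h4, h5⟩ := frame_inner ξ (mem_sphere_zero_iff_norm.1 ξ.2)
    have : ‖v 0 • frameFst ξ + v 1 • frameSnd ξ‖ ^ 2 = ‖v‖ ^ 2 := by
      rw [norm_add_sq_real, real_inner_smul_left, real_inner_smul_right, h3,
        EuclideanSpace.real_norm_sq_eq v, norm_smul, norm_smul, h4, h5, Fin.sum_univ_two]
      simp
    exact (sq_eq_sq₀ (norm_nonneg _) (norm_nonneg _)).1 this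

lemma frameIsometry_inner (ξ : S2) (v : E2) : inner ℝ (ξ : E3) (frameIsometry ξ v) = 0 := by
  obtain ⟨h1, h2, -⟩ := frame_inner ξ (mem_sphere_zero_iff_norm.1 ξ.2)
  change inner ℝ (ξ : E3) (v 0 • frameFst ξ + v 1 • frameSnd ξ) = 0
  rw [inner_add_right, real_inner_smul_right, real_inner_smul_right, h1, h2]
  simp

/-- A measurable parametrisation of all equators by a fixed circle. -/
def equatorParam (p : S2 × Metric.sphere (0 : E2) 1) : S2 := sphereMap (frameIsometry p.1) p.2

lemma measurable_equatorParam : Measurable equatorParam := by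
  refine Measurable.subtype_mk ?_
  change Measurable fun p : S2 × Metric.sphere (0 : E2) 1 =>
    (p.2 : E2) 0 • frameFst p.1 + (p.2 : E2) 1 • frameSnd p.1
  have h := measurable_frameFst
  have h' := measurable_frameSnd
  have h1 : ∀ i, Measurable fun p : S2 × Metric.sphere (0 : E2) 1 => (p.2 : E2) i := fun i => by
    fun_prop
  exact ((h1 0).smul (h.comp (measurable_subtype_coe.comp measurable_fst))).add
    ((h1 1).smul (h'.comp (measurable_subtype_coe.comp measurable_fst)))

lemma measurable_equatorParam_right (ξ : S2) : Measurable fun v => equatorParam (ξ, v) :=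
  measurable_equatorParam.comp measurable_prodMk_left

lemma equatorMeasure_eq (ξ : S2) :
    equatorMeasure ξ = circleMeasure.map fun v => equatorParam (ξ, v) :=
  equatorMeasure_eq_map ξ (frameIsometry ξ) (frameIsometry_inner ξ)

instance (ξ : S2) : IsProbabilityMeasure (equatorMeasure ξ) := by
  rw [equatorMeasure_eq]
  exact Measure.isProbabilityMeasure_map
    (measurable_equatorParam_right ξ).aemeasurable

/-! ### Uniqueness of the invariant measure and its disintegration along equators. -/

/-- Reflection in the plane bisecting `x` and `y`, which swaps them because their norms agree. -/
lemma exists_isometry_sphere (x y : S2) :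
    ∃ R : E3 ≃ₗᵢ[ℝ] E3, sphereMap R.toLinearIsometry x = y := by
  refine ⟨(Submodule.span ℝ {(x : E3) - y})ᗮ.reflection, Subtype.ext ?_⟩
  simp only [sphereMap, LinearIsometryEquiv.coe_toLinearIsometry]
  exact Submodule.reflection_sub (by
    rw [mem_sphere_zero_iff_norm.1 x.2, mem_sphere_zero_iff_norm.1 y.2])

/-- A rotation-invariant probability measure on the two-sphere is unique. -/
lemma sphere_measure_unique (m m' : Measure S2) [IsProbabilityMeasure m] [IsProbabilityMeasure m']
    (h : ∀ R : E3 ≃ₗᵢ[ℝ] E3, m.map (sphereMap R.toLinearIsometry) = m)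
    (h' : ∀ R : E3 ≃ₗᵢ[ℝ] E3, m'.map (sphereMap R.toLinearIsometry) = m') : m = m' := by
  -- `∫ k s x y dm(x)` is the characteristic function of `m` at the point `s y`; by invariance it
  -- depends only on `s`.
  let k : ℝ → S2 → S2 → ℂ := fun s x y => Complex.exp ((s * inner ℝ (x : E3) (y : E3) : ℝ) * Complex.I)
  have hk : ∀ s, Continuous fun p : S2 × S2 => k s p.1 p.2 := fun s => by
    simp only [k]; fun_prop
  have hkn : ∀ s x y, ‖k s x y‖ = 1 := fun s x y => Complex.norm_exp_ofReal_mul_I _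
  have hinv : ∀ (m : Measure S2) (_ : ∀ R : E3 ≃ₗᵢ[ℝ] E3, m.map (sphereMap R.toLinearIsometry) = m)
      (s : ℝ) (y z : S2), ∫ x, k s x y ∂m = ∫ x, k s x z ∂m := by
    intro m h s y z
    obtain ⟨R, hR⟩ := exists_isometry_sphere y z
    conv_rhs => rw [← h R]
    have hc : Continuous fun x => k s x z := (hk s).comp (by fun_prop : Continuous fun x : S2 => (x, z))
    rw [integral_map (measurable_sphereMap _).aemeasurable hc.aestronglyMeasurable]
    congr 1
    ext x
    simp only [k, ← hR, sphereMap, LinearIsometryEquiv.coe_toLinearIsometry,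
      LinearIsometryEquiv.inner_map_map]
  have hsymm : ∀ s x y, k s x y = k s y x := fun s x y => by simp only [k, real_inner_comm]
  have hint : ∀ s, Integrable (fun p : S2 × S2 => k s p.1 p.2) (m.prod m') := fun s =>
    (integrable_const (1 : ℝ)).mono' (hk s).aestronglyMeasurable
      (Filter.Eventually.of_forall fun p => (hkn s _ _).le)
  -- In the double integral of the symmetric kernel either inner integral is constant, so Fubini
  -- identifies the constants of `m` and `m'`.
  have heq : ∀ (s : ℝ) (y : S2), ∫ x, k s x y ∂m = ∫ x, k s x y ∂m' := by
    intro s y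
    have h1 := integral_prod _ (hint s)
    have h2 := integral_prod_symm _ (hint s)
    simp only at h1 h2
    rw [h1] at h2
    have e1 : ∀ x, ∫ z, k s x z ∂m' = ∫ z, k s z y ∂m' := fun x => by
      rw [← hinv m' h' s x y]; simp only [hsymm s x]
    simp only [e1, hinv m h s _ y, integral_const, probReal_univ, one_smul] at h2
    exact h2.symm
  have hE : m.map ((↑) : S2 → E3) = m'.map ((↑) : S2 → E3) := by
    have := Measure.isProbabilityMeasure_map (μ := m) measurable_subtype_coe.aemeasurable
    have := Measure.isProbabilityMeasure_map (μ := m') measurable_subtype_coe.aemeasurable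
    refine Measure.ext_of_charFun (funext fun t => ?_)
    have hc : Continuous fun x : E3 => Complex.exp ((inner ℝ x t : ℝ) * Complex.I) := by fun_prop
    rw [charFun_apply, charFun_apply, integral_map measurable_subtype_coe.aemeasurable
      hc.aestronglyMeasurable, integral_map measurable_subtype_coe.aemeasurable
      hc.aestronglyMeasurable]
    by_cases ht : t = 0
    · simp [ht]
    · have hu : ‖t‖⁻¹ • t ∈ Metric.sphere (0 : E3) 1 := by
        rw [mem_sphere_zero_iff_norm, norm_smul, norm_inv, norm_norm]
        exact inv_mul_cancel₀ (norm_ne_zero_iff.2 ht)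
      have := heq ‖t‖ ⟨_, hu⟩
      simpa only [k, real_inner_smul_right, ← mul_assoc, mul_inv_cancel₀ (norm_ne_zero_iff.2 ht),
        one_mul] using this
  ext s hs
  have he : MeasurableEmbedding ((↑) : S2 → E3) :=
    MeasurableEmbedding.subtype_coe Metric.isClosed_sphere.measurableSet
  have := congrArg (fun M => M ((↑) '' s)) hE
  simpa [he.map_apply, preimage_image_eq _ Subtype.val_injective] using this

/-- The law of the image gives `s` the mass `∫ equatorMeasure ξ s dμ(ξ)`. This is rotation invariant
by `equatorMeasure_map`, hence uniform by `sphere_measure_unique`. -/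
lemma measurePreserving_equatorParam :
    MeasurePreserving equatorParam (sphereMeasure.prod circleMeasure) sphereMeasure := by
  refine ⟨measurable_equatorParam, ?_⟩
  have := Measure.isProbabilityMeasure_map (μ := sphereMeasure.prod circleMeasure)
    measurable_equatorParam.aemeasurable
  refine sphere_measure_unique _ _ (fun R => ?_) fun R => map_uniformSphere R
  have hR := measurable_sphereMap R.toLinearIsometry
  have hap : ∀ s, MeasurableSet s →
      (sphereMeasure.prod circleMeasure).map equatorParam s
        = ∫⁻ ξ, equatorMeasure ξ s ∂sphereMeasure := fun s hs => by
    rw [Measure.map_apply measurable_equatorParam hs,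
      Measure.prod_apply (measurable_equatorParam hs)]
    congr 1
    ext ξ
    rw [equatorMeasure_eq, Measure.map_apply (measurable_equatorParam_right ξ) hs]
    rfl
  have hmeas : ∀ s, MeasurableSet s → Measurable fun ξ => equatorMeasure ξ s := fun s hs => by
    have := measurable_measure_prodMk_left (ν := circleMeasure) (measurable_equatorParam hs)
    convert this using 2 with ξ
    rw [equatorMeasure_eq, Measure.map_apply (measurable_equatorParam_right ξ) hs]
    rfl
  ext s hs
  rw [Measure.map_apply hR hs, hap _ (hR hs), hap _ hs]
  have e1 : ∀ ξ, equatorMeasure ξ (sphereMap R.toLinearIsometry ⁻¹' s)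
      = equatorMeasure (sphereMap R.toLinearIsometry ξ) s := fun ξ => by
    rw [equatorMeasure_map R ξ (frameIsometry ξ) (frameIsometry_inner ξ),
      Measure.map_apply hR hs]
  simp_rw [e1]
  rw [← lintegral_map (f := fun ξ => equatorMeasure ξ s) (hmeas s hs) hR]
  congr 1
  exact map_uniformSphere R


/-! ### Averaging over equators as an operator on square-integrable functions. -/

/-- Each equator is itself a null set, yet by the disintegration almost every equator meets a given
null set in a null set. This makes `A` well defined on almost-everywhere classes. -/
lemma ae_equatorMeasure_of_ae {P : S2 → Prop} (h : ∀ᵐ η ∂sphereMeasure, P η) :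
    ∀ᵐ ξ ∂sphereMeasure, ∀ᵐ η ∂equatorMeasure ξ, P η := by
  obtain ⟨s, hs, hsm, hs0⟩ := exists_measurable_superset_of_null (ae_iff.1 h)
  have h0 := measurePreserving_equatorParam.quasiMeasurePreserving.preimage_null hs0
  have h1 := (Measure.measure_prod_null (measurable_equatorParam hsm)).1 h0
  filter_upwards [h1] with ξ hξ
  refine measure_mono_null hs ?_
  rw [equatorMeasure_eq, Measure.map_apply (measurable_equatorParam_right ξ) hsm]
  exact hξ

lemma sphericalAverage_eq {f : S2 → ℝ} {ξ : S2} (hf : AEStronglyMeasurable f (equatorMeasure ξ)) :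
    sphericalAverage f ξ = ∫ v, f (equatorParam (ξ, v)) ∂circleMeasure := by
  rw [equatorMeasure_eq] at hf
  rw [sphericalAverage, equatorMeasure_eq,
    integral_map (measurable_equatorParam_right ξ).aemeasurable hf]

lemma ae_aestronglyMeasurable_equator {f : S2 → ℝ} (hf : AEStronglyMeasurable f sphereMeasure) :
    ∀ᵐ ξ ∂sphereMeasure, AEStronglyMeasurable f (equatorMeasure ξ) := by
  filter_upwards [ae_equatorMeasure_of_ae hf.ae_eq_mk] with ξ hξ
  exact ⟨_, hf.stronglyMeasurable_mk, hξ⟩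

lemma ae_sphericalAverage_eq {f : S2 → ℝ} (hf : AEStronglyMeasurable f sphereMeasure) :
    sphericalAverage f =ᵐ[sphereMeasure] fun ξ => ∫ v, f (equatorParam (ξ, v)) ∂circleMeasure := by
  filter_upwards [ae_aestronglyMeasurable_equator hf] with ξ hξ using sphericalAverage_eq hξ

lemma aestronglyMeasurable_sphericalAverage {f : S2 → ℝ}
    (hf : AEStronglyMeasurable f sphereMeasure) :
    AEStronglyMeasurable (sphericalAverage f) sphereMeasure := by
  refine AEStronglyMeasurable.congr ?_ (ae_sphericalAverage_eq hf).symm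
  have := hf.comp_measurePreserving measurePreserving_equatorParam
  exact this.integral_prod_right'

lemma ae_integrable_equator {f : S2 → ℝ} (hf : Integrable f sphereMeasure) :
    ∀ᵐ ξ ∂sphereMeasure, Integrable f (equatorMeasure ξ) := by
  have h1 := (measurePreserving_equatorParam.integrable_comp hf.aestronglyMeasurable).2 hf
  filter_upwards [h1.prod_right_ae, ae_aestronglyMeasurable_equator hf.aestronglyMeasurable]
    with ξ h2 h3
  rw [equatorMeasure_eq] at h3 ⊢
  exact (integrable_map_measure h3 (measurable_equatorParam_right ξ).aemeasurable).2 h2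

lemma integrable_sphericalAverage {f : S2 → ℝ} (hf : Integrable f sphereMeasure) :
    Integrable (sphericalAverage f) sphereMeasure := by
  have h1 := (measurePreserving_equatorParam.integrable_comp hf.aestronglyMeasurable).2 hf
  exact h1.integral_prod_left.congr (ae_sphericalAverage_eq hf.aestronglyMeasurable).symm

lemma integral_sphericalAverage {f : S2 → ℝ} (hf : Integrable f sphereMeasure) :
    ∫ ξ, sphericalAverage f ξ ∂sphereMeasure = ∫ ξ, f ξ ∂sphereMeasure := by
  have h1 := (measurePreserving_equatorParam.integrable_comp hf.aestronglyMeasurable).2 hf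
  have h2 := integral_prod _ h1
  rw [integral_congr_ae (ae_sphericalAverage_eq hf.aestronglyMeasurable)]
  refine h2.symm.trans ?_
  have h3 : AEStronglyMeasurable f
      ((sphereMeasure.prod circleMeasure).map equatorParam) := by
    rw [measurePreserving_equatorParam.map_eq]
    exact hf.aestronglyMeasurable
  have h4 := integral_map measurePreserving_equatorParam.aemeasurable h3
  rw [measurePreserving_equatorParam.map_eq] at h4
  exact h4.symm

/-- The variance of `f` under `equatorMeasure ξ` is nonnegative. -/
lemma sphericalAverage_sq_le {f : S2 → ℝ} {ξ : S2} (hf : Integrable f (equatorMeasure ξ))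
    (hf2 : Integrable (fun η => f η ^ 2) (equatorMeasure ξ)) :
    sphericalAverage f ξ ^ 2 ≤ sphericalAverage (fun η => f η ^ 2) ξ := by
  have h : 0 ≤ ∫ η, (f η - sphericalAverage f ξ) ^ 2 ∂equatorMeasure ξ :=
    integral_nonneg fun η => sq_nonneg _
  have e : ∀ η, (f η - sphericalAverage f ξ) ^ 2
      = f η ^ 2 - 2 * sphericalAverage f ξ * f η + sphericalAverage f ξ ^ 2 := fun η => by ring
  simp only [e] at h
  rw [integral_add (f := fun η => f η ^ 2 - 2 * sphericalAverage f ξ * f η)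
      (hf2.sub (hf.const_mul _)) (integrable_const _), integral_sub hf2 (hf.const_mul _), integral_const_mul, integral_const, probReal_univ,
    one_smul] at h
  change 0 ≤ sphericalAverage (fun η => f η ^ 2) ξ
    - 2 * sphericalAverage f ξ * sphericalAverage f ξ + sphericalAverage f ξ ^ 2 at h
  nlinarith

/-- Jensen's inequality on almost every equator, integrated with `integral_sphericalAverage`. -/
lemma memLp_sphericalAverage {f : S2 → ℝ} (hf : MemLp f 2 sphereMeasure) :
    MemLp (sphericalAverage f) 2 sphereMeasure ∧
    ∫ ξ, sphericalAverage f ξ ^ 2 ∂sphereMeasure ≤ ∫ ξ, f ξ ^ 2 ∂sphereMeasure := by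
  have hi : Integrable f sphereMeasure := hf.integrable (by norm_num)
  have hm := aestronglyMeasurable_sphericalAverage hf.1
  have hsq := (memLp_two_iff_integrable_sq hf.1).1 hf
  have hle : ∀ᵐ ξ ∂sphereMeasure,
      sphericalAverage f ξ ^ 2 ≤ sphericalAverage (fun η => f η ^ 2) ξ := by
    filter_upwards [ae_integrable_equator hi, ae_integrable_equator hsq] with ξ h1 h2
    exact sphericalAverage_sq_le h1 h2
  have hI := integrable_sphericalAverage hsq
  have hI2 : Integrable (fun ξ => sphericalAverage f ξ ^ 2) sphereMeasure := by
    refine hI.mono' (hm.pow 2) ?_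
    filter_upwards [hle] with ξ h
    rwa [Real.norm_of_nonneg (sq_nonneg _)]
  refine ⟨(memLp_two_iff_integrable_sq hm).2 hI2, ?_⟩
  rw [← integral_sphericalAverage hsq]
  exact integral_mono_ae hI2 hI hle

lemma lp_two_norm_sq (g : Lp ℝ 2 sphereMeasure) :
    ‖g‖ ^ 2 = ∫ ξ, g ξ ^ 2 ∂sphereMeasure := by
  rw [← real_inner_self_eq_norm_sq, L2.inner_def]
  congr 1
  ext ξ
  simp [pow_two]

lemma sphericalAverage_congr {f g : S2 → ℝ} (h : f =ᵐ[sphereMeasure] g) :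
    sphericalAverage f =ᵐ[sphereMeasure] sphericalAverage g := by
  filter_upwards [ae_equatorMeasure_of_ae h] with ξ hξ using integral_congr_ae hξ

/-- The spherical graphop is a bounded operator on `L²` of operator norm one. -/
theorem exists_sphericalGraphop :
    ∃ A : Lp ℝ 2 sphereMeasure →L[ℝ] Lp ℝ 2 sphereMeasure,
      (∀ (f : S2 → ℝ) (hf : MemLp f 2 sphereMeasure),
        A (hf.toLp f) =ᵐ[sphereMeasure] sphericalAverage f) ∧ ‖A‖ = 1 := by
  have hM : ∀ g : Lp ℝ 2 sphereMeasure, MemLp (sphericalAverage g) 2 sphereMeasure :=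
    fun g => (memLp_sphericalAverage (Lp.memLp g)).1
  let A₀ : Lp ℝ 2 sphereMeasure →ₗ[ℝ] Lp ℝ 2 sphereMeasure :=
    { toFun := fun g => (hM g).toLp _
      map_add' := fun g h => by
        rw [← MemLp.toLp_add]
        refine MemLp.toLp_congr _ _ ?_
        have hg := (Lp.memLp g).integrable (by norm_num)
        have hh := (Lp.memLp h).integrable (by norm_num)
        filter_upwards [sphericalAverage_congr (Lp.coeFn_add g h), ae_integrable_equator hg,
          ae_integrable_equator hh] with ξ h1 h2 h3
        rw [h1]
        exact integral_add h2 h3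
      map_smul' := fun c g => by
        rw [RingHom.id_apply, ← MemLp.toLp_const_smul]
        refine MemLp.toLp_congr _ _ ?_
        filter_upwards [sphericalAverage_congr (Lp.coeFn_smul c g)] with ξ h1
        rw [h1]
        exact integral_const_mul c _ }
  have hA : ∀ g, ‖A₀ g‖ ≤ 1 * ‖g‖ := fun g => by
    rw [one_mul, ← sq_le_sq₀ (norm_nonneg _) (norm_nonneg _), lp_two_norm_sq, lp_two_norm_sq]
    refine le_of_eq_of_le (integral_congr_ae ?_) (memLp_sphericalAverage (Lp.memLp g)).2
    filter_upwards [(hM g).coeFn_toLp] with ξ hξ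
    exact congrArg (· ^ 2) hξ
  have hf : ∀ (f : S2 → ℝ) (hf : MemLp f 2 sphereMeasure),
        A₀.mkContinuous 1 hA (hf.toLp f) =ᵐ[sphereMeasure] sphericalAverage f := fun f hf =>
    (hM _).coeFn_toLp.trans (sphericalAverage_congr hf.coeFn_toLp)
  refine ⟨A₀.mkContinuous 1 hA, hf, le_antisymm (A₀.mkContinuous_norm_le zero_le_one hA) ?_⟩
  -- The constant function is a unit vector fixed by the operator, so the norm is at least one.
  have h1 : MemLp (fun _ : S2 => (1 : ℝ)) 2 sphereMeasure := memLp_const 1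
  have h2 : ∫ ξ, (h1.toLp _ : S2 → ℝ) ξ ^ 2 ∂sphereMeasure = 1 := by
    rw [integral_congr_ae (g := fun _ => (1 : ℝ))]
    · simp
    · filter_upwards [h1.coeFn_toLp] with ξ hξ
      rw [hξ, one_pow]
  have h3 : A₀.mkContinuous 1 hA (h1.toLp _) = h1.toLp _ := by
    refine Lp.ext ((hf _ h1).trans ?_)
    filter_upwards [h1.coeFn_toLp] with ξ hξ
    rw [hξ]
    simp [sphericalAverage]
  have h4 := (A₀.mkContinuous 1 hA).le_opNorm (h1.toLp _)
  rw [h3] at h4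
  have h5 : ‖h1.toLp _‖ ^ 2 = 1 := (lp_two_norm_sq _).trans h2
  have h6 : ‖h1.toLp _‖ = 1 := by
    rwa [← sq_eq_sq₀ (norm_nonneg _) zero_le_one, one_pow]
  rwa [h6, mul_one] at h4

/-! ### Integration of periodic functions over the cell. -/

section Torus

/-- The lattice of periods `(L ℤ)^d`. -/
def periodLattice (d : ℕ) (L : ℝ) : AddSubgroup (Fin d → ℝ) :=
  (AddMonoidHom.mk' (fun (n : Fin d → ℤ) (i : Fin d) => n i • L)
    (fun m n => by ext i; simp [add_mul])).range

instance (d : ℕ) (L : ℝ) : Countable (periodLattice d L) :=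
  (Set.countable_range _).to_subtype

/-- The translations that fix `f` form a subgroup containing the generators of the lattice. -/
lemma IsPeriodic.add_mem {d : ℕ} {L : ℝ} {f : (Fin d → ℝ) → ℝ} (hf : IsPeriodic L f)
    {c : Fin d → ℝ} (hc : c ∈ periodLattice d L) (x : Fin d → ℝ) : f (c + x) = f x := by
  let S : AddSubgroup (Fin d → ℝ) :=
    { carrier := {c | ∀ x, f (c + x) = f x}
      zero_mem' := fun x => by rw [zero_add]
      add_mem' := fun {a b} ha hb x => by rw [add_assoc, ha, hb]
      neg_mem' := fun {a} ha x => by rw [← ha (-a + x), add_neg_cancel_left] }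
  have h1 : ∀ i, Pi.single i L ∈ S := fun i x => by rw [add_comm]; exact hf x i
  obtain ⟨n, rfl⟩ := hc
  have h2 : (fun i => n i • L) = ∑ i, n i • (Pi.single i L : Fin d → ℝ) := by
    ext j
    simp [Finset.sum_apply, Pi.single_apply]
  have h3 : (fun i => n i • L) ∈ S := by
    rw [h2]
    exact S.sum_mem fun i _ => S.zsmul_mem (h1 i) _
  exact h3 x

/-- A half-open cell with corner `a`. -/
def box {d : ℕ} (L : ℝ) (a : Fin d → ℝ) : Set (Fin d → ℝ) :=
  univ.pi fun i => Ico (a i) (a i + L)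

lemma isAddFundamentalDomain_box {d : ℕ} {L : ℝ} (hL : 0 < L) (a : Fin d → ℝ) :
    IsAddFundamentalDomain (periodLattice d L) (box L a) volume := by
  refine IsAddFundamentalDomain.mk'
    (MeasurableSet.univ_pi fun i => measurableSet_Ico).nullMeasurableSet fun x => ?_
  choose n hn hn' using fun i => existsUnique_add_zsmul_mem_Ico hL (x i) (a i)
  refine ⟨⟨fun i => n i • L, n, rfl⟩, fun i _ => ?_, ?_⟩
  · have := hn i
    simp only [] at this
    change n i • L + x i ∈ _
    rwa [add_comm]
  · rintro ⟨_, m, rfl⟩ hm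
    ext i
    have := hn' i (m i) (by
      have := hm i (mem_univ i)
      change m i • L + x i ∈ _ at this
      rwa [add_comm] at this)
    change m i • L = n i • L
    rw [this]

lemma box_ae_eq_Icc {d : ℕ} (L : ℝ) (a : Fin d → ℝ) :
    box L a =ᵐ[volume] univ.pi fun i => Icc (a i) (a i + L) :=
  Measure.ae_eq_set_pi fun _ _ => Ico_ae_eq_Icc

lemma box_ae_eq_cell (d : ℕ) (L : ℝ) : box L (fun _ : Fin d => -L / 2) =ᵐ[volume] cell d L := by
  have := box_ae_eq_Icc L (fun _ : Fin d => -L / 2)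
  rwa [show -L / 2 + L = L / 2 by ring] at this

lemma cellMeasure_eq_restrict_box (d : ℕ) (L : ℝ) :
    cellMeasure d L = volume.restrict (box L (fun _ : Fin d => -L / 2)) :=
  (Measure.restrict_congr_set (box_ae_eq_cell d L)).symm

lemma measurableSet_cell (d : ℕ) (L : ℝ) : MeasurableSet (cell d L) :=
  MeasurableSet.univ_pi fun _ => measurableSet_Icc

lemma isCompact_cell (d : ℕ) (L : ℝ) : IsCompact (cell d L) :=
  isCompact_univ_pi fun _ => isCompact_Icc

instance (d : ℕ) (L : ℝ) : IsFiniteMeasure (cellMeasure d L) :=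
  ⟨by rw [cellMeasure, Measure.restrict_apply_univ]; exact (isCompact_cell d L).measure_lt_top⟩

lemma cellMeasure_real_univ {d : ℕ} {L : ℝ} (hL : 0 < L) : (cellMeasure d L).real univ = L ^ d := by
  rw [measureReal_def, cellMeasure, Measure.restrict_apply_univ, cell, volume_pi_pi]
  simp [show L / 2 - -L / 2 = L by ring, hL.le]

variable {d : ℕ} {L : ℝ} {f : (Fin d → ℝ) → ℝ}

/-- The shifted half-open box is another fundamental domain of the same lattice. -/
lemma integral_cell_add (hL : 0 < L) (hf : IsPeriodic L f) (c : Fin d → ℝ) :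
    ∫ x, f (x + c) ∂cellMeasure d L = ∫ x, f x ∂cellMeasure d L := by
  rw [cellMeasure_eq_restrict_box]
  have h1 : box L (fun _ : Fin d => -L / 2) = (fun x => x + c) ⁻¹' box L (fun i => -L / 2 + c i) := by
    ext x
    simp only [box, mem_univ_pi, mem_Ico, mem_preimage, Pi.add_apply]
    refine forall_congr' fun i => ?_
    constructor <;> rintro ⟨h1, h2⟩ <;> constructor <;> linarith
  conv_lhs => rw [h1]
  rw [(measurePreserving_add_right volume c).setIntegral_preimage_emb
    (MeasurableEquiv.addRight c).measurableEmbedding]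
  exact (isAddFundamentalDomain_box hL _).setIntegral_eq (isAddFundamentalDomain_box hL _)
    fun g x => hf.add_mem g.2 x

lemma integral_cell_neg (f : (Fin d → ℝ) → ℝ) :
    ∫ x, f (-x) ∂cellMeasure d L = ∫ x, f x ∂cellMeasure d L := by
  have h1 : cell d L = (fun x => -x) ⁻¹' cell d L := by
    ext x
    simp only [cell, mem_univ_pi, mem_Icc, mem_preimage, Pi.neg_apply]
    refine forall_congr' fun i => ?_
    constructor <;> rintro ⟨h1, h2⟩ <;> constructor <;> linarith
  rw [cellMeasure]
  conv_lhs => rw [h1]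
  exact (Measure.measurePreserving_neg volume).setIntegral_preimage_emb
    (MeasurableEquiv.neg _).measurableEmbedding _ _

lemma integral_cell_sub (hL : 0 < L) (hf : IsPeriodic L f) (c : Fin d → ℝ) :
    ∫ y, f (c - y) ∂cellMeasure d L = ∫ x, f x ∂cellMeasure d L := by
  rw [← integral_cell_add hL hf c, ← integral_cell_neg fun x => f (x + c)]
  simp only [neg_add_eq_sub]

lemma ae_volume_of_ae_cell (hL : 0 < L) (hf : IsPeriodic L f) {P : ℝ → Prop}
    (h : ∀ᵐ x ∂cellMeasure d L, P (f x)) : ∀ᵐ x, P (f x) := by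
  refine (isAddFundamentalDomain_box hL (fun _ : Fin d => -L / 2)).measure_zero_of_invariant
    {x | ¬ P (f x)} (fun g => ?_) ?_
  · ext x
    rw [Set.mem_vadd_set_iff_neg_vadd_mem]
    change ¬ P (f ((-g : periodLattice d L) + x)) ↔ ¬ P (f x)
    rw [hf.add_mem (-g : periodLattice d L).2]
  · rw [cellMeasure_eq_restrict_box, ae_iff, Measure.restrict_apply₀'] at h
    · exact h
    · exact (MeasurableSet.univ_pi fun i => measurableSet_Ico).nullMeasurableSet

lemma Continuous.integrable_cell {E : Type*} [NormedAddCommGroup E] {f : (Fin d → ℝ) → E}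
    (hf : Continuous f) : Integrable f (cellMeasure d L) :=
  hf.continuousOn.integrableOn_compact (isCompact_cell d L)

/-- Every point has a representative in the cell. -/
lemma exists_mem_cell (hL : 0 < L) (x : Fin d → ℝ) :
    ∃ c ∈ periodLattice d L, c + x ∈ cell d L := by
  choose n hn hn' using fun i => existsUnique_add_zsmul_mem_Ico hL (x i) (-L / 2)
  refine ⟨fun i => n i • L, ⟨n, rfl⟩, fun i _ => ?_⟩
  have := hn i
  simp only [mem_Ico] at this
  change n i • L + x i ∈ _
  constructor <;> linarith

lemma IsPeriodic.forall_of_cell (hL : 0 < L) (hf : IsPeriodic L f) {P : ℝ → Prop}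
    (h : ∀ x ∈ cell d L, P (f x)) (x : Fin d → ℝ) : P (f x) := by
  obtain ⟨c, hc, hcx⟩ := exists_mem_cell hL x
  rw [← hf.add_mem hc]
  exact h _ hcx

lemma isPeriodic_of_hasLineDerivAt (hf : IsPeriodic L f) {f' : (Fin d → ℝ) → ℝ} {v : Fin d → ℝ}
    (h : ∀ x, HasLineDerivAt ℝ f (f' x) x v) : IsPeriodic L f' := fun x i => by
  have h1 := h (x + Pi.single i L)
  refine HasDerivAt.unique h1 ?_
  have h2 : (fun t : ℝ => f (x + Pi.single i L + t • v)) = fun t => f (x + t • v) := by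
    ext t
    rw [add_right_comm, hf]
  rw [h2]
  exact h x

lemma hasDerivAt_line {f' : (Fin d → ℝ) → ℝ} {v : Fin d → ℝ}
    (h : ∀ x, HasLineDerivAt ℝ f (f' x) x v) (x : Fin d → ℝ) (s : ℝ) :
    HasDerivAt (fun t : ℝ => f (x + t • v)) (f' (x + s • v)) s := by
  have h1 : HasDerivAt (fun t : ℝ => f (x + s • v + t • v)) (f' (x + s • v)) 0 := h (x + s • v)
  have h2 := HasDerivAt.comp_sub_const s s (f := fun t : ℝ => f (x + s • v + t • v))
    (f' := f' (x + s • v)) (by rwa [sub_self])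
  refine h2.congr_of_eventuallyEq (Filter.Eventually.of_forall fun t => ?_)
  simp only [add_assoc, ← add_smul]
  congr 3
  ring

/-- The integral over the cell of a continuous partial derivative of a periodic function
vanishes. -/
lemma integral_cell_lineDeriv_eq_zero (hL : 0 < L) (hf : IsPeriodic L f) (hfc : Continuous f)
    {f' : (Fin d → ℝ) → ℝ} (hf' : Continuous f') {v : Fin d → ℝ}
    (h : ∀ x, HasLineDerivAt ℝ f (f' x) x v) : ∫ x, f' x ∂cellMeasure d L = 0 := by
  have hp := isPeriodic_of_hasLineDerivAt hf h
  have hline := fun x s => hasDerivAt_line h x s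
  -- The double integral of `f' (x + s • v)` is computed twice: in `s` first it is a difference of
  -- two equal integrals, in `x` first it is the wanted integral for every `s`. No slicing along `v`
  -- is needed.
  have h1 : ∀ x, ∫ s in (0 : ℝ)..1, f' (x + s • v) = f (x + v) - f x := fun x => by
    rw [intervalIntegral.integral_eq_sub_of_hasDerivAt (fun s _ => hline x s)
      ((by fun_prop : Continuous fun s : ℝ => f' (x + s • v)).intervalIntegrable _ _)]
    simp
  have h2 : ∫ x, (∫ s in (0 : ℝ)..1, f' (x + s • v)) ∂cellMeasure d L = 0 := by
    simp only [h1]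
    rw [integral_sub (by fun_prop : Continuous fun x => f (x + v)).integrable_cell
      hfc.integrable_cell, integral_cell_add hL hf, sub_self]
  have h3 : ∫ x, (∫ s in (0 : ℝ)..1, f' (x + s • v)) ∂cellMeasure d L
      = ∫ s in (0 : ℝ)..1, ∫ x, f' (x + s • v) ∂cellMeasure d L := by
    simp only [intervalIntegral.integral_of_le zero_le_one]
    refine integral_integral_swap ?_
    rw [cellMeasure, Measure.prod_restrict]
    have hc : ContinuousOn (fun p : (Fin d → ℝ) × ℝ => f' (p.1 + p.2 • v))
      (cell d L ×ˢ Icc 0 1) := by fun_prop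
    exact (hc.integrableOn_compact ((isCompact_cell d L).prod isCompact_Icc)).mono_set
      (prod_mono_right Ioc_subset_Icc_self)
  rw [h3] at h2
  simpa [integral_cell_add hL hp] using h2

end Torus

/-! ### Classical differentiability of convolutions with a weakly differentiable bounded kernel. -/

section Convolution
open Filter Topology
open scoped Convolution ContDiff

variable {d : ℕ} {g h b c : (Fin d → ℝ) → ℝ} {K : ℝ}

lemma integrable_comp_sub_mul (hg : AEStronglyMeasurable g volume) (hK : ∀ᵐ x, |g x| ≤ K)
    (hb : Integrable b) (x : Fin d → ℝ) : Integrable fun y => g (x - y) * b y := by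
  have hq := quasiMeasurePreserving_sub_left_of_right_invariant
    (volume : Measure (Fin d → ℝ)) x
  exact hb.bdd_mul (c := K) (hg.comp_quasiMeasurePreserving hq) (hq.ae hK)

lemma abs_integral_comp_sub_mul_le (hK : ∀ᵐ x, |g x| ≤ K) (hb : Integrable b) (x : Fin d → ℝ) :
    |∫ y, g (x - y) * b y| ≤ K * ∫ y, |b y| := by
  have hq := quasiMeasurePreserving_sub_left_of_right_invariant
    (volume : Measure (Fin d → ℝ)) x
  rw [← integral_const_mul, ← Real.norm_eq_abs]
  refine norm_integral_le_of_norm_le (hb.abs.const_mul K) ?_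
  filter_upwards [hq.ae hK] with y hy
  rw [norm_mul, Real.norm_eq_abs, Real.norm_eq_abs]
  gcongr

/-- Smooth compactly supported approximation in `L¹`. -/
lemma exists_smooth_seq (hb : Integrable b) :
    ∃ φ : ℕ → (Fin d → ℝ) → ℝ, (∀ n, HasCompactSupport (φ n)) ∧ (∀ n, ContDiff ℝ ∞ (φ n)) ∧
      Tendsto (fun n => ∫ y, |b y - φ n y|) atTop (𝓝 0) := by
  have h1 : MemLp b 1 volume := memLp_one_iff_integrable.2 hb
  choose φ h2 h3 h4 using fun n : ℕ => h1.exist_eLpNorm_sub_le ENNReal.one_ne_top le_rfl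
    (ε := 1 / (n + 1 : ℝ)) (by positivity)
  refine ⟨φ, h2, h3, squeeze_zero (fun n => integral_nonneg fun y => abs_nonneg _) (fun n => ?_)
    tendsto_one_div_add_atTop_nhds_zero_nat⟩
  have h5 : Integrable (b - φ n) :=
    hb.sub ((h3 n).continuous.integrable_of_hasCompactSupport (h2 n))
  have h6 := h4 n
  rw [eLpNorm_one_eq_lintegral_enorm] at h6
  have h7 : ∫ y, |b y - φ n y| = (∫⁻ y, ‖(b - φ n) y‖ₑ).toReal :=
    integral_norm_eq_lintegral_enorm h5.1
  rw [h7]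
  exact ENNReal.toReal_le_of_le_ofReal (by positivity) h6

/-- Young's inequality with a bounded kernel turns `L¹` convergence of the densities into uniform
convergence, so that continuity and differentiability pass from test functions to integrable `b`. -/
lemma tendstoUniformly_convolution (hg : AEStronglyMeasurable g volume) (hK : ∀ᵐ x, |g x| ≤ K)
    (hb : Integrable b) {φ : ℕ → (Fin d → ℝ) → ℝ} (hφ : ∀ n, Integrable (φ n))
    (hlim : Tendsto (fun n => ∫ y, |b y - φ n y|) atTop (𝓝 0)) :
    TendstoUniformly (fun n x => ∫ y, g (x - y) * φ n y) (fun x => ∫ y, g (x - y) * b y)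
      atTop := by
  rw [Metric.tendstoUniformly_iff]
  intro ε hε
  have h1 : Tendsto (fun n => K * ∫ y, |b y - φ n y|) atTop (𝓝 0) := by
    simpa using hlim.const_mul K
  filter_upwards [h1.eventually (gt_mem_nhds hε)] with n hn x
  rw [Real.dist_eq, ← integral_sub (integrable_comp_sub_mul hg hK hb x)
    (integrable_comp_sub_mul hg hK (hφ n) x)]
  simp only [← mul_sub]
  exact (abs_integral_comp_sub_mul_le hK (hb.sub (hφ n)) x).trans_lt hn

lemma convolution_eq_integral (φ : (Fin d → ℝ) → ℝ) (x : Fin d → ℝ) :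
    (g ⋆[ContinuousLinearMap.mul ℝ ℝ] φ) x = ∫ y, g (x - y) * φ y := by
  rw [convolution_eq_swap]
  rfl

lemma continuous_integral_comp_sub_mul (hg : LocallyIntegrable g volume) (hK : ∀ᵐ x, |g x| ≤ K)
    (hb : Integrable b) : Continuous fun x => ∫ y, g (x - y) * b y := by
  obtain ⟨φ, h1, h2, h3⟩ := exists_smooth_seq hb
  refine (tendstoUniformly_convolution hg.aestronglyMeasurable hK hb (fun n =>
    (h2 n).continuous.integrable_of_hasCompactSupport (h1 n)) h3).continuous
      (Frequently.of_forall fun n => ?_)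
  simp only [← convolution_eq_integral]
  exact (h1 n).continuous_convolution_right _ hg (h2 n).continuous

lemma pd_eq_fderiv {φ : (Fin d → ℝ) → ℝ} (hφ : Differentiable ℝ φ) (i : Fin d) (x : Fin d → ℝ) :
    pd i φ x = fderiv ℝ φ x (Pi.single i 1) :=
  (hφ x).lineDeriv_eq_fderiv

/-- The derivative first falls on `φ`. Testing the weak derivative of `g` with `z ↦ φ (x - z)` moves
it to `g`; the sign of the reflection cancels that of the integration by parts. -/
lemma hasLineDerivAt_integral_smooth {i : Fin d} (hw : HasWeakPartial i g h)
    {φ : (Fin d → ℝ) → ℝ} (hc : HasCompactSupport φ) (hφ : ContDiff ℝ ∞ φ) (x : Fin d → ℝ) :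
    HasLineDerivAt ℝ (fun x => ∫ y, g (x - y) * φ y) (∫ y, h (x - y) * φ y) x
      (Pi.single i 1) := by
  have h1 := (hc.hasFDerivAt_convolution_right (ContinuousLinearMap.mul ℝ ℝ) hw.1
    (hφ.of_le (by norm_cast)) x).hasLineDerivAt (Pi.single i 1)
  have hd : Differentiable ℝ φ := hφ.differentiable (by simp)
  rw [convolution_precompR_apply _ hw.1 (hc.fderiv ℝ) (hφ.continuous_fderiv (by simp))] at h1
  have h2 : (g ⋆[ContinuousLinearMap.mul ℝ ℝ] φ) = fun x => ∫ y, g (x - y) * φ y :=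
    funext fun x => convolution_eq_integral φ x
  rw [h2] at h1
  suffices he : ∫ y, h (x - y) * φ y = (g ⋆[ContinuousLinearMap.mul ℝ ℝ]
      fun a => fderiv ℝ φ a (Pi.single i 1)) x by
    rw [he]
    exact h1
  rw [← convolution_eq_integral]
  have hψ : ContDiff ℝ ∞ fun z => φ (x - z) := hφ.comp (contDiff_const.sub contDiff_id)
  have hψc : HasCompactSupport fun z => φ (x - z) :=
    hc.comp_homeomorph (Homeomorph.subLeft x)
  have h3 := hw.2.2 _ hψ hψc
  have h4 : ∀ z, pd i (fun z => φ (x - z)) z = -(fderiv ℝ φ (x - z) (Pi.single i 1)) := fun z => by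
    have h5 : HasFDerivAt (fun z => φ (x - z)) _ z :=
      (hd (x - z)).hasFDerivAt.comp z ((hasFDerivAt_id z).const_sub x)
    rw [pd_eq_fderiv (hψ.differentiable (by simp)), h5.fderiv]
    simp
  simp only [h4, mul_neg, integral_neg, neg_inj] at h3
  exact h3.symm

/-- Along a smooth `L¹` approximation of `b` both the convolutions and their derivatives converge
uniformly. -/
lemma hasLineDerivAt_integral_comp_sub_mul {i : Fin d} (hw : HasWeakPartial i g h)
    (hg : ∀ᵐ x, |g x| ≤ K) {K' : ℝ} (hh : ∀ᵐ x, |h x| ≤ K') (hb : Integrable b)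
    (x : Fin d → ℝ) :
    HasLineDerivAt ℝ (fun x => ∫ y, g (x - y) * b y) (∫ y, h (x - y) * b y) x
      (Pi.single i 1) := by
  obtain ⟨φ, h1, h2, h3⟩ := exists_smooth_seq hb
  have hφ := fun n => (h2 n).continuous.integrable_of_hasCompactSupport (μ := volume) (h1 n)
  have hG := tendstoUniformly_convolution hw.1.aestronglyMeasurable hg hb hφ h3
  have hH := tendstoUniformly_convolution hw.2.1.aestronglyMeasurable hh hb hφ h3
  have key := hasDerivAt_of_tendstoUniformly (l := atTop)
    (f := fun n (s : ℝ) => ∫ y, g (x + s • Pi.single i 1 - y) * φ n y)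
    (f' := fun n (s : ℝ) => ∫ y, h (x + s • Pi.single i 1 - y) * φ n y)
    (g := fun s => ∫ y, g (x + s • Pi.single i 1 - y) * b y)
    (g' := fun s => ∫ y, h (x + s • Pi.single i 1 - y) * b y)
    (hH.comp fun s : ℝ => x + s • Pi.single i 1)
    (Eventually.of_forall fun n s => ?_)
    (fun s => hG.tendsto_at _) 0
  · simpa [HasLineDerivAt] using key
  · exact hasDerivAt_line (fun x => hasLineDerivAt_integral_smooth hw (h1 n) (h2 n) x) x s

end Convolution

/-! ### Logarithmic Sobolev inequality on the circle of length one. -/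

section CircleLogSobolev

/-- Cauchy–Schwarz, from the discriminant of the nonnegative quadratic `t ↦ ∫ (a + t b)²`. -/
lemma sq_integral_mul_le {α : Type*} [MeasurableSpace α] {μ : Measure α} {a b : α → ℝ}
    (ha : Integrable (fun x => a x ^ 2) μ) (hb : Integrable (fun x => b x ^ 2) μ)
    (hab : Integrable (fun x => a x * b x) μ) :
    (∫ x, a x * b x ∂μ) ^ 2 ≤ (∫ x, a x ^ 2 ∂μ) * ∫ x, b x ^ 2 ∂μ := by
  have h : ∀ t : ℝ, 0 ≤ (∫ x, b x ^ 2 ∂μ) * (t * t) + (2 * ∫ x, a x * b x ∂μ) * t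
      + ∫ x, a x ^ 2 ∂μ := fun t => by
    have h1 : 0 ≤ ∫ x, (a x + t * b x) ^ 2 ∂μ := integral_nonneg fun x => sq_nonneg _
    have h2 : ∀ x, (a x + t * b x) ^ 2 = a x ^ 2 + (2 * t * (a x * b x) + t ^ 2 * b x ^ 2) :=
      fun x => by ring
    simp only [h2] at h1
    have h3 : Integrable (fun x => 2 * t * (a x * b x) + t ^ 2 * b x ^ 2) μ :=
      (hab.const_mul (2 * t)).add (hb.const_mul (t ^ 2))
    rw [integral_add ha h3,
      integral_add (hab.const_mul (2 * t)) (hb.const_mul (t ^ 2)), integral_const_mul, integral_const_mul] at h1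
    nlinarith
  have := discrim_le_zero h
  rw [discrim] at this
  nlinarith

variable {g g' : ℝ → ℝ}

/-- Wirtinger's inequality on the circle of length one. -/
lemma wirtinger (hg : ∀ x, HasDerivAt g (g' x) x) (hg' : Continuous g') (hp : g 1 = g 0)
    (hm : ∫ x in (0 : ℝ)..1, g x = 0) :
    4 * Real.pi ^ 2 * ∫ x in (0 : ℝ)..1, g x ^ 2 ≤ ∫ x in (0 : ℝ)..1, g' x ^ 2 := by
  have hgc : Continuous g := continuous_iff_continuousAt.2 fun x => (hg x).continuousAt
  have hmem : ∀ {f : ℝ → ℝ}, Continuous f →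
      MemLp (fun x => (f x : ℂ)) 2 (volume.restrict (Ioc (0 : ℝ) 1)) := fun {f} hf => by
    have h1 : Continuous fun x => (f x : ℂ) := by fun_prop
    refine (memLp_two_iff_integrable_sq_norm h1.aestronglyMeasurable).2 ?_
    exact ((by fun_prop : Continuous fun x => ‖(f x : ℂ)‖ ^ 2).integrableOn_Icc).mono_set
      Ioc_subset_Icc_self
  have h1 := hasSum_sq_fourierCoeffOn zero_lt_one (hmem hgc)
  have h2 := hasSum_sq_fourierCoeffOn zero_lt_one (hmem hg')
  -- Parseval on both sides, compared mode by mode: the zero mode vanishes by `hm`, and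
  -- differentiation multiplies the squared modulus of mode `n` by `4π²n² ≥ 4π²`.
  have h3 := hasSum_le (fun n : ℤ => ?_) (h1.mul_left (4 * Real.pi ^ 2)) h2
  · simpa using h3
  · by_cases hn : n = 0
    · rw [hn, fourierCoeffOn_eq_integral]
      simp [intervalIntegral.integral_ofReal, hm]
    · rw [fourierCoeffOn_of_hasDerivAt zero_lt_one hn (f' := fun x => (g' x : ℂ))
        (fun x _ => (hg x).ofReal_comp)
        ((by fun_prop : Continuous fun x => (g' x : ℂ)).intervalIntegrable _ _)]
      rw [hp]
      have hn2 : (1 : ℝ) ≤ (n : ℝ) ^ 2 := by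
        have : (1 : ℤ) ≤ n ^ 2 := by have := sq_pos_of_ne_zero hn; omega
        exact_mod_cast this
      simp only [sub_self, mul_zero, Complex.ofReal_one, Complex.ofReal_zero, sub_zero, one_mul,
        zero_sub, norm_mul, norm_div, norm_neg, norm_one, Complex.norm_ofNat, Complex.norm_real,
        Complex.norm_I, Complex.norm_intCast, mul_one, mul_pow, div_pow, one_pow, Real.norm_eq_abs,
        sq_abs]
      set q := ‖fourierCoeffOn _ (fun x => (g' x : ℂ)) n‖ ^ 2 with hq
      have hq0 : 0 ≤ q := sq_nonneg _
      have hpi := Real.pi_pos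
      have e : 4 * Real.pi ^ 2 * (1 / (2 ^ 2 * Real.pi ^ 2 * (n : ℝ) ^ 2) * q) = q / (n : ℝ) ^ 2 := by
        field_simp
        norm_num
      rw [e]
      exact div_le_self hq0 hn2

/-- Integration by parts gives `g x = ∫ (y - 1/2) g'(x + y) dy` over a period. Cauchy–Schwarz and `∫
(y - 1/2)² = 1/12` finish. -/
lemma sq_le_of_mean_zero (hg : ∀ x, HasDerivAt g (g' x) x) (hg' : Continuous g')
    (hp : Function.Periodic g 1) (hm : ∫ x in (0 : ℝ)..1, g x = 0) (x : ℝ) :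
    g x ^ 2 ≤ (∫ x in (0 : ℝ)..1, g' x ^ 2) / 12 := by
  have hgc : Continuous g := continuous_iff_continuousAt.2 fun x => (hg x).continuousAt
  have hp' : Function.Periodic g' 1 := fun y => by
    refine (hg (y + 1)).unique ?_ |>.trans rfl
    have h1 := (hg (y + 1 - 1)).comp_sub_const (y + 1) 1
    rw [add_sub_cancel_right] at h1
    exact h1.congr_of_eventuallyEq (Filter.Eventually.of_forall fun z => by
      change g z = g (z - 1)
      rw [← hp (z - 1), sub_add_cancel])
  have h1 : ∫ y in (0 : ℝ)..1, g (x + y) = 0 := by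
    rw [intervalIntegral.integral_comp_add_left (fun y => g y) x, add_zero, hp.intervalIntegral_add_eq x 0, zero_add, hm]
  have h2 : ∫ y in (0 : ℝ)..1, (y - 1 / 2) * g' (x + y) = g x := by
    rw [intervalIntegral.integral_mul_deriv_eq_deriv_mul (u := fun y : ℝ => y - 1 / 2) (u' := fun _ => 1)
      (v := fun y => g (x + y)) (fun y _ => (hasDerivAt_id y).sub_const _)
      (fun y _ => (hg (x + y)).comp_const_add x y) (by simp)
      ((by fun_prop : Continuous fun y => g' (x + y)).intervalIntegrable _ _)]
    simp only [one_mul, h1, hp x]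
    ring_nf
  have h3 : ∫ y in (0 : ℝ)..1, g' (x + y) ^ 2 = ∫ y in (0 : ℝ)..1, g' y ^ 2 := by
    have hp2 : Function.Periodic (fun y => g' y ^ 2) 1 := fun y => by simp only [hp' y]
    rw [intervalIntegral.integral_comp_add_left (fun y => g' y ^ 2) x, add_zero, hp2.intervalIntegral_add_eq x 0,
      zero_add]
  have h4 : ∫ y in (0 : ℝ)..1, (y - 1 / 2) ^ 2 = 1 / 12 := by
    rw [intervalIntegral.integral_comp_sub_right (fun y => y ^ 2)]
    simp only [integral_pow]
    norm_num
  have h5 := sq_integral_mul_le (μ := volume.restrict (Ioc (0 : ℝ) 1)) (a := fun y => y - 1 / 2)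
    (b := fun y => g' (x + y))
    ((by fun_prop : Continuous fun y : ℝ => (y - 1 / 2) ^ 2).intervalIntegrable 0 1).1
    ((by fun_prop : Continuous fun y : ℝ => g' (x + y) ^ 2).intervalIntegrable 0 1).1
    ((by fun_prop : Continuous fun y : ℝ => (y - 1 / 2) * g' (x + y)).intervalIntegrable 0 1).1
  simp only [← intervalIntegral.integral_of_le zero_le_one] at h5
  rw [h2, h3, h4] at h5
  linarith

/-- A logarithmic Sobolev inequality on the circle of length one. -/
lemma circle_logSobolev_unit {f f' : ℝ → ℝ} (hf : ∀ x, HasDerivAt f (f' x) x)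
    (hf' : Continuous f') (hp : Function.Periodic f 1) (hpos : ∀ x, 0 < f x)
    (hnorm : ∫ x in (0 : ℝ)..1, f x ^ 2 = 1) :
    ∫ x in (0 : ℝ)..1, f x ^ 2 * Real.log (f x ^ 2)
      ≤ (∫ x in (0 : ℝ)..1, f' x ^ 2) / Real.pi ^ 2 := by
  have hfc : Continuous f := continuous_iff_continuousAt.2 fun x => (hf x).continuousAt
  have hne : ∀ x, f x ≠ 0 := fun x => (hpos x).ne'
  set m := ∫ x in (0 : ℝ)..1, f x with hm
  set E := ∫ x in (0 : ℝ)..1, f' x ^ 2 with hE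
  have hE0 : 0 ≤ E := intervalIntegral.integral_nonneg zero_le_one fun x _ => sq_nonneg _
  have hm0 : 0 < m := intervalIntegral.intervalIntegral_pos_of_pos (hfc.intervalIntegrable _ _) hpos zero_lt_one
  have hI : ∀ {q : ℝ → ℝ}, Continuous q → IntervalIntegrable q volume 0 1 :=
    fun hq => hq.intervalIntegrable _ _
  have hgm : ∫ x in (0 : ℝ)..1, (f x - m) = 0 := by
    rw [intervalIntegral.integral_sub (hI hfc) (hI continuous_const), ← hm]
    simp
  have hg : ∀ x, HasDerivAt (fun x => f x - m) (f' x) x := fun x => (hf x).sub_const m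
  set s := ∫ x in (0 : ℝ)..1, (f x - m) ^ 2 with hs
  have hs0 : 0 ≤ s := intervalIntegral.integral_nonneg zero_le_one fun x _ => sq_nonneg _
  have hsE : 4 * Real.pi ^ 2 * s ≤ E := wirtinger hg hf' (by rw [← hp 0, zero_add]) hgm
  have hM : ∀ x, (f x - m) ^ 2 ≤ E / 12 :=
    sq_le_of_mean_zero hg hf' (fun x => by simp only [hp x]) hgm
  have hsm : s = 1 - m ^ 2 := by
    have e : ∀ x, (f x - m) ^ 2 = f x ^ 2 - (2 * m * (f x - m) + m ^ 2) := fun x => by ring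
    rw [hs]
    simp only [e]
    rw [intervalIntegral.integral_sub (hI (by fun_prop)) (hI (by fun_prop)),
      intervalIntegral.integral_add (hI (by fun_prop)) (hI (by fun_prop)), intervalIntegral.integral_const_mul, hgm, hnorm]
    simp
  -- The cube is expanded around the mean; the linear term integrates to zero.
  have hcube : ∫ x in (0 : ℝ)..1, f x ^ 3
      = m ^ 3 + 3 * m * s + ∫ x in (0 : ℝ)..1, (f x - m) ^ 3 := by
    have e : ∀ x, f x ^ 3 = (m ^ 3 + 3 * m ^ 2 * (f x - m)) + 3 * m * (f x - m) ^ 2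
        + (f x - m) ^ 3 := fun x => by ring
    simp only [e]
    rw [intervalIntegral.integral_add (hI (by fun_prop)) (hI (by fun_prop)),
      intervalIntegral.integral_add (hI (by fun_prop)) (hI (by fun_prop)),
      intervalIntegral.integral_add (hI (by fun_prop)) (hI (by fun_prop)), intervalIntegral.integral_const_mul, intervalIntegral.integral_const_mul,
      hgm, ← hs]
    simp
  have hM3 : ∫ x in (0 : ℝ)..1, (f x - m) ^ 3 ≤ √(E / 12) * s := by
    rw [hs, ← intervalIntegral.integral_const_mul]
    refine intervalIntegral.integral_mono_on zero_le_one (hI (by fun_prop)) (hI (by fun_prop)) fun x _ => ?_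
    rw [pow_succ' _ 2]
    exact mul_le_mul_of_nonneg_right ((le_abs_self _).trans (Real.abs_le_sqrt (hM x)))
      (sq_nonneg _)
  set c := ∫ x in (0 : ℝ)..1, f x ^ 3 with hc
  have hc0 : 0 < c :=
    intervalIntegral.intervalIntegral_pos_of_pos (hI (by fun_prop)) (fun x => pow_pos (hpos x) 3) zero_lt_one
  -- Jensen's inequality for the logarithm under the probability density `f²`, via the tangent line
  -- of the logarithm at `c`. It remains to show `c ≤ exp (e / 2)`.
  have hJ : ∫ x in (0 : ℝ)..1, f x ^ 2 * Real.log (f x ^ 2) ≤ 2 * Real.log c := by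
    have h1 : ∀ x, f x ^ 2 * Real.log (f x ^ 2)
        ≤ 2 * (Real.log c - 1) * f x ^ 2 + 2 / c * f x ^ 3 := fun x => by
      have h2 := Real.log_le_sub_one_of_pos (div_pos (hpos x) hc0)
      rw [Real.log_div (hne x) hc0.ne'] at h2
      rw [Real.log_pow]
      have h3 : Real.log (f x) ≤ Real.log c - 1 + f x / c := by linarith
      have h4 := mul_le_mul_of_nonneg_left h3 (sq_nonneg (f x))
      push_cast
      calc f x ^ 2 * (2 * Real.log (f x)) = 2 * (f x ^ 2 * Real.log (f x)) := by ring
        _ ≤ 2 * (f x ^ 2 * (Real.log c - 1 + f x / c)) := by linarith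
        _ = _ := by ring
    have hlc : Continuous fun x => f x ^ 2 * Real.log (f x ^ 2) :=
      (hfc.pow 2).mul ((hfc.pow 2).log fun x => pow_ne_zero 2 (hne x))
    refine (intervalIntegral.integral_mono_on zero_le_one (hI hlc) (hI (by fun_prop)) fun x _ => h1 x).trans ?_
    rw [intervalIntegral.integral_add (hI (by fun_prop)) (hI (by fun_prop)), intervalIntegral.integral_const_mul, intervalIntegral.integral_const_mul,
      hnorm, ← hc, div_mul_cancel₀ _ hc0.ne']
    linarith
  have hpi := Real.pi_pos
  set e := E / Real.pi ^ 2 with he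
  have he0 : 0 ≤ e := by positivity
  have hse : s ≤ e / 4 := by
    rw [he, div_div, le_div_iff₀ (by positivity)]
    linarith
  -- Since `π² ≤ 12`, `E / 12 ≤ e ≤ ((1 + e) / 2)²`.
  have hME : √(E / 12) ≤ (1 + e) / 2 := by
    refine Real.sqrt_le_iff.2 ⟨by positivity, ?_⟩
    have h1 : E = e * Real.pi ^ 2 := by rw [he]; field_simp
    have h2 : Real.pi ^ 2 ≤ 12 := by nlinarith [Real.pi_lt_d2]
    nlinarith [sq_nonneg (1 - e)]
  -- The identity `m² = 1 - s` makes the left side `m (1 + 2s)` and gives `m ≤ 1 - s / 2`.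
  have hms : m ^ 3 + 3 * m * s ≤ 1 + 3 / 2 * s := by
    have h1 : m ≤ 1 - s / 2 := by nlinarith [sq_nonneg (m - 1)]
    have h2 : m ^ 3 + 3 * m * s = m * (1 + 2 * s) := by rw [hsm]; ring
    rw [h2]
    nlinarith
  -- With `s ≤ e / 4` the bounds add up to exactly the second Taylor polynomial of the exponential
  -- at `e / 2`.
  have hce : c ≤ 1 + e / 2 + (e / 2) ^ 2 / 2 := by
    have h1 : √(E / 12) * s ≤ (1 + e) / 2 * (e / 4) := by gcongr
    linarith
  have hlog : Real.log c ≤ e / 2 := by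
    rw [Real.log_le_iff_le_exp hc0]
    exact hce.trans (Real.quadratic_le_exp_of_nonneg (by positivity))
  linarith

end CircleLogSobolev

/-! ### Rescaling to length `L`, Pinsker's inequality, differentiation under the integral. -/

section LogSobolev

/-- Length and mass are normalised to one and `f = √F` is substituted; the factor 4 is that of `F'²
/ F = 4 f'²`. -/
lemma circle_logSobolev {L : ℝ} (hL : 0 < L) {F F' : ℝ → ℝ} (hF : ∀ x, HasDerivAt F (F' x) x)
    (hF' : Continuous F') (hp : Function.Periodic F L) (hpos : ∀ x, 0 < F x) :
    4 * Real.pi ^ 2 / L ^ 2 * ((∫ x in -L / 2..L / 2, F x * Real.log (F x))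
        - (∫ x in -L / 2..L / 2, F x) * Real.log ((∫ x in -L / 2..L / 2, F x) / L))
      ≤ ∫ x in -L / 2..L / 2, F' x ^ 2 / F x := by
  have hFc : Continuous F := continuous_iff_continuousAt.2 fun x => (hF x).continuousAt
  have hne : ∀ x, F x ≠ 0 := fun x => (hpos x).ne'
  have hI : ∀ {q : ℝ → ℝ}, Continuous q → IntervalIntegrable q volume (-L / 2) (L / 2) :=
    fun hq => hq.intervalIntegrable _ _
  set m := ∫ x in -L / 2..L / 2, F x with hm
  have hm0 : 0 < m := intervalIntegral.intervalIntegral_pos_of_pos (hI hFc) hpos (by linarith)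
  let f : ℝ → ℝ := fun y => √(L / m * F (L * y + -L / 2))
  have hrad : ∀ y, 0 < L / m * F (L * y + -L / 2) := fun y => mul_pos (div_pos hL hm0) (hpos _)
  have hfpos : ∀ y, 0 < f y := fun y => Real.sqrt_pos.2 (hrad y)
  have hfsq : ∀ y, f y ^ 2 = L / m * F (L * y + -L / 2) := fun y => Real.sq_sqrt (hrad y).le
  have hfc : Continuous f := by fun_prop
  let f' : ℝ → ℝ := fun y => L / m * (F' (L * y + -L / 2) * L) / (2 * f y)
  have hf : ∀ y, HasDerivAt f (f' y) y := fun y => by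
    have h1 : HasDerivAt (fun y : ℝ => L * y + -L / 2) L y := by
      simpa using ((hasDerivAt_id y).const_mul L).add_const (-L / 2)
    exact (((hF _).comp y h1).const_mul (L / m)).sqrt (hrad y).ne'
  have hf'c : Continuous f' := by
    refine Continuous.div (by fun_prop) (by fun_prop) fun y => ?_
    exact mul_ne_zero two_ne_zero (hfpos y).ne'
  have hfp : Function.Periodic f 1 := fun y => by
    simp only [f]
    rw [show L * (y + 1) + -L / 2 = L * y + -L / 2 + L by ring, hp]
  have hcv : ∀ q : ℝ → ℝ, ∫ y in (0 : ℝ)..1, q (L * y + -L / 2)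
      = L⁻¹ * ∫ x in -L / 2..L / 2, q x := fun q => by
    rw [intervalIntegral.integral_comp_mul_add q hL.ne']
    simp only [mul_zero, zero_add, mul_one, smul_eq_mul, show L + -L / 2 = L / 2 by ring]
  have hnorm : ∫ y in (0 : ℝ)..1, f y ^ 2 = 1 := by
    simp only [hfsq]
    rw [intervalIntegral.integral_const_mul, hcv F, ← hm]
    field_simp
  have h1 := circle_logSobolev_unit hf hf'c hfp hfpos hnorm
  have h2 : ∫ y in (0 : ℝ)..1, f' y ^ 2 = L ^ 2 / (4 * m) * ∫ x in -L / 2..L / 2, F' x ^ 2 / F x := by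
    have e : ∀ y, f' y ^ 2 = L ^ 3 / (4 * m) * (fun x => F' x ^ 2 / F x) (L * y + -L / 2) :=
      fun y => by
      simp only [f']
      rw [div_pow, mul_pow 2 (f y), hfsq]
      have h0 := hne (L * y + -L / 2)
      generalize F (L * y + -L / 2) = B at h0 ⊢
      generalize F' (L * y + -L / 2) = A
      field_simp
      norm_num
    simp only [e]
    rw [intervalIntegral.integral_const_mul, hcv fun x => F' x ^ 2 / F x]
    field_simp
  have h3 : ∫ y in (0 : ℝ)..1, f y ^ 2 * Real.log (f y ^ 2)
      = m⁻¹ * ((∫ x in -L / 2..L / 2, F x * Real.log (F x)) - m * Real.log (m / L)) := by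
    have e : ∀ y, f y ^ 2 * Real.log (f y ^ 2)
        = L / m * (fun x => F x * Real.log (F x) - Real.log (m / L) * F x) (L * y + -L / 2) :=
      fun y => by
      rw [hfsq, Real.log_mul (div_pos hL hm0).ne' (hne _), ← inv_div m L, Real.log_inv, inv_div]
      ring
    simp only [e]
    have hlc : Continuous fun x => F x * Real.log (F x) := hFc.mul (hFc.log hne)
    rw [intervalIntegral.integral_const_mul, hcv fun x => F x * Real.log (F x) - Real.log (m / L) * F x,
      intervalIntegral.integral_sub (hI hlc) (hI (by fun_prop)),
      intervalIntegral.integral_const_mul, ← hm]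
    field_simp
  rw [h2, h3] at h1
  have hpi := Real.pi_pos
  set Ent := (∫ x in -L / 2..L / 2, F x * Real.log (F x)) - m * Real.log (m / L)
  set J := ∫ x in -L / 2..L / 2, F' x ^ 2 / F x
  have h4 := mul_le_mul_of_nonneg_left h1 (by positivity : 0 ≤ 4 * Real.pi ^ 2 * m / L ^ 2)
  calc 4 * Real.pi ^ 2 / L ^ 2 * Ent = 4 * Real.pi ^ 2 * m / L ^ 2 * (m⁻¹ * Ent) := by field_simp
    _ ≤ _ := h4
    _ = J := by field_simp

/-- The difference `h` of the two sides has derivative `log y + 1/y - 1 ≥ 0` and vanishes at 1. Its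
sign controls the derivative in `three_mul_sq_sub_one_le`. -/
lemma two_mul_sub_one_le_mul_log {x : ℝ} (hx : 0 < x) :
    (1 ≤ x → 2 * (x - 1) ≤ (x + 1) * Real.log x) ∧
      (x ≤ 1 → (x + 1) * Real.log x ≤ 2 * (x - 1)) := by
  let h : ℝ → ℝ := fun x => (x + 1) * Real.log x - 2 * (x - 1)
  have hd : ∀ y ∈ Ioi (0 : ℝ), HasDerivAt h (Real.log y + y⁻¹ - 1) y := fun y hy => by
    have hy0 : y ≠ 0 := (mem_Ioi.1 hy).ne'
    have := (((hasDerivAt_id y).add_const 1).mul (Real.hasDerivAt_log hy0)).sub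
      (((hasDerivAt_id y).sub_const 1).const_mul 2)
    refine this.congr_deriv ?_
    simp only [id]
    field_simp
    ring
  have hmono : MonotoneOn h (Ioi 0) := by
    refine monotoneOn_of_deriv_nonneg (convex_Ioi 0)
      (fun y hy => (hd y hy).continuousAt.continuousWithinAt)
      (fun y hy => ((hd y (interior_subset hy)).differentiableAt).differentiableWithinAt)
      fun y hy => ?_
    have hy' : y ∈ Ioi (0 : ℝ) := interior_subset hy
    rw [(hd y hy').deriv]
    have := Real.one_sub_inv_le_log_of_pos hy'
    linarith
  have h1 : h 1 = 0 := by simp [h]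
  constructor
  · intro hx1
    have := hmono (mem_Ioi.2 one_pos) (mem_Ioi.2 hx) hx1
    simp only [h1] at this
    simp only [h] at this
    linarith
  · intro hx1
    have := hmono (mem_Ioi.2 hx) (mem_Ioi.2 one_pos) hx1
    simp only [h1] at this
    simp only [h] at this
    linarith

/-- Pinsker's inequality in pointwise form. -/
lemma three_mul_sq_sub_one_le {x : ℝ} (hx : 0 ≤ x) :
    3 * (x - 1) ^ 2 ≤ (2 * x + 4) * (x * Real.log x + 1 - x) := by
  rcases hx.eq_or_lt with rfl | hx
  · norm_num
  let g : ℝ → ℝ := fun x => (2 * x + 4) * (x * Real.log x + 1 - x) - 3 * (x - 1) ^ 2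
  -- So `g` decreases on `(0, 1]` and increases afterwards; its minimum is `g 1 = 0`.
  have hd : ∀ y, 0 < y → HasDerivAt g (4 * ((y + 1) * Real.log y - 2 * (y - 1))) y := fun y hy => by
    have h1 := ((((hasDerivAt_id y).mul (Real.hasDerivAt_log hy.ne')).add_const 1).sub
      (hasDerivAt_id y))
    have h2 := (((hasDerivAt_id y).const_mul 2).add_const 4).mul h1
    have h3 := (((hasDerivAt_id y).sub_const 1).pow 2).const_mul 3
    refine (h2.sub h3).congr_deriv ?_
    simp
    field_simp
    ring
  have h1 : g 1 = 0 := by simp [g]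
  suffices 0 ≤ g x by simp only [g] at this; linarith
  rw [← h1]
  rcases le_total x 1 with hx1 | hx1
  · have hanti : AntitoneOn g (Ioc 0 1) := by
      refine antitoneOn_of_deriv_nonpos (convex_Ioc 0 1)
        (fun y hy => (hd y hy.1).continuousAt.continuousWithinAt)
        (fun y hy => ((hd y (interior_subset hy).1).differentiableAt).differentiableWithinAt)
        fun y hy => ?_
      have hy' : y ∈ Ioc (0 : ℝ) 1 := interior_subset hy
      rw [(hd y hy'.1).deriv]
      have := (two_mul_sub_one_le_mul_log hy'.1).2 hy'.2
      linarith
    exact hanti ⟨hx, hx1⟩ ⟨one_pos, le_rfl⟩ hx1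
  · have hmono : MonotoneOn g (Ici 1) := by
      have hp : ∀ y ∈ Ici (1 : ℝ), 0 < y := fun y hy => one_pos.trans_le hy
      refine monotoneOn_of_deriv_nonneg (convex_Ici 1)
        (fun y hy => (hd y (hp y hy)).continuousAt.continuousWithinAt)
        (fun y hy => ((hd y (hp y (interior_subset hy))).differentiableAt).differentiableWithinAt)
        fun y hy => ?_
      have hy' : y ∈ Ici (1 : ℝ) := interior_subset hy
      rw [(hd y (hp y hy')).deriv]
      have := (two_mul_sub_one_le_mul_log (hp y hy')).1 hy'
      linarith
    exact hmono (mem_Ici.2 le_rfl) hx1 hx1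

lemma continuous_entropyDensity (d : ℕ) {L : ℝ} (hL : 0 < L) : Continuous (entropyDensity d L) := by
  have h : entropyDensity d L = fun u => (1 / L ^ d) * ((u / (1 / L ^ d)) * Real.log (u / (1 / L ^ d))) := by
    ext u
    rw [entropyDensity]
    field_simp
  rw [h]
  have h2 : Continuous fun u : ℝ => u / (1 / L ^ d) := by fun_prop
  exact continuous_const.mul (Real.continuous_mul_log.comp h2)

/-- Pinsker's inequality on the torus. -/
lemma sq_integral_abs_sub_le {d : ℕ} {L : ℝ} (hL : 0 < L) {u : (Fin d → ℝ) → ℝ} (hu : Continuous u)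
    (hu0 : ∀ x, 0 ≤ u x) (hu1 : ∫ x, u x ∂cellMeasure d L = 1) :
    (∫ x, |u x - 1 / L ^ d| ∂cellMeasure d L) ^ 2
      ≤ 2 * ∫ x, entropyDensity d L (u x) ∂cellMeasure d L := by
  have hLd : 0 < L ^ d := pow_pos hL d
  let v : (Fin d → ℝ) → ℝ := fun x => L ^ d * u x
  have hv : Continuous v := by fun_prop
  have hv0 : ∀ x, 0 ≤ v x := fun x => mul_nonneg hLd.le (hu0 x)
  let k : (Fin d → ℝ) → ℝ := fun x => v x * Real.log (v x) + 1 - v x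
  have hk : Continuous k :=
    ((Real.continuous_mul_log.comp hv).add continuous_const).sub hv
  have hk0 : ∀ x, 0 ≤ k x := fun x => by
    have h1 := three_mul_sq_sub_one_le (hv0 x)
    have h2 : 0 ≤ (2 * v x + 4) * k x := by nlinarith [sq_nonneg (v x - 1)]
    exact nonneg_of_mul_nonneg_right h2 (by linarith [hv0 x])
  -- The pointwise inequality splits the deviation into two factors for Cauchy–Schwarz. The first
  -- squares to an affine function of `v` with integral `2 L ^ d`, the second to the entropy: hence
  -- the constant 2.
  have h1 : ∀ x, |u x - 1 / L ^ d| ≤ (1 / L ^ d) * (√((2 * v x + 4) / 3) * √(k x)) := fun x => by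
    have e : u x - 1 / L ^ d = (1 / L ^ d) * (v x - 1) := by
      simp only [v]; field_simp
    rw [e, abs_mul, abs_of_pos (by positivity : 0 < 1 / L ^ d)]
    refine mul_le_mul_of_nonneg_left ?_ (by positivity)
    rw [← Real.sqrt_mul (by linarith [hv0 x])]
    refine Real.abs_le_sqrt ?_
    have := three_mul_sq_sub_one_le (hv0 x)
    change 3 * (v x - 1) ^ 2 ≤ (2 * v x + 4) * k x at this
    linarith
  have h2 := sq_integral_mul_le (μ := cellMeasure d L) (a := fun x => √((2 * v x + 4) / 3))
    (b := fun x => √(k x)) (by fun_prop : Continuous _).integrable_cell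
    (by fun_prop : Continuous _).integrable_cell (by fun_prop : Continuous _).integrable_cell
  have h3 : ∫ x, √((2 * v x + 4) / 3) ^ 2 ∂cellMeasure d L = 2 * L ^ d := by
    have e : ∀ x, √((2 * v x + 4) / 3) ^ 2 = 2 * L ^ d / 3 * u x + 4 / 3 := fun x => by
      rw [Real.sq_sqrt (by linarith [hv0 x])]
      simp only [v]; ring
    simp only [e]
    rw [integral_add (hu.integrable_cell.const_mul _) (integrable_const _), integral_const_mul, hu1,
      integral_const, cellMeasure_real_univ hL, smul_eq_mul]
    ring
  have h4 : ∫ x, √(k x) ^ 2 ∂cellMeasure d L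
      = L ^ d * ∫ x, entropyDensity d L (u x) ∂cellMeasure d L := by
    have hE : Continuous fun x => entropyDensity d L (u x) := (continuous_entropyDensity d hL).comp hu
    have hA : Continuous fun x => 1 - L ^ d * u x := by fun_prop
    have e : ∀ x, √(k x) ^ 2 = L ^ d * entropyDensity d L (u x) + (1 - L ^ d * u x) := fun x => by
      rw [Real.sq_sqrt (hk0 x)]
      simp only [k, v, entropyDensity]
      rw [div_div_eq_mul_div, div_one, mul_comm (u x) (L ^ d)]
      ring
    simp only [e]
    rw [integral_add (hE.integrable_cell.const_mul _) hA.integrable_cell, integral_const_mul,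
      integral_sub (integrable_const _) (hu.integrable_cell.const_mul _), integral_const_mul, hu1,
      integral_const, cellMeasure_real_univ hL, smul_eq_mul]
    ring
  rw [h3, h4] at h2
  have h5 : ∫ x, |u x - 1 / L ^ d| ∂cellMeasure d L
      ≤ (1 / L ^ d) * ∫ x, √((2 * v x + 4) / 3) * √(k x) ∂cellMeasure d L := by
    rw [← integral_const_mul]
    exact integral_mono (by fun_prop : Continuous _).integrable_cell
      (by fun_prop : Continuous _).integrable_cell h1
  have h6 : 0 ≤ ∫ x, |u x - 1 / L ^ d| ∂cellMeasure d L := integral_nonneg fun x => abs_nonneg _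
  calc _ ≤ ((1 / L ^ d) * ∫ x, √((2 * v x + 4) / 3) * √(k x) ∂cellMeasure d L) ^ 2 :=
        pow_le_pow_left₀ h6 h5 2
    _ = (1 / L ^ d) ^ 2 * (∫ x, √((2 * v x + 4) / 3) * √(k x) ∂cellMeasure d L) ^ 2 := by ring
    _ ≤ (1 / L ^ d) ^ 2 * _ := mul_le_mul_of_nonneg_left h2 (by positivity)
    _ = _ := by field_simp

/-- Differentiation under an integral over a compact set. -/
lemma hasDerivAt_integral_compact {α : Type*} [TopologicalSpace α] [T2Space α]
    [SecondCountableTopology α] [MeasurableSpace α] [BorelSpace α] {μ : Measure α}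
    [IsFiniteMeasureOnCompacts μ] {K : Set α} (hK : IsCompact K) {s : Set ℝ} (hs : IsOpen s)
    {f f' : ℝ → α → ℝ} (hf : ∀ t ∈ s, ContinuousOn (f t) K)
    (hf' : ContinuousOn (fun p : ℝ × α => f' p.1 p.2) (s ×ˢ K))
    (hder : ∀ t ∈ s, ∀ x ∈ K, HasDerivAt (fun t => f t x) (f' t x) t) {t : ℝ} (ht : t ∈ s) :
    HasDerivAt (fun t => ∫ x in K, f t x ∂μ) (∫ x in K, f' t x ∂μ) t := by
  obtain ⟨r, hr, hrs⟩ := Metric.nhds_basis_closedBall.mem_iff.1 (hs.mem_nhds ht)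
  have hcomp : IsCompact (Metric.closedBall t r ×ˢ K) := (isCompact_closedBall t r).prod hK
  obtain ⟨C, hC⟩ := hcomp.exists_bound_of_continuousOn (hf'.mono (prod_mono_left hrs))
  have hmeas : MeasurableSet K := hK.measurableSet
  have hsec : ∀ t ∈ s, ContinuousOn (f' t) K := fun t ht =>
    hf'.comp (by fun_prop : Continuous fun x : α => (t, x)).continuousOn fun x hx => ⟨ht, hx⟩
  have : IsFiniteMeasure (μ.restrict K) :=
    ⟨by rw [Measure.restrict_apply_univ]; exact hK.measure_lt_top⟩
  refine (hasDerivAt_integral_of_dominated_loc_of_deriv_le (bound := fun _ => C)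
    (Metric.ball_mem_nhds t hr) ?_ ?_ ?_ ?_ (integrable_const C) ?_).2
  · filter_upwards [hs.mem_nhds ht] with t' ht'
    exact (hf t' ht').aestronglyMeasurable hmeas
  · exact (hf t ht).integrableOn_compact hK
  · exact (hsec t ht).aestronglyMeasurable hmeas
  · filter_upwards [ae_restrict_mem hmeas] with x hx t' ht'
    exact hC (t', x) ⟨Metric.ball_subset_closedBall ht', hx⟩
  · filter_upwards [ae_restrict_mem hmeas] with x hx t' ht'
    exact hder t' (hrs (Metric.ball_subset_closedBall ht')) x hx

end LogSobolev

/-! ### Tensorisation: the logarithmic Sobolev inequality in every dimension with the same constant.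
-/

section TorusLogSobolev

variable {d : ℕ} {L : ℝ}

lemma continuous_finCons (d : ℕ) :
    Continuous fun p : ℝ × (Fin d → ℝ) => (Fin.cons p.1 p.2 : Fin (d + 1) → ℝ) := by
  refine continuous_pi fun i => ?_
  refine Fin.cases ?_ (fun j => ?_) i
  · simpa using continuous_fst
  · simp only [Fin.cons_succ]; fun_prop

lemma integral_cell_succ (hL : 0 < L) {F : (Fin (d + 1) → ℝ) → ℝ} (hF : Continuous F) :
    ∫ x, F x ∂cellMeasure (d + 1) L
      = ∫ z, (∫ a in -L / 2..L / 2, F (Fin.cons a z)) ∂cellMeasure d L := by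
  have e : ∀ n, cellMeasure n L
      = Measure.pi fun _ : Fin n => (volume : Measure ℝ).restrict (Icc (-L / 2) (L / 2)) := fun n =>
    Measure.restrict_pi_pi _ _
  have hmp := (measurePreserving_piFinSuccAbove
    (fun _ : Fin (d + 1) => (volume : Measure ℝ).restrict (Icc (-L / 2) (L / 2))) 0).symm
  have h1 := hmp.integral_comp' F
  rw [← e] at h1
  rw [e (d + 1), ← h1]
  have h2 : ∀ p : ℝ × (Fin d → ℝ),
      F ((MeasurableEquiv.piFinSuccAbove (fun _ : Fin (d + 1) => ℝ) 0).symm p)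
        = F (Fin.cons p.1 p.2) := fun p => by
    simp [MeasurableEquiv.piFinSuccAbove, Fin.insertNthEquiv]
  simp only [h2]
  have hc : Continuous fun p : ℝ × (Fin d → ℝ) => F (Fin.cons p.1 p.2) :=
    hF.comp (continuous_finCons d)
  rw [integral_prod_symm]
  · simp only [intervalIntegral.integral_of_le (by linarith : -L / 2 ≤ L / 2),
      integral_Icc_eq_integral_Ioc]
  · rw [cellMeasure, Measure.prod_restrict]
    exact hc.continuousOn.integrableOn_compact (isCompact_Icc.prod (isCompact_cell d L))

/-- A logarithmic Sobolev inequality on the flat torus. -/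
theorem torus_logSobolev (hL : 0 < L) (d : ℕ) {F : (Fin d → ℝ) → ℝ}
    {F' : Fin d → (Fin d → ℝ) → ℝ} (hF : Continuous F) (hp : IsPeriodic L F) (hpos : ∀ x, 0 < F x)
    (hF' : ∀ i, Continuous (F' i))
    (hder : ∀ i x, HasLineDerivAt ℝ F (F' i x) x (Pi.single i 1)) :
    4 * Real.pi ^ 2 / L ^ 2 * ((∫ x, F x * Real.log (F x) ∂cellMeasure d L)
        - (∫ x, F x ∂cellMeasure d L) * Real.log ((∫ x, F x ∂cellMeasure d L) / L ^ d))
      ≤ ∑ i, ∫ x, F' i x ^ 2 / F x ∂cellMeasure d L := by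
  -- The entropy of `F` splits into the entropy in coordinate 0, integrated over the other
  -- coordinates, and the entropy of the marginal `G`. The circle inequality controls the former and
  -- the induction hypothesis the latter.
  induction d with
  | zero =>
    have h1 : ∀ q : (Fin 0 → ℝ) → ℝ, ∫ x, q x ∂cellMeasure 0 L = q 0 := fun q => by
      have h2 : ∀ x, q x = q 0 := fun x => by rw [Subsingleton.elim x 0]
      simp only [h2]
      rw [integral_const, cellMeasure_real_univ hL]
      simp
    simp [h1]
  | succ d ih =>
    have hne : ∀ x, F x ≠ 0 := fun x => (hpos x).ne'
    have hcons := continuous_finCons d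
    have hab : -L / 2 ≤ L / 2 := by linarith
    have hpar : ∀ {q : (Fin (d + 1) → ℝ) → ℝ}, Continuous q →
        Continuous fun z : Fin d → ℝ => ∫ a in -L / 2..L / 2, q (Fin.cons a z) := fun {q} hq =>
      intervalIntegral.continuous_parametric_intervalIntegral_of_continuous'
        (f := fun z a => q (Fin.cons a z))
        (hq.comp (hcons.comp continuous_swap)) _ _
    have hsec : ∀ {q : (Fin (d + 1) → ℝ) → ℝ}, Continuous q → ∀ z : Fin d → ℝ,
        Continuous fun a : ℝ => q (Fin.cons a z) := fun {q} hq z =>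
      hq.comp (hcons.comp (by fun_prop : Continuous fun a : ℝ => (a, z)))
    let G : (Fin d → ℝ) → ℝ := fun z => ∫ a in -L / 2..L / 2, F (Fin.cons a z)
    let G' : Fin d → (Fin d → ℝ) → ℝ := fun i z => ∫ a in -L / 2..L / 2, F' i.succ (Fin.cons a z)
    have hG : Continuous G := hpar hF
    have hGpos : ∀ z, 0 < G z := fun z => intervalIntegral.intervalIntegral_pos_of_pos
      ((hsec hF z).intervalIntegrable _ _) (fun a => hpos _) (by linarith)
    have hcs : ∀ (i : Fin d) (t : ℝ) (a : ℝ) (z : Fin d → ℝ),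
        (Fin.cons a (z + Pi.single i t) : Fin (d + 1) → ℝ) = Fin.cons a z + Pi.single i.succ t := by
      intro i t a z
      ext j
      refine Fin.cases ?_ (fun k => ?_) j
      · simp
      · simp [Pi.single_apply]
    have hGp : IsPeriodic L G := fun z i => by
      simp only [G, hcs, hp _ _]
    have hGder : ∀ i z, HasLineDerivAt ℝ G (G' i z) z (Pi.single i 1) := by
      intro i z
      have key := hasDerivAt_integral_compact (μ := volume) (isCompact_Icc (a := -L / 2) (b := L / 2))
        isOpen_univ (f := fun t a => F (Fin.cons a z + t • Pi.single i.succ 1))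
        (f' := fun t a => F' i.succ (Fin.cons a z + t • Pi.single i.succ 1)) (t := 0)
        (fun t _ => ((hsec (q := fun x => F (x + t • Pi.single i.succ 1)) (by fun_prop) z)).continuousOn)
        ?_ (fun t _ a _ => hasDerivAt_line (hder i.succ) _ t) (mem_univ 0)
      · simp only [integral_Icc_eq_integral_Ioc, ← intervalIntegral.integral_of_le hab] at key
        have e : ∀ (t a : ℝ), (Fin.cons a z + t • Pi.single i.succ 1 : Fin (d + 1) → ℝ)
            = Fin.cons a (z + t • Pi.single i 1) := fun t a => by
          rw [← Pi.single_smul, ← Pi.single_smul, hcs]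
        simp only [e] at key
        simpa [HasLineDerivAt, G, G'] using key
      · refine Continuous.continuousOn ?_
        refine (hF' i.succ).comp (Continuous.add ?_ (by fun_prop))
        exact hcons.comp (by fun_prop : Continuous fun p : ℝ × ℝ => (p.2, z))
    have hIH := ih hG hGp hGpos (fun i => hpar (hF' i.succ)) hGder
    have hFlog : Continuous fun x => F x * Real.log (F x) := hF.mul (hF.log hne)
    have hGlog : Continuous fun x => G x * Real.log (G x) := hG.mul (hG.log fun z => (hGpos z).ne')
    have hquot : ∀ i, Continuous fun x => F' i x ^ 2 / F x := fun i =>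
      ((hF' i).pow 2).div hF hne
    have h1d : ∀ z : Fin d → ℝ, 4 * Real.pi ^ 2 / L ^ 2 *
        ((∫ a in -L / 2..L / 2, F (Fin.cons a z) * Real.log (F (Fin.cons a z)))
          - G z * Real.log (G z / L))
        ≤ ∫ a in -L / 2..L / 2, F' 0 (Fin.cons a z) ^ 2 / F (Fin.cons a z) := by
      intro z
      have hc0 : ∀ a t : ℝ, (Fin.cons (a + t) z : Fin (d + 1) → ℝ) = Fin.cons a z + Pi.single 0 t := by
        intro a t
        ext j
        refine Fin.cases ?_ (fun k => ?_) j
        · simp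
        · simp
      refine circle_logSobolev hL (F := fun a => F (Fin.cons a z))
        (F' := fun a => F' 0 (Fin.cons a z)) (fun a => ?_) (hsec (hF' 0) z)
        (fun a => by simp only [hc0, hp _ _]) fun a => hpos _
      have h1 := hasDerivAt_line (hder 0) (Fin.cons 0 z) a
      have e : ∀ t : ℝ, (Fin.cons 0 z + t • Pi.single 0 1 : Fin (d + 1) → ℝ) = Fin.cons t z :=
        fun t => by rw [← Pi.single_smul, smul_eq_mul, mul_one, ← hc0, zero_add]
      simpa only [e] using h1
    -- Passing to the marginal does not increase Fisher information: Cauchy–Schwarz for `F' / √F`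
    -- and `√F`.
    have hCS : ∀ (i : Fin d) (z : Fin d → ℝ), G' i z ^ 2 / G z
        ≤ ∫ a in -L / 2..L / 2, F' i.succ (Fin.cons a z) ^ 2 / F (Fin.cons a z) := by
      intro i z
      have hs : ∀ x, √(F x) ≠ 0 := fun x => (Real.sqrt_pos.2 (hpos x)).ne'
      have hint : ∀ {q : (Fin (d + 1) → ℝ) → ℝ}, Continuous q → Integrable
          (fun a => q (Fin.cons a z)) (volume.restrict (Ioc (-L / 2) (L / 2))) := fun hq =>
        ((hsec hq z).intervalIntegrable _ _).1
      have h := sq_integral_mul_le (μ := volume.restrict (Ioc (-L / 2) (L / 2)))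
        (a := fun a => F' i.succ (Fin.cons a z) / √(F (Fin.cons a z)))
        (b := fun a => √(F (Fin.cons a z)))
        (hint (q := fun x => (F' i.succ x / √(F x)) ^ 2)
          (((hF' _).div hF.sqrt hs).pow 2))
        (hint (q := fun x => √(F x) ^ 2) (hF.sqrt.pow 2))
        (hint (q := fun x => F' i.succ x / √(F x) * √(F x)) (((hF' _).div hF.sqrt hs).mul hF.sqrt))
      simp only [← intervalIntegral.integral_of_le hab, div_mul_cancel₀ _ (hs _), div_pow,
        Real.sq_sqrt (hpos _).le] at h
      rwa [div_le_iff₀ (hGpos z)]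
    have hm : ∫ x, F x ∂cellMeasure (d + 1) L = ∫ z, G z ∂cellMeasure d L := integral_cell_succ hL hF
    rw [Fin.sum_univ_succ, hm, integral_cell_succ hL hFlog, integral_cell_succ hL (hquot 0)]
    set m := ∫ z, G z ∂cellMeasure d L with hmdef
    have hLd : 0 < L ^ d := pow_pos hL d
    have hm0 : 0 < m := by
      have hcell : (cellMeasure d L) univ ≠ 0 := by
        intro h0
        have := cellMeasure_real_univ (d := d) hL
        rw [measureReal_def, h0] at this
        simp at this
        exact hLd.ne this
      rw [hmdef, integral_pos_iff_support_of_nonneg (fun z => (hGpos z).le) hG.integrable_cell]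
      have : Function.support G = univ := by
        ext z; simp [(hGpos z).ne']
      rw [this]
      exact pos_iff_ne_zero.2 hcell
    have hA : ∫ z, 4 * Real.pi ^ 2 / L ^ 2 *
        ((∫ a in -L / 2..L / 2, F (Fin.cons a z) * Real.log (F (Fin.cons a z)))
          - G z * Real.log (G z / L)) ∂cellMeasure d L
        ≤ ∫ z, (∫ a in -L / 2..L / 2, F' 0 (Fin.cons a z) ^ 2 / F (Fin.cons a z)) ∂cellMeasure d L := by
      refine integral_mono (Continuous.integrable_cell ?_) (hpar (hquot 0)).integrable_cell h1d
      exact continuous_const.mul ((hpar hFlog).sub (hG.mul ((hG.div_const L).log fun z =>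
        (div_pos (hGpos z) hL).ne')))
    have hB : ∑ i, ∫ z, G' i z ^ 2 / G z ∂cellMeasure d L
        ≤ ∑ i : Fin d, ∫ x, F' i.succ x ^ 2 / F x ∂cellMeasure (d + 1) L := by
      refine Finset.sum_le_sum fun i _ => ?_
      rw [integral_cell_succ hL (hquot i.succ)]
      exact integral_mono (((hpar (hF' i.succ)).pow 2).div hG fun z => (hGpos z).ne').integrable_cell
        (hpar (hquot i.succ)).integrable_cell (hCS i)
    rw [integral_const_mul] at hA
    have hsplit : ∫ z, ((∫ a in -L / 2..L / 2, F (Fin.cons a z) * Real.log (F (Fin.cons a z)))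
          - G z * Real.log (G z / L)) ∂cellMeasure d L
        = (∫ z, (∫ a in -L / 2..L / 2, F (Fin.cons a z) * Real.log (F (Fin.cons a z)))
            ∂cellMeasure d L) - ((∫ z, G z * Real.log (G z) ∂cellMeasure d L) - Real.log L * m) := by
      have e : ∀ z, G z * Real.log (G z / L) = G z * Real.log (G z) - Real.log L * G z := fun z => by
        rw [Real.log_div (hGpos z).ne' hL.ne']; ring
      simp only [e]
      have hc2 : Continuous fun z => G z * Real.log (G z) - Real.log L * G z :=
        hGlog.sub (hG.const_mul _)
      rw [integral_sub (hpar hFlog).integrable_cell hc2.integrable_cell,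
        integral_sub hGlog.integrable_cell (hG.const_mul _).integrable_cell, integral_const_mul]
    rw [hsplit] at hA
    have hlogm : Real.log (m / L ^ (d + 1)) = Real.log (m / L ^ d) - Real.log L := by
      rw [pow_succ, ← div_div, Real.log_div (div_pos hm0 hLd).ne' hL.ne']
    rw [hlogm]
    refine le_trans (le_of_eq ?_) (add_le_add hA (hIH.trans hB))
    ring

end TorusLogSobolev

/-! ### Regularity of the Vlasov field and the bound on its divergence. -/

section VlasovTerm

variable {d : ℕ} {L : ℝ} {D : (Fin d → ℝ) → ℝ} {G : Fin d → (Fin d → ℝ) → ℝ}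
  {H : Fin d → Fin d → (Fin d → ℝ) → ℝ} {a : (Fin d → ℝ) → ℝ}

lemma exists_ae_bound_of_memLp_top (hL : 0 < L) {g : (Fin d → ℝ) → ℝ} (hg : IsPeriodic L g)
    (hb : MemLp g ⊤ (cellMeasure d L)) : ∃ K, ∀ᵐ x, |g x| ≤ K := by
  refine ⟨(eLpNorm g ⊤ (cellMeasure d L)).toReal, ae_volume_of_ae_cell hL hg (P := fun y => |y| ≤ _) ?_⟩
  filter_upwards [ae_le_eLpNormEssSup (f := g) (μ := cellMeasure d L)] with x hx
  rw [← eLpNorm_exponent_top] at hx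
  have := (ENNReal.toReal_le_toReal (by simp) hb.2.ne).2 hx
  simpa using this

lemma ae_abs_laplacian_le (hL : 0 < L) (hD : IsW2InfPotential L D G H) :
    ∀ᵐ x, |∑ i, H i i x| ≤ lapNorm L H := by
  have hp : IsPeriodic L fun x => ∑ i, H i i x := fun x j =>
    Finset.sum_congr rfl fun i _ => hD.periodic_hess i i x j
  have hm : MemLp (fun x => ∑ i, H i i x) ⊤ (cellMeasure d L) :=
    memLp_finsetSum _ fun i _ => hD.bdd_hess i i
  refine ae_volume_of_ae_cell hL hp (P := fun y => |y| ≤ _) ?_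
  filter_upwards [ae_le_eLpNormEssSup (f := fun x => ∑ i, H i i x) (μ := cellMeasure d L)] with x hx
  rw [← eLpNorm_exponent_top] at hx
  have := (ENNReal.toReal_le_toReal (by simp) hm.2.ne).2 hx
  simpa [lapNorm] using this

lemma integral_cell_eq_integral_indicator (g a : (Fin d → ℝ) → ℝ) (x : Fin d → ℝ) :
    ∫ y, g (x - y) * a y ∂cellMeasure d L = ∫ y, g (x - y) * (cell d L).indicator a y := by
  rw [cellMeasure, ← integral_indicator (measurableSet_cell d L)]
  congr 1
  ext y
  by_cases hy : y ∈ cell d L <;> simp [hy]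

lemma continuous_cell_convolution {g : (Fin d → ℝ) → ℝ} {K : ℝ} (hg : LocallyIntegrable g volume)
    (hK : ∀ᵐ x, |g x| ≤ K) (ha : Integrable a (cellMeasure d L)) :
    Continuous fun x => ∫ y, g (x - y) * a y ∂cellMeasure d L := by
  simp only [integral_cell_eq_integral_indicator]
  exact continuous_integral_comp_sub_mul hg hK ((integrable_indicator_iff (measurableSet_cell d L)).2 ha)

lemma isPeriodic_cell_convolution {g : (Fin d → ℝ) → ℝ} (hg : IsPeriodic L g) :
    IsPeriodic L fun x => ∫ y, g (x - y) * a y ∂cellMeasure d L := fun x i => by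
  have e : ∀ y, x + Pi.single i L - y = x - y + Pi.single i L := fun y => by abel
  simp only [e, hg _ _]

lemma hasLineDerivAt_cell_convolution (hL : 0 < L) (hD : IsW2InfPotential L D G H)
    (ha : Integrable a (cellMeasure d L)) (i : Fin d) (x : Fin d → ℝ) :
    HasLineDerivAt ℝ (fun x => ∫ y, G i (x - y) * a y ∂cellMeasure d L)
      (∫ y, H i i (x - y) * a y ∂cellMeasure d L) x (Pi.single i 1) := by
  obtain ⟨K, hK⟩ := exists_ae_bound_of_memLp_top hL (hD.periodic_grad i) (hD.bdd_grad i)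
  obtain ⟨K', hK'⟩ := exists_ae_bound_of_memLp_top hL (hD.periodic_hess i i) (hD.bdd_hess i i)
  simp only [integral_cell_eq_integral_indicator]
  exact hasLineDerivAt_integral_comp_sub_mul (hD.weak_hess i i) hK hK'
    ((integrable_indicator_iff (measurableSet_cell d L)).2 ha) x

lemma continuous_vlasov_aux (hL : 0 < L) (hD : IsW2InfPotential L D G H)
    (ha : Integrable a (cellMeasure d L)) (i : Fin d) :
    Continuous (fun x => ∫ y, G i (x - y) * a y ∂cellMeasure d L) ∧
    Continuous (fun x => ∫ y, H i i (x - y) * a y ∂cellMeasure d L) := by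
  obtain ⟨K, hK⟩ := exists_ae_bound_of_memLp_top hL (hD.periodic_grad i) (hD.bdd_grad i)
  obtain ⟨K', hK'⟩ := exists_ae_bound_of_memLp_top hL (hD.periodic_hess i i) (hD.bdd_hess i i)
  exact ⟨continuous_cell_convolution (hD.weak_hess i i).1 hK ha,
    continuous_cell_convolution (hD.weak_hess i i).2.1 hK' ha⟩

/-- Convolving `G i` with the constant 1 gives a constant function of `x`, whose derivative is this
integral. -/
lemma integral_hess_sub_eq_zero (hL : 0 < L) (hD : IsW2InfPotential L D G H) (i : Fin d)
    (x : Fin d → ℝ) : ∫ y, H i i (x - y) ∂cellMeasure d L = 0 := by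
  have h1 := hasLineDerivAt_cell_convolution hL hD (a := fun _ => 1) (integrable_const 1) i x
  simp only [mul_one, integral_cell_sub hL (hD.periodic_grad i)] at h1
  exact HasDerivAt.unique h1 (hasDerivAt_const _ _)

/-- By `integral_hess_sub_eq_zero` any constant may be subtracted from `a`. Summing over `i` under
the integral before taking absolute values leaves only the norm of the Laplacian. -/
lemma abs_div_vlasov_le (hL : 0 < L) (hD : IsW2InfPotential L D G H)
    (ha : Integrable a (cellMeasure d L)) (c : ℝ) (x : Fin d → ℝ) :
    |∑ i, ∫ y, H i i (x - y) * a y ∂cellMeasure d L|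
      ≤ lapNorm L H * ∫ y, |a y - c| ∂cellMeasure d L := by
  have hint : ∀ (b : (Fin d → ℝ) → ℝ) (_ : Integrable b (cellMeasure d L)) (i : Fin d),
      Integrable (fun y => H i i (x - y) * b y) (cellMeasure d L) := fun b hb i => by
    obtain ⟨K', hK'⟩ := exists_ae_bound_of_memLp_top hL (hD.periodic_hess i i) (hD.bdd_hess i i)
    have h1 := integrable_comp_sub_mul (hD.weak_hess i i).2.1.aestronglyMeasurable hK'
      ((integrable_indicator_iff (measurableSet_cell d L)).2 hb) x
    refine (h1.integrableOn (s := cell d L)).congr_fun (fun y hy => ?_) (measurableSet_cell d L)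
    simp [hy]
  have h1 : ∀ i, ∫ y, H i i (x - y) * a y ∂cellMeasure d L
      = ∫ y, H i i (x - y) * (a y - c) ∂cellMeasure d L := fun i => by
    have h2 := hint (fun _ => c) (integrable_const c) i
    simp only [mul_sub]
    rw [integral_sub (hint a ha i) h2, integral_mul_const, integral_hess_sub_eq_zero hL hD]
    simp
  have hac : Integrable (fun y => a y - c) (cellMeasure d L) := ha.sub (integrable_const c)
  simp only [h1]
  rw [← integral_finsetSum _ fun i _ => hint _ hac i]
  simp only [← Finset.sum_mul]
  rw [integral_cell_eq_integral_indicator (fun z => ∑ i, H i i z)]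
  refine (abs_integral_comp_sub_mul_le (ae_abs_laplacian_le hL hD)
    ((integrable_indicator_iff (measurableSet_cell d L)).2 hac) x).trans_eq ?_
  congr 1
  rw [cellMeasure, ← integral_indicator (measurableSet_cell d L)]
  congr 1
  ext y
  by_cases hy : y ∈ cell d L <;> simp [hy]

end VlasovTerm

/-! ### Calculus of directional derivatives and conditions at a minimum. -/

section PartialDerivatives

variable {d : ℕ} {L : ℝ} {f : (Fin d → ℝ) → ℝ}

lemma ContDiff.pd {n : WithTop ℕ∞} {m : WithTop ℕ∞} (hf : ContDiff ℝ n f) (hmn : m + 1 ≤ n)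
    (i : Fin d) : ContDiff ℝ m (pd i f) := by
  have hd : Differentiable ℝ f := hf.differentiable (by
    rintro rfl
    simp at hmn)
  have h1 : _root_.pd i f = fun x => fderiv ℝ f x (Pi.single i 1) :=
    funext fun x => pd_eq_fderiv hd i x
  rw [h1]
  exact (hf.fderiv_right hmn).clm_apply contDiff_const

lemma hasLineDerivAt_pd (hf : Differentiable ℝ f) (i : Fin d) (x : Fin d → ℝ) :
    HasLineDerivAt ℝ f (pd i f x) x (Pi.single i 1) :=
  ((hf x).hasFDerivAt.hasLineDerivAt (Pi.single i 1)).lineDifferentiableAt.hasLineDerivAt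

lemma HasLineDerivAt.mul_of_real {f g : (Fin d → ℝ) → ℝ} {f' g' : ℝ} {x v : Fin d → ℝ}
    (hf : HasLineDerivAt ℝ f f' x v) (hg : HasLineDerivAt ℝ g g' x v) :
    HasLineDerivAt ℝ (fun x => f x * g x) (f' * g x + f x * g') x v := by
  have h1 : HasDerivAt (fun t : ℝ => f (x + t • v)) f' 0 := hf
  have h2 : HasDerivAt (fun t : ℝ => g (x + t • v)) g' 0 := hg
  have h3 := h1.mul h2
  simp only [zero_smul, add_zero] at h3
  exact h3

lemma HasLineDerivAt.comp_real {g : (Fin d → ℝ) → ℝ} {φ : ℝ → ℝ} {φ' g' : ℝ} {x v : Fin d → ℝ}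
    (hφ : HasDerivAt φ φ' (g x)) (hg : HasLineDerivAt ℝ g g' x v) :
    HasLineDerivAt ℝ (fun x => φ (g x)) (φ' * g') x v := by
  have h2 : HasDerivAt (fun t : ℝ => g (x + t • v)) g' 0 := hg
  have h1 : HasDerivAt φ φ' (g (x + (0 : ℝ) • v)) := by simpa using hφ
  exact h1.comp (0 : ℝ) h2

/-- A negative second derivative would also make `x` a local maximum, hence `g` locally constant
with second derivative zero. -/
lemma deriv_deriv_nonneg_of_isLocalMin {g : ℝ → ℝ} {x : ℝ} (hc : Continuous g)
    (h : IsLocalMin g x) : 0 ≤ deriv (deriv g) x := by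
  by_contra! hneg
  have hmax := isLocalMax_of_deriv_deriv_neg hneg h.deriv_eq_zero hc.continuousAt
  have hconst : g =ᶠ[nhds x] fun _ => g x := by
    filter_upwards [h, hmax] with y h1 h2 using le_antisymm h2 h1
  have h1 : deriv g =ᶠ[nhds x] fun _ => 0 := by
    filter_upwards [hconst.eventuallyEq_nhds] with y hy
    rw [hy.deriv_eq, deriv_const]
  rw [h1.deriv_eq, deriv_const] at hneg
  exact hneg.false

lemma pd_eq_zero_of_forall_le (hf : ContDiff ℝ 2 f) {x : Fin d → ℝ} (h : ∀ y, f x ≤ f y)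
    (i : Fin d) : pd i f x = 0 ∧ 0 ≤ pd i (pd i f) x := by
  have hd : Differentiable ℝ f := hf.differentiable (by simp)
  have hline := hasDerivAt_line (hasLineDerivAt_pd hd i) x
  have hmin : IsLocalMin (fun s : ℝ => f (x + s • Pi.single i 1)) 0 :=
    Filter.Eventually.of_forall fun s => by simpa using h _
  constructor
  · have := hmin.hasDerivAt_eq_zero (hline 0)
    simpa using this
  · have h1 := deriv_deriv_nonneg_of_isLocalMin (by fun_prop) hmin
    have h2 : deriv (fun s : ℝ => f (x + s • Pi.single i 1))
        = fun s => pd i f (x + s • Pi.single i 1) := funext fun s => (hline s).deriv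
    rw [h2] at h1
    exact h1

end PartialDerivatives

/-! ### Positivity of solutions. -/

section MaximumPrinciple

variable {d : ℕ} {L : ℝ}

/-- The weak minimum principle for a periodic Fokker--Planck equation. -/
lemma nonneg_of_solution (hL : 0 < L) {κ K T : ℝ} (hκ : 0 < κ) {u : ℝ → (Fin d → ℝ) → ℝ}
    {V W : ℝ → Fin d → (Fin d → ℝ) → ℝ} (hp : ∀ t ∈ Icc 0 T, IsPeriodic L (u t))
    (hc : ContinuousOn (fun p : ℝ × (Fin d → ℝ) => u p.1 p.2) (Ici 0 ×ˢ univ))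
    (h0 : ∀ x, 0 ≤ u 0 x) (hu : ∀ t ∈ Ioc 0 T, ContDiff ℝ 2 (u t))
    (hV : ∀ t ∈ Ioc 0 T, ∀ i x, HasLineDerivAt ℝ (V t i) (W t i x) x (Pi.single i 1))
    (hW : ∀ t ∈ Ioc 0 T, ∀ x, |∑ i, W t i x| ≤ K)
    (heq : ∀ t ∈ Ioc 0 T, ∀ x, HasDerivAt (fun s => u s x)
      (κ * ∑ i, pd i (fun y => u t y * V t i y) x + ∑ i, pd i (pd i (u t)) x) t)
    {t : ℝ} (ht : t ∈ Icc 0 T) (x : Fin d → ℝ) : 0 ≤ u t x := by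
  -- At a negative minimum of `v` the zeroth-order term `κ u div V` is at least `κ K u`. The weight
  -- `exp (-M t)` outweighs it, and the extra 1 makes the time derivative of `v` strictly positive.
  let M := κ * K + 1
  let v : ℝ → (Fin d → ℝ) → ℝ := fun t x => Real.exp (-M * t) * u t x
  have hne : (Icc 0 T ×ˢ cell d L).Nonempty := by
    refine ⟨(t, 0), ht, fun i _ => ?_⟩
    simp only [Pi.zero_apply, mem_Icc]
    constructor <;> linarith
  have hvc : ContinuousOn (fun p : ℝ × (Fin d → ℝ) => v p.1 p.2) (Icc 0 T ×ˢ cell d L) := by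
    refine ContinuousOn.mul (by fun_prop) (hc.mono ?_)
    exact prod_mono Icc_subset_Ici_self (subset_univ _)
  obtain ⟨⟨t₀, x₀⟩, ⟨ht₀, hx₀⟩, hmin⟩ :=
    (isCompact_Icc.prod (isCompact_cell d L)).exists_isMinOn hne hvc
  change t₀ ∈ Icc 0 T at ht₀
  have hmin' : ∀ t ∈ Icc 0 T, ∀ x, v t₀ x₀ ≤ v t x := fun t ht x => by
    have hpv : IsPeriodic L (v t) := fun y i => by simp only [v, hp t ht y i]
    exact hpv.forall_of_cell hL (P := fun y => v t₀ x₀ ≤ y)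
      (fun y hy => hmin (mk_mem_prod ht hy)) x
  suffices hpos : 0 ≤ v t₀ x₀ by
    have := hpos.trans (hmin' t ht x)
    exact nonneg_of_mul_nonneg_right this (Real.exp_pos _)
  by_contra! hneg
  have hu0 : u t₀ x₀ < 0 := by
    by_contra! h
    exact hneg.not_ge (mul_nonneg (Real.exp_pos _).le h)
  have ht₀0 : 0 < t₀ := by
    rcases ht₀.1.eq_or_lt with h | h
    · rw [← h] at hu0
      exact absurd (h0 x₀) (not_le.2 hu0)
    · exact h
  have ht₀' : t₀ ∈ Ioc 0 T := ⟨ht₀0, ht₀.2⟩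
  have huv : ∀ y, u t₀ x₀ ≤ u t₀ y := fun y =>
    le_of_mul_le_mul_left (hmin' t₀ ht₀ y) (Real.exp_pos _)
  have hd : Differentiable ℝ (u t₀) := (hu t₀ ht₀').differentiable (by simp)
  have hpd := pd_eq_zero_of_forall_le (hu t₀ ht₀') huv
  have hprod : ∀ i, pd i (fun y => u t₀ y * V t₀ i y) x₀ = u t₀ x₀ * W t₀ i x₀ := fun i => by
    have := ((hasLineDerivAt_pd hd i x₀).mul_of_real (hV t₀ ht₀' i x₀)).lineDeriv
    rw [(hpd i).1, zero_mul, zero_add] at this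
    exact this
  have hder := heq t₀ ht₀' x₀
  simp only [hprod, ← Finset.mul_sum] at hder
  set R := κ * (u t₀ x₀ * ∑ i, W t₀ i x₀) + ∑ i, pd i (pd i (u t₀)) x₀ with hR
  have hRlow : κ * K * u t₀ x₀ ≤ R := by
    have h1 : 0 ≤ ∑ i, pd i (pd i (u t₀)) x₀ := Finset.sum_nonneg fun i _ => (hpd i).2
    have h2 : u t₀ x₀ * K ≤ u t₀ x₀ * ∑ i, W t₀ i x₀ :=
      mul_le_mul_of_nonpos_left ((le_abs_self _).trans (hW t₀ ht₀' x₀)) hu0.le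
    have h3 := mul_le_mul_of_nonneg_left h2 hκ.le
    rw [hR]
    linarith
  have hvder : HasDerivAt (fun s => v s x₀) (Real.exp (-M * t₀) * (R - M * u t₀ x₀)) t₀ := by
    have h1 : HasDerivAt (fun s : ℝ => Real.exp (-M * s)) (Real.exp (-M * t₀) * -M) t₀ := by
      simpa using ((hasDerivAt_id t₀).const_mul (-M)).exp
    refine (h1.mul hder).congr_deriv ?_
    ring
  have hvpos : 0 < Real.exp (-M * t₀) * (R - M * u t₀ x₀) := by
    refine mul_pos (Real.exp_pos _) ?_
    simp only [M]
    linarith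
  -- Only earlier times are compared, since `t₀` may be the final time `T`.
  have hslope := hasDerivAt_iff_tendsto_slope_left_right.1 hvder |>.1
  have hle : Real.exp (-M * t₀) * (R - M * u t₀ x₀) ≤ 0 := by
    refine le_of_tendsto hslope ?_
    filter_upwards [Ioo_mem_nhdsLT ht₀0] with s hs
    rw [slope_def_field]
    exact div_nonpos_of_nonneg_of_nonpos
      (sub_nonneg.2 (hmin' s ⟨hs.1.le, hs.2.le.trans ht₀.2⟩ x₀)) (by linarith [hs.2])
  exact hle.not_gt hvpos

end MaximumPrinciple

/-! ### Mass and entropy balance for a Fokker–Planck equation with given drift. -/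

section FokkerPlanck
open Filter Topology

variable {d : ℕ} {L κ : ℝ}

/-- Right-hand side of the Fokker--Planck equation with drift `-κ V`. -/
def fpRhs (κ : ℝ) (u : (Fin d → ℝ) → ℝ) (V : Fin d → (Fin d → ℝ) → ℝ) (x : Fin d → ℝ) : ℝ :=
  κ * ∑ i, pd i (fun y => u y * V i y) x + ∑ i, pd i (pd i u) x

/-- `V` is a periodic vector field with continuous partial derivatives `W i = ∂ᵢ Vᵢ`. -/
structure IsTorusField (L : ℝ) (V W : Fin d → (Fin d → ℝ) → ℝ) : Prop where
  periodic : ∀ i, IsPeriodic L (V i)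
  continuous : ∀ i, Continuous (V i)
  continuous_deriv : ∀ i, Continuous (W i)
  hasLineDerivAt : ∀ i x, HasLineDerivAt ℝ (V i) (W i x) x (Pi.single i 1)

/-- Integration by parts for the weak form of the equation tested with `φ₁ ∘ u`. -/
lemma integral_comp_mul_fpRhs (hL : 0 < L) {u : (Fin d → ℝ) → ℝ} {V W : Fin d → (Fin d → ℝ) → ℝ}
    (hV : IsTorusField L V W) (hu : ContDiff ℝ 2 u) (hp : IsPeriodic L u) {φ₁ φ₂ χ : ℝ → ℝ}
    (h1 : ∀ x, HasDerivAt φ₁ (φ₂ (u x)) (u x)) (h2 : ∀ x, HasDerivAt χ (u x * φ₂ (u x)) (u x))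
    (h3 : Continuous fun x => φ₂ (u x)) :
    ∫ x, φ₁ (u x) * fpRhs κ u V x ∂cellMeasure d L
      = -(∑ i, ∫ x, φ₂ (u x) * pd i u x ^ 2 ∂cellMeasure d L)
        + κ * ∫ x, χ (u x) * ∑ i, W i x ∂cellMeasure d L := by
  have hd : Differentiable ℝ u := hu.differentiable (by simp)
  have huc : Continuous u := hu.continuous
  have hpd : ∀ i, ContDiff ℝ 1 (pd i u) := fun i => hu.pd (by norm_num) i
  have hpc : ∀ i, Continuous (pd i u) := fun i => (hpd i).continuous
  have hppc : ∀ i, Continuous (pd i (pd i u)) := fun i => ((hpd i).pd (m := 0) (by norm_num) i).continuous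
  have hφ₁c : Continuous fun x => φ₁ (u x) := continuous_iff_continuousAt.2 fun x =>
    (h1 x).continuousAt.comp huc.continuousAt
  have hχc : Continuous fun x => χ (u x) := continuous_iff_continuousAt.2 fun x =>
    (h2 x).continuousAt.comp huc.continuousAt
  have hVc := hV.continuous
  have hWc := hV.continuous_deriv
  have hprod : ∀ i x, HasLineDerivAt ℝ (fun y => u y * V i y) (pd i u x * V i x + u x * W i x) x
      (Pi.single i 1) := fun i x => (hasLineDerivAt_pd hd i x).mul_of_real (hV.hasLineDerivAt i x)
  have hpprod : ∀ i, pd i (fun y => u y * V i y) = fun x => pd i u x * V i x + u x * W i x :=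
    fun i => funext fun x => (hprod i x).lineDeriv
  have hA : ∀ i, Continuous fun x => φ₂ (u x) * pd i u x ^ 2 := fun i => h3.mul ((hpc i).pow 2)
  have hB : ∀ i, Continuous fun x => φ₁ (u x) *
      (κ * pd i (fun y => u y * V i y) x + pd i (pd i u) x) := fun i => by
    simp only [hpprod]
    exact hφ₁c.mul ((continuous_const.mul (((hpc i).mul (hVc i)).add (huc.mul (hWc i)))).add (hppc i))
  have hC : ∀ i, Continuous fun x => χ (u x) * W i x := fun i => hχc.mul (hWc i)
  -- The integrand is the `i`-th derivative of a periodic flux. As `χ` is a primitive of `y φ₂(y)`,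
  -- its correction term moves the derivative from `u` onto the drift, leaving only `W`.
  have hzero : ∀ i, ∫ x, (φ₂ (u x) * pd i u x ^ 2
      + φ₁ (u x) * (κ * pd i (fun y => u y * V i y) x + pd i (pd i u) x)
      - κ * (χ (u x) * W i x)) ∂cellMeasure d L = 0 := by
    intro i
    have hper : IsPeriodic L (pd i u) := isPeriodic_of_hasLineDerivAt hp (hasLineDerivAt_pd hd i)
    refine integral_cell_lineDeriv_eq_zero hL (v := Pi.single i 1)
      (f := fun x => φ₁ (u x) * (κ * (u x * V i x) + pd i u x) - κ * (χ (u x) * V i x)) ?_ ?_ ?_ ?_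
    · intro x j
      simp only [hp x j, hV.periodic i x j, hper x j]
    · exact (hφ₁c.mul ((continuous_const.mul (huc.mul (hVc i))).add (hpc i))).sub
        (continuous_const.mul (hχc.mul (hVc i)))
    · exact ((hA i).add (hB i)).sub (continuous_const.mul (hC i))
    · intro x
      have e1 := HasLineDerivAt.comp_real (h1 x) (hasLineDerivAt_pd hd i x)
      have e2 := HasLineDerivAt.comp_real (h2 x) (hasLineDerivAt_pd hd i x)
      have e3 : HasLineDerivAt ℝ (fun x => κ * (u x * V i x) + pd i u x)
          (κ * (pd i u x * V i x + u x * W i x) + pd i (pd i u) x) x (Pi.single i 1) :=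
        HasDerivAt.add (HasDerivAt.const_mul κ (hprod i x))
          (hasLineDerivAt_pd ((hpd i).differentiable (by simp)) i x)
      have e4 := e1.mul_of_real e3
      have e5 := e2.mul_of_real (hV.hasLineDerivAt i x)
      have e6 : HasLineDerivAt ℝ (fun x => φ₁ (u x) * (κ * (u x * V i x) + pd i u x)
          - κ * (χ (u x) * V i x)) _ x (Pi.single i 1) :=
        HasDerivAt.sub e4 (HasDerivAt.const_mul κ e5)
      have e7 : (φ₂ (u x) * pd i u x ^ 2
          + φ₁ (u x) * (κ * pd i (fun y => u y * V i y) x + pd i (pd i u) x)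
          - κ * (χ (u x) * W i x)) = φ₂ (u x) * pd i u x * (κ * (u x * V i x) + pd i u x)
          + φ₁ (u x) * (κ * (pd i u x * V i x + u x * W i x) + pd i (pd i u) x)
          - κ * (u x * φ₂ (u x) * pd i u x * V i x + χ (u x) * W i x) := by
        simp only [hpprod]
        ring
      rw [e7]
      exact e6
  have hsum : ∑ i, ∫ x, φ₁ (u x) * (κ * pd i (fun y => u y * V i y) x + pd i (pd i u) x)
      ∂cellMeasure d L = ∑ i, (-(∫ x, φ₂ (u x) * pd i u x ^ 2 ∂cellMeasure d L)
        + κ * ∫ x, χ (u x) * W i x ∂cellMeasure d L) := by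
    refine Finset.sum_congr rfl fun i _ => ?_
    have hAB : Continuous fun x => φ₂ (u x) * pd i u x ^ 2
      + φ₁ (u x) * (κ * pd i (fun y => u y * V i y) x + pd i (pd i u) x) := (hA i).add (hB i)
    have := hzero i
    rw [integral_sub hAB.integrable_cell ((hC i).integrable_cell.const_mul κ),
      integral_add (hA i).integrable_cell (hB i).integrable_cell, integral_const_mul] at this
    linarith
  rw [Finset.sum_add_distrib, Finset.sum_neg_distrib, ← Finset.mul_sum,
    ← integral_finsetSum _ fun i _ => (hB i).integrable_cell,
    ← integral_finsetSum _ fun i _ => (hC i).integrable_cell] at hsum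
  simp only [Finset.mul_sum] at hsum ⊢
  rw [← hsum]
  congr 1
  ext x
  rw [fpRhs, Finset.mul_sum, ← Finset.sum_add_distrib, Finset.mul_sum]

/-- Classical periodic solutions of a Fokker--Planck equation with given drift. -/
structure IsFPSolution (L κ : ℝ) (V W : ℝ → Fin d → (Fin d → ℝ) → ℝ) (u : ℝ → (Fin d → ℝ) → ℝ) :
    Prop where
  periodic : ∀ t, 0 ≤ t → IsPeriodic L (u t)
  continuousOn : ContinuousOn (fun p : ℝ × (Fin d → ℝ) => u p.1 p.2) (Ici 0 ×ˢ univ)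
  continuous_dt : ContinuousOn
    (fun p : ℝ × (Fin d → ℝ) => deriv (fun s => u s p.2) p.1) (Ioi 0 ×ˢ univ)
  contDiff : ∀ t, 0 < t → ContDiff ℝ 2 (u t)
  field : ∀ t, 0 < t → IsTorusField L (V t) (W t)
  equation : ∀ t, 0 < t → ∀ x, HasDerivAt (fun s => u s x) (fpRhs κ (u t) (V t) x) t

variable {V W : ℝ → Fin d → (Fin d → ℝ) → ℝ} {u : ℝ → (Fin d → ℝ) → ℝ}

/-- Freezing the solution at its initial value for negative times gives a globally continuous
function, which avoids one-sided statements at time zero. -/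
lemma continuous_max_time
    (h : ContinuousOn (fun p : ℝ × (Fin d → ℝ) => u p.1 p.2) (Ici 0 ×ˢ univ)) :
    Continuous fun p : ℝ × (Fin d → ℝ) => u (max p.1 0) p.2 :=
  h.comp_continuous (f := fun p : ℝ × (Fin d → ℝ) => (max p.1 0, p.2)) (by fun_prop)
    fun p => ⟨mem_Ici.2 (le_max_right _ _), mem_univ _⟩

lemma continuous_slice
    (h : ContinuousOn (fun p : ℝ × (Fin d → ℝ) => u p.1 p.2) (Ici 0 ×ˢ univ)) {t : ℝ} (ht : 0 ≤ t) :
    Continuous (u t) :=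
  h.comp_continuous (f := fun x => (t, x)) (by fun_prop) fun p => ⟨ht, mem_univ _⟩

lemma continuous_integral_max_time
    (h : ContinuousOn (fun p : ℝ × (Fin d → ℝ) => u p.1 p.2) (Ici 0 ×ˢ univ)) {φ : ℝ → ℝ}
    (hφ : Continuous φ) : Continuous fun t => ∫ x, φ (u (max t 0) x) ∂cellMeasure d L :=
  continuous_parametric_integral_of_continuous (f := fun t x => φ (u (max t 0) x))
    (hφ.comp (continuous_max_time h)) (isCompact_cell d L)

lemma IsFPSolution.hasDerivAt_integral (hu : IsFPSolution L κ V W u)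
    (hpos : ∀ t, 0 ≤ t → ∀ x, 0 ≤ u t x) {φ φ₁ : ℝ → ℝ} (hφ : ∀ y, 0 ≤ y → HasDerivAt φ (φ₁ y) y)
    (hφ₁ : ContinuousOn φ₁ (Ici 0)) {t : ℝ} (ht : 0 < t) :
    HasDerivAt (fun t => ∫ x, φ (u t x) ∂cellMeasure d L)
      (∫ x, φ₁ (u t x) * fpRhs κ (u t) (V t) x ∂cellMeasure d L) t := by
  have key := hasDerivAt_integral_compact (μ := volume) (isCompact_cell d L) isOpen_Ioi
    (f := fun t x => φ (u t x)) (f' := fun t x => φ₁ (u t x) * deriv (fun s => u s x) t)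
    (fun s hs => ?_) ?_ (fun s hs x _ => ?_) (mem_Ioi.2 ht)
  · have e : ∀ x, deriv (fun s => u s x) t = fpRhs κ (u t) (V t) x := fun x =>
      (hu.equation t ht x).deriv
    simp only [e] at key
    exact key
  · refine Continuous.continuousOn (continuous_iff_continuousAt.2 fun x => ?_)
    exact (hφ _ (hpos s (mem_Ioi.1 hs).le x)).continuousAt.comp
      (hu.contDiff s hs).continuous.continuousAt
  · refine ContinuousOn.mul ?_ (hu.continuous_dt.mono (prod_mono_right (subset_univ _)))
    refine hφ₁.comp (hu.continuousOn.mono (prod_mono Ioi_subset_Ici_self (subset_univ _))) ?_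
    rintro ⟨s, x⟩ ⟨hs, -⟩
    exact hpos s (mem_Ioi.1 hs).le x
  · have h1 := hu.equation s hs x
    rw [h1.deriv]
    exact (hφ _ (hpos s (mem_Ioi.1 hs).le x)).comp s h1

/-- Conservation of mass. -/
lemma IsFPSolution.integral_eq (hL : 0 < L) (hu : IsFPSolution L κ V W u)
    (hpos : ∀ t, 0 ≤ t → ∀ x, 0 ≤ u t x) {t : ℝ} (ht : 0 ≤ t) :
    ∫ x, u t x ∂cellMeasure d L = ∫ x, u 0 x ∂cellMeasure d L := by
  rcases ht.eq_or_lt with rfl | ht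
  · rfl
  have hc := continuous_integral_max_time (L := L) hu.continuousOn continuous_id
  have hcO : ContinuousOn (fun t => ∫ x, u t x ∂cellMeasure d L) (Icc 0 t) := by
    refine hc.continuousOn.congr fun s hs => ?_
    simp [max_eq_left hs.1]
  have hder : ∀ s ∈ Ioo 0 t, HasDerivAt (fun t => ∫ x, u t x ∂cellMeasure d L) 0 s := by
    intro s hs
    have h1 := hu.hasDerivAt_integral hpos (φ := id) (φ₁ := fun _ => 1)
      (fun y _ => hasDerivAt_id y) continuousOn_const hs.1
    have h2 := integral_comp_mul_fpRhs (κ := κ) hL (hu.field s hs.1) (hu.contDiff s hs.1)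
      (hu.periodic s hs.1.le) (φ₁ := fun _ => 1) (φ₂ := fun _ => 0) (χ := fun _ => 0)
      (fun x => hasDerivAt_const _ _) (fun x => by simpa using hasDerivAt_const _ _)
      continuous_const
    simp only [zero_mul, integral_zero, Finset.sum_const_zero, neg_zero, mul_zero, add_zero] at h2
    rw [h2] at h1
    exact h1
  obtain ⟨c, -, hc⟩ := exists_hasDerivAt_eq_slope _ _ ht hcO hder
  rw [eq_comm, div_eq_zero_iff] at hc
  rcases hc with h | h <;> linarith


/-- Dissipation of the regularised entropy at a fixed time. -/
lemma entropy_dissipation (hL : 0 < L) (hκ : 0 < κ) {u : (Fin d → ℝ) → ℝ}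
    {V W : Fin d → (Fin d → ℝ) → ℝ} (hV : IsTorusField L V W) (hu : ContDiff ℝ 2 u)
    (hp : IsPeriodic L u) (hpos : ∀ x, 0 ≤ u x) (hmass : ∫ x, u x ∂cellMeasure d L = 1)
    {M : ℝ} (hM : ∀ x, u x ≤ M) {B : ℝ} (hB : ∀ x, |∑ i, W i x| ≤ B) {ε : ℝ} (hε : 0 < ε) :
    ∫ x, (Real.log (u x + ε) + 1) * fpRhs κ u V x ∂cellMeasure d L
      ≤ -(4 * Real.pi ^ 2 / L ^ 2) * ((∫ x, (u x + ε) * Real.log (u x + ε) ∂cellMeasure d L)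
          - (1 + ε * L ^ d) * Real.log ((1 + ε * L ^ d) / L ^ d))
        + κ * (B * (∫ x, |u x - 1 / L ^ d| ∂cellMeasure d L)
          + B * (L ^ d * (ε * Real.log (M + ε) - ε * Real.log ε))) := by
  have huc : Continuous u := hu.continuous
  have hd : Differentiable ℝ u := hu.differentiable (by simp)
  have hpe : ∀ x, 0 < u x + ε := fun x => add_pos_of_nonneg_of_pos (hpos x) hε
  have hpc : ∀ i, Continuous (pd i u) := fun i => (hu.pd (m := 1) (by norm_num) i).continuous
  -- The primitive `χ` is free up to a constant. This choice makes `χ(u)` equal to `u - 1 / L ^ d`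
  -- minus `ε (log (u + ε) - log ε)`, an error between zero and `ε (log (M + ε) - log ε)`.
  let k : ℝ := 1 / L ^ d - ε * Real.log ε
  have h1 := integral_comp_mul_fpRhs (κ := κ) hL hV hu hp (φ₁ := fun y => Real.log (y + ε) + 1)
    (φ₂ := fun y => (y + ε)⁻¹) (χ := fun y => y - ε * Real.log (y + ε) - k)
    (fun x => by
      have := (((hasDerivAt_id (u x)).add_const ε).log (hpe x).ne').add_const 1
      simpa using this)
    (fun x => by
      have h2 := ((hasDerivAt_id (u x)).add_const ε).log (hpe x).ne'
      have h3 := ((hasDerivAt_id (u x)).sub (h2.const_mul ε)).sub_const k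
      refine h3.congr_deriv ?_
      have := (hpe x).ne'
      simp only [id]
      field_simp
      ring)
    ((huc.add continuous_const).inv₀ fun x => (hpe x).ne')
  have hLSI := torus_logSobolev hL d (F := fun x => u x + ε) (F' := fun i => pd i u)
    (huc.add continuous_const) (fun x i => by simp only [hp x i]) hpe hpc
    (fun i x => HasDerivAt.add_const ε (hasLineDerivAt_pd hd i x))
  have hmass' : ∫ x, (u x + ε) ∂cellMeasure d L = 1 + ε * L ^ d := by
    rw [integral_add huc.integrable_cell (integrable_const _), hmass, integral_const,
      cellMeasure_real_univ hL, smul_eq_mul, mul_comm]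
  rw [hmass'] at hLSI
  have e1 : ∀ i x, (u x + ε)⁻¹ * pd i u x ^ 2 = pd i u x ^ 2 / (u x + ε) := fun i x => by
    rw [div_eq_inv_mul]
  simp only [e1] at h1
  have hlog0 : ∀ x, 0 ≤ ε * Real.log (u x + ε) - ε * Real.log ε ∧
      ε * Real.log (u x + ε) - ε * Real.log ε ≤ ε * Real.log (M + ε) - ε * Real.log ε := fun x => by
    constructor
    · have := Real.log_le_log hε (by linarith [hpos x] : ε ≤ u x + ε)
      nlinarith
    · have := Real.log_le_log (hpe x) (by linarith [hM x] : u x + ε ≤ M + ε)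
      nlinarith
  set δ := ε * Real.log (M + ε) - ε * Real.log ε with hδ
  have h4 : ∫ x, (u x - ε * Real.log (u x + ε) - k) * ∑ i, W i x ∂cellMeasure d L
      ≤ ∫ x, (B * |u x - 1 / L ^ d| + B * δ) ∂cellMeasure d L := by
    have hWc : Continuous fun x => ∑ i, W i x := continuous_finsetSum _ fun i _ => hV.continuous_deriv i
    have hl : Continuous fun x => Real.log (u x + ε) :=
      (huc.add continuous_const).log fun x => (hpe x).ne'
    refine integral_mono (((huc.sub (continuous_const.mul hl)).sub continuous_const).mul
      hWc).integrable_cell (by fun_prop : Continuous _).integrable_cell fun x => ?_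
    have hχ : |u x - ε * Real.log (u x + ε) - k| ≤ |u x - 1 / L ^ d| + δ := by
      have e : u x - ε * Real.log (u x + ε) - k
          = (u x - 1 / L ^ d) - (ε * Real.log (u x + ε) - ε * Real.log ε) := by
        simp only [k]; ring
      rw [e]
      refine (abs_sub _ _).trans ?_
      rw [abs_of_nonneg (hlog0 x).1]
      linarith [(hlog0 x).2]
    calc _ ≤ |(u x - ε * Real.log (u x + ε) - k) * ∑ i, W i x| := le_abs_self _
      _ = |u x - ε * Real.log (u x + ε) - k| * |∑ i, W i x| := abs_mul _ _
      _ ≤ (|u x - 1 / L ^ d| + δ) * B :=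
        mul_le_mul hχ (hB x) (abs_nonneg _) ((abs_nonneg _).trans hχ)
      _ = _ := by ring
  have h5 : ∫ x, (B * |u x - 1 / L ^ d| + B * δ) ∂cellMeasure d L
      = B * (∫ x, |u x - 1 / L ^ d| ∂cellMeasure d L) + B * (L ^ d * δ) := by
    rw [integral_add (by fun_prop : Continuous _).integrable_cell (integrable_const _),
      integral_const_mul, integral_const, cellMeasure_real_univ hL, smul_eq_mul]
    ring
  rw [h5] at h4
  have h6 := mul_le_mul_of_nonneg_left h4 hκ.le
  rw [h1]
  linarith

end FokkerPlanck

/-! ### Time-integrated entropy inequality and removal of the regularisation. -/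

section EntropyEvolution
open Filter Topology

variable {d : ℕ} {L κ : ℝ} {V W : ℝ → Fin d → (Fin d → ℝ) → ℝ} {u : ℝ → (Fin d → ℝ) → ℝ}

lemma entropyDensity_eq (d : ℕ) {L : ℝ} (hL : 0 < L) (y : ℝ) :
    entropyDensity d L y = y * Real.log y - y * Real.log (1 / L ^ d) := by
  rcases eq_or_ne y 0 with rfl | hy
  · simp [entropyDensity]
  · have : (0 : ℝ) < 1 / L ^ d := by positivity
    rw [entropyDensity, Real.log_div hy this.ne']
    ring

lemma integral_entropyDensity (hL : 0 < L) {v : (Fin d → ℝ) → ℝ} (hv : Continuous v)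
    (hm : ∫ x, v x ∂cellMeasure d L = 1) :
    ∫ x, entropyDensity d L (v x) ∂cellMeasure d L
      = (∫ x, v x * Real.log (v x) ∂cellMeasure d L) - Real.log (1 / L ^ d) := by
  simp only [entropyDensity_eq d hL]
  have h1 : Continuous fun x => v x * Real.log (v x) := Real.continuous_mul_log.comp hv
  rw [integral_sub h1.integrable_cell (hv.integrable_cell.mul_const _), integral_mul_const, hm,
    one_mul]

/-- Exponentially weighted bound for the regularised entropy. -/
lemma regularised_entropy_le (hL : 0 < L) (hκ : 0 < κ) (hu : IsFPSolution L κ V W u)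
    (hpos : ∀ t, 0 ≤ t → ∀ x, 0 ≤ u t x) (hmass : ∀ t, 0 ≤ t → ∫ x, u t x ∂cellMeasure d L = 1)
    {B : ℝ → ℝ} (hBc : Continuous B) {C : ℝ} (hBC : ∀ t, 0 < t → B t ≤ C)
    (hB : ∀ t, 0 < t → ∀ x, |∑ i, W t i x| ≤ B t)
    {T : ℝ} (hT : 0 ≤ T) {M : ℝ} (hM : ∀ t ∈ Icc 0 T, ∀ x, u t x ≤ M) {ε δ c lam : ℝ} (hε : 0 < ε)
    (hlam : lam = 4 * Real.pi ^ 2 / L ^ 2)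
    (hδ : δ = L ^ d * (ε * Real.log (M + ε) - ε * Real.log ε))
    (hc : c = (1 + ε * L ^ d) * Real.log ((1 + ε * L ^ d) / L ^ d)) :
    Real.exp (lam * T) * ((∫ x, (u T x + ε) * Real.log (u T x + ε) ∂cellMeasure d L) - c)
      ≤ ((∫ x, (u 0 x + ε) * Real.log (u 0 x + ε) ∂cellMeasure d L) - c)
        + ∫ s in (0 : ℝ)..T, Real.exp (lam * s)
          * (κ * (B s * (∫ x, |u (max s 0) x - 1 / L ^ d| ∂cellMeasure d L) + C * δ)) := by
  let φ : ℝ → ℝ := fun y => (y + ε) * Real.log (y + ε)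
  have hφc : Continuous φ := Real.continuous_mul_log.comp (by fun_prop : Continuous fun y : ℝ => y + ε)
  let p : ℝ → ℝ := fun s => ∫ x, |u (max s 0) x - 1 / L ^ d| ∂cellMeasure d L
  have hpc : Continuous p := continuous_integral_max_time hu.continuousOn (φ := fun y => |y - 1 / L ^ d|)
    (by fun_prop)
  let Hf : ℝ → ℝ := fun t => ∫ x, φ (u (max t 0) x) ∂cellMeasure d L
  have hHc : Continuous Hf := continuous_integral_max_time hu.continuousOn hφc
  let R : ℝ → ℝ := fun s => Real.exp (lam * s) * (κ * (B s * p s + C * δ))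
  have hRc : Continuous R := by fun_prop
  -- The differential inequality says that `Y` is nonincreasing. Continuity covers the endpoint 0,
  -- where the equation is not assumed, and no integrability of the dissipation is needed.
  let Y : ℝ → ℝ := fun t => Real.exp (lam * t) * (Hf t - c) - ∫ s in (0 : ℝ)..t, R s
  have hprim : ∀ t, HasDerivAt (fun t => ∫ s in (0 : ℝ)..t, R s) (R t) t := fun t =>
    intervalIntegral.integral_hasDerivAt_right (hRc.intervalIntegrable _ _)
      (hRc.stronglyMeasurableAtFilter _ _) hRc.continuousAt
  have hder : ∀ t, 0 < t → HasDerivAt Y (Real.exp (lam * t) * (lam * (Hf t - c)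
      + ∫ x, (Real.log (u t x + ε) + 1) * fpRhs κ (u t) (V t) x ∂cellMeasure d L) - R t) t := by
    intro t ht
    have h1 := hu.hasDerivAt_integral hpos (φ := φ) (φ₁ := fun y => Real.log (y + ε) + 1)
      (fun y hy => by
        have hy' : y + ε ≠ 0 := by positivity
        have h2 := ((hasDerivAt_id y).add_const ε).mul (((hasDerivAt_id y).add_const ε).log hy')
        refine h2.congr_deriv ?_
        simp only [id]
        field_simp)
      (by
        refine ContinuousOn.add (ContinuousOn.log (by fun_prop) fun y hy => ?_) continuousOn_const
        have : 0 ≤ y := hy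
        positivity) ht
    have h3 : HasDerivAt Hf _ t := h1.congr_of_eventuallyEq (by
      filter_upwards [lt_mem_nhds ht] with s hs
      simp only [Hf, max_eq_left hs.le])
    have h4 : HasDerivAt (fun s : ℝ => Real.exp (lam * s)) (Real.exp (lam * t) * lam) t := by
      simpa using ((hasDerivAt_id t).const_mul lam).exp
    refine ((h4.mul (h3.sub_const c)).sub (hprim t)).congr_deriv ?_
    ring
  have hYc : Continuous Y := by
    have : Continuous fun t => ∫ s in (0 : ℝ)..t, R s :=
      continuous_iff_continuousAt.2 fun t => (hprim t).continuousAt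
    fun_prop
  have hanti : AntitoneOn Y (Icc 0 T) := by
    refine antitoneOn_of_deriv_nonpos (convex_Icc 0 T) hYc.continuousOn
      (fun t ht => ?_) fun t ht => ?_
    · rw [interior_Icc] at ht
      exact (hder t ht.1).differentiableAt.differentiableWithinAt
    · rw [interior_Icc] at ht
      rw [(hder t ht.1).deriv]
      have hd := entropy_dissipation hL hκ (hu.field t ht.1) (hu.contDiff t ht.1)
        (hu.periodic t ht.1.le) (hpos t ht.1.le) (hmass t ht.1.le) (hM t ⟨ht.1.le, ht.2.le⟩)
        (hB t ht.1) hε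
      rw [← hδ, ← hc, ← hlam] at hd
      have hM0 : ε ≤ M + ε := by
        linarith [hpos t ht.1.le 0, hM t ⟨ht.1.le, ht.2.le⟩ 0]
      have hδ0 : 0 ≤ δ := by
        rw [hδ]
        have h1 := Real.log_le_log hε hM0
        have : 0 ≤ ε * (Real.log (M + ε) - Real.log ε) := mul_nonneg hε.le (by linarith)
        have hLd : 0 < L ^ d := pow_pos hL d
        rw [← mul_sub]
        positivity
      have h5 : κ * (B t * δ) ≤ κ * (C * δ) := by
        have := hBC t ht.1
        gcongr
      have hHt : Hf t = ∫ x, (u t x + ε) * Real.log (u t x + ε) ∂cellMeasure d L := by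
        simp only [Hf, φ, max_eq_left ht.1.le]
      have hpt : p t = ∫ x, |u t x - 1 / L ^ d| ∂cellMeasure d L := by
        simp only [p, max_eq_left ht.1.le]
      rw [← hHt, ← hpt] at hd
      simp only [R]
      rw [← mul_sub]
      refine mul_nonpos_of_nonneg_of_nonpos (Real.exp_pos _).le ?_
      linarith
  have hfin := hanti (left_mem_Icc.2 hT) (right_mem_Icc.2 hT) hT
  simp only [Y, mul_zero, Real.exp_zero, one_mul, intervalIntegral.integral_same, sub_zero] at hfin
  have e0 : Hf 0 = ∫ x, (u 0 x + ε) * Real.log (u 0 x + ε) ∂cellMeasure d L := by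
    simp only [Hf, φ, max_self]
  have eT : Hf T = ∫ x, (u T x + ε) * Real.log (u T x + ε) ∂cellMeasure d L := by
    simp only [Hf, φ, max_eq_left hT]
  rw [e0, eT] at hfin
  simp only [R, p] at hfin
  linarith

/-- Entropy inequality for a single Fokker--Planck solution. -/
theorem entropy_le (hL : 0 < L) (hκ : 0 < κ) (hu : IsFPSolution L κ V W u)
    (hpos : ∀ t, 0 ≤ t → ∀ x, 0 ≤ u t x) (hmass : ∀ t, 0 ≤ t → ∫ x, u t x ∂cellMeasure d L = 1)
    {B : ℝ → ℝ} (hBc : Continuous B) {C : ℝ} (hBC : ∀ t, 0 < t → B t ≤ C)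
    (hB : ∀ t, 0 < t → ∀ x, |∑ i, W t i x| ≤ B t) {T : ℝ} (hT : 0 ≤ T) :
    Real.exp (4 * Real.pi ^ 2 / L ^ 2 * T) * ∫ x, entropyDensity d L (u T x) ∂cellMeasure d L
      ≤ (∫ x, entropyDensity d L (u 0 x) ∂cellMeasure d L)
        + ∫ s in (0 : ℝ)..T, Real.exp (4 * Real.pi ^ 2 / L ^ 2 * s)
          * (κ * (B s * (∫ x, |u (max s 0) x - 1 / L ^ d| ∂cellMeasure d L))) := by
  obtain ⟨M, hM1, hM⟩ : ∃ M, 0 < M ∧ ∀ t ∈ Icc 0 T, ∀ x, u t x ≤ M := by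
    obtain ⟨M, hM⟩ := (isCompact_Icc.prod (isCompact_cell d L)).exists_bound_of_continuousOn
      (hu.continuousOn.mono (prod_mono (fun s hs => hs.1 : Icc 0 T ⊆ Ici (0 : ℝ)) (subset_univ _)))
    refine ⟨|M| + 1, by positivity, fun t ht x => ?_⟩
    refine (hu.periodic t ht.1).forall_of_cell hL (P := fun y => y ≤ |M| + 1) (fun y hy => ?_) x
    have := hM (t, y) ⟨ht, hy⟩
    rw [Real.norm_eq_abs] at this
    linarith [le_abs_self (u t y), le_abs_self M]
  set lam := 4 * Real.pi ^ 2 / L ^ 2 with hlam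
  have hLd : 0 < L ^ d := pow_pos hL d
  let f : ℝ → ℝ := fun y => y * Real.log y
  have hf : Continuous f := Real.continuous_mul_log
  let δ : ℝ → ℝ := fun ε => L ^ d * (ε * Real.log (M + ε) - f ε)
  let c : ℝ → ℝ := fun ε => L ^ d * f ((1 + ε * L ^ d) / L ^ d)
  have hcc : Continuous c := by fun_prop
  have hδc : ContinuousAt δ 0 := by
    have h1 : ContinuousAt (fun ε : ℝ => Real.log (M + ε)) 0 :=
      ContinuousAt.log (by fun_prop) (by simpa using hM1.ne')
    have h2 : ContinuousAt f 0 := hf.continuousAt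
    exact continuousAt_const.mul ((continuousAt_id.mul h1).sub h2)
  let Hf : ℝ → ℝ → ℝ := fun t ε => ∫ x, f (u t x + ε) ∂cellMeasure d L
  have hHc : ∀ t, 0 ≤ t → Continuous (Hf t) := fun t ht => by
    have h1 := continuous_slice hu.continuousOn ht
    refine continuous_parametric_integral_of_continuous (f := fun ε x => f (u t x + ε)) ?_
      (isCompact_cell d L)
    exact hf.comp (by fun_prop : Continuous fun q : ℝ × (Fin d → ℝ) => u t q.2 + q.1)
  let p : ℝ → ℝ := fun s => ∫ x, |u (max s 0) x - 1 / L ^ d| ∂cellMeasure d L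
  have hpc : Continuous p := continuous_integral_max_time hu.continuousOn (φ := fun y => |y - 1 / L ^ d|)
    (by fun_prop)
  let I₀ : ℝ := ∫ s in (0 : ℝ)..T, Real.exp (lam * s) * (κ * (B s * p s))
  let I₁ : ℝ := ∫ s in (0 : ℝ)..T, Real.exp (lam * s) * (κ * C)
  have key : ∀ ε, 0 < ε → Real.exp (lam * T) * (Hf T ε - c ε)
      ≤ (Hf 0 ε - c ε) + (I₀ + δ ε * I₁) := by
    intro ε hε
    have h1 := regularised_entropy_le hL hκ hu hpos hmass hBc hBC hB hT hM (c := c ε) hε hlam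
      (rfl : δ ε = _) (by
        simp only [c, f]
        field_simp)
    refine h1.trans_eq ?_
    congr 1
    simp only [I₀, I₁]
    rw [← intervalIntegral.integral_const_mul, ← intervalIntegral.integral_add
      ((by fun_prop : Continuous _).intervalIntegrable _ _)
      ((by fun_prop : Continuous _).intervalIntegrable _ _)]
    congr 1
    ext s
    ring
  have hc0 : c 0 = Real.log (1 / L ^ d) := by
    simp only [c, f, zero_mul, add_zero]
    field_simp
  have hδ0 : δ 0 = 0 := by simp [δ, f]
  -- The limit `ε → 0⁺`: everything is continuous at 0 because `y log y` is, and `log (M + ε)` is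
  -- because `M > 0`.
  have hlim : Real.exp (lam * T) * (Hf T 0 - c 0) ≤ (Hf 0 0 - c 0) + (I₀ + δ 0 * I₁) := by
    have l1 : ContinuousAt (fun ε => Real.exp (lam * T) * (Hf T ε - c ε)) 0 :=
      continuousAt_const.mul (((hHc T hT).continuousAt).sub hcc.continuousAt)
    have l2 : ContinuousAt (fun ε => (Hf 0 ε - c ε) + (I₀ + δ ε * I₁)) 0 :=
      (((hHc 0 le_rfl).continuousAt).sub hcc.continuousAt).add
        (continuousAt_const.add (hδc.mul continuousAt_const))
    refine le_of_tendsto_of_tendsto (b := 𝓝[>] 0) (l1.tendsto.mono_left nhdsWithin_le_nhds)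
      (l2.tendsto.mono_left nhdsWithin_le_nhds) ?_
    filter_upwards [self_mem_nhdsWithin] with ε hε using key ε hε
  rw [hc0, hδ0] at hlim
  simp only [zero_mul, add_zero, Hf, f] at hlim
  rw [integral_entropyDensity hL (continuous_slice hu.continuousOn hT) (hmass T hT),
    integral_entropyDensity hL (continuous_slice hu.continuousOn le_rfl) (hmass 0 le_rfl)]
  exact hlim

end EntropyEvolution

/-! ### Fibres of the coupled equation. -/

section GraphopSolution
open Filter Topology

variable {d : ℕ} {L κ : ℝ} {D : (Fin d → ℝ) → ℝ} {G : Fin d → (Fin d → ℝ) → ℝ}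
  {H : Fin d → Fin d → (Fin d → ℝ) → ℝ} {ρ₀ : (Fin d → ℝ) → S2 → ℝ}
  {ρ : ℝ → (Fin d → ℝ) → S2 → ℝ} {ξ : S2}

/-- `∂ᵢ Vᵢ` for the Vlasov field `V`. -/
def vlasovDeriv (L : ℝ) (H : Fin d → Fin d → (Fin d → ℝ) → ℝ) (v : (Fin d → ℝ) → S2 → ℝ)
    (ξ : S2) (i : Fin d) (x : Fin d → ℝ) : ℝ :=
  ∫ y, H i i (x - y) * sphericalAverage (v y) ξ ∂cellMeasure d L

lemma SolvesAt.integrable_average (h : SolvesAt L κ G ρ₀ ρ ξ) {t : ℝ} (ht : 0 ≤ t) :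
    Integrable (fun y => sphericalAverage (ρ t y) ξ) (cellMeasure d L) := by
  obtain ⟨C, hC⟩ := h.interaction t
  exact (hC t ⟨ht, le_rfl⟩).1.integral_prod_left

/-- With `ξ` frozen, the other fibres enter only through the drift, which is then treated as given.
-/
lemma SolvesAt.isFPSolution (hL : 0 < L) (hD : IsW2InfPotential L D G H)
    (h : SolvesAt L κ G ρ₀ ρ ξ) :
    IsFPSolution L κ (fun t i x => vlasov L G (ρ t) i x ξ) (fun t => vlasovDeriv L H (ρ t) ξ)
      (fun t x => ρ t x ξ) where
  periodic := h.periodic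
  continuousOn := h.continuous
  continuous_dt := h.continuous_dt
  contDiff := h.contDiff
  field _ ht :=
    { periodic := fun i => isPeriodic_cell_convolution (hD.periodic_grad i)
      continuous := fun i => (continuous_vlasov_aux hL hD (h.integrable_average ht.le) i).1
      continuous_deriv := fun i => (continuous_vlasov_aux hL hD (h.integrable_average ht.le) i).2
      hasLineDerivAt := fun i x =>
        hasLineDerivAt_cell_convolution hL hD (h.integrable_average ht.le) i x }
  equation := h.equation

/-- The rough bound required by the minimum principle, with `c = 0` in `abs_div_vlasov_le`. It rests
on the interaction condition alone, as positivity is not yet known. -/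
lemma SolvesAt.exists_div_bound (hL : 0 < L) (hD : IsW2InfPotential L D G H)
    (h : SolvesAt L κ G ρ₀ ρ ξ) (T : ℝ) :
    ∃ K, ∀ t ∈ Icc 0 T, ∀ x, |∑ i, vlasovDeriv L H (ρ t) ξ i x| ≤ K := by
  obtain ⟨C, hC⟩ := h.interaction T
  refine ⟨lapNorm L H * C, fun t ht x => ?_⟩
  have h1 := abs_div_vlasov_le hL hD (h.integrable_average ht.1) 0 x
  refine h1.trans (mul_le_mul_of_nonneg_left ?_ ENNReal.toReal_nonneg)
  simp only [sub_zero]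
  refine le_trans ?_ (hC t ht).2
  rw [integral_prod _ (hC t ht).1.abs]
  refine integral_mono (h.integrable_average ht.1).abs (hC t ht).1.abs.integral_prod_left fun y => ?_
  exact abs_integral_le_integral_abs

lemma SolvesAt.nonneg_zero (hL : 0 < L) (h : SolvesAt L κ G ρ₀ ρ ξ)
    (h0 : IsProbDensity L fun x => ρ₀ x ξ) (x : Fin d → ℝ) : 0 ≤ ρ 0 x ξ := by
  have h1 : ∀ᵐ x ∂cellMeasure d L, 0 ≤ ρ 0 x ξ := by
    filter_upwards [h0.1, h.initial] with x hx1 hx2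
    rwa [hx2]
  have h2 := ae_volume_of_ae_cell hL (h.periodic 0 le_rfl) (P := fun y => 0 ≤ y) h1
  have hc : Continuous fun x => ρ 0 x ξ :=
    continuous_slice (u := fun t x => ρ t x ξ) h.continuous le_rfl
  have hopen : IsOpen {x | ρ 0 x ξ < 0} := isOpen_lt hc continuous_const
  by_contra! hx
  refine hopen.measure_ne_zero volume ⟨x, hx⟩ ?_
  simpa [ae_iff] using h2

lemma SolvesAt.nonneg (hL : 0 < L) (hκ : 0 < κ) (hD : IsW2InfPotential L D G H)
    (h : SolvesAt L κ G ρ₀ ρ ξ) (h0 : IsProbDensity L fun x => ρ₀ x ξ) (t : ℝ) (ht : 0 ≤ t)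
    (x : Fin d → ℝ) : 0 ≤ ρ t x ξ := by
  obtain ⟨K, hK⟩ := h.exists_div_bound hL hD t
  have hF := h.isFPSolution hL hD
  exact nonneg_of_solution hL (K := K) (T := t) hκ (u := fun t x => ρ t x ξ)
    (fun s hs => h.periodic s hs.1) h.continuous (h.nonneg_zero hL h0)
    (fun s hs => h.contDiff s hs.1) (fun s hs => (hF.field s hs.1).hasLineDerivAt)
    (fun s hs => hK s ⟨hs.1.le, hs.2⟩) (fun s hs => h.equation s hs.1) ⟨ht, le_rfl⟩ x

lemma SolvesAt.mass (hL : 0 < L) (hκ : 0 < κ) (hD : IsW2InfPotential L D G H)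
    (h : SolvesAt L κ G ρ₀ ρ ξ) (h0 : IsProbDensity L fun x => ρ₀ x ξ) (t : ℝ) (ht : 0 ≤ t) :
    ∫ x, ρ t x ξ ∂cellMeasure d L = 1 := by
  rw [(h.isFPSolution hL hD).integral_eq hL (h.nonneg hL hκ hD h0) ht, ← h0.2.2]
  exact integral_congr_ae h.initial

/-- `L¹` distance to the uniform density. -/
def deviation (L : ℝ) (ρ : ℝ → (Fin d → ℝ) → S2 → ℝ) (t : ℝ) (ξ : S2) : ℝ :=
  ∫ x, |ρ (max t 0) x ξ - 1 / L ^ d| ∂cellMeasure d L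

/-- The spherical average of the `L¹` distance to the uniform density. -/
def avgDeviation (L : ℝ) (ρ : ℝ → (Fin d → ℝ) → S2 → ℝ) (t : ℝ) (ξ : S2) : ℝ :=
  ∫ v, deviation L ρ t (equatorParam (ξ, v)) ∂circleMeasure

lemma measurable_deviation (hρ : Measurable fun p : ℝ × (Fin d → ℝ) × S2 => ρ p.1 p.2.1 p.2.2) :
    Measurable fun p : ℝ × S2 => deviation L ρ p.1 p.2 := by
  have h1 : Measurable fun q : (ℝ × S2) × (Fin d → ℝ) => |ρ (max q.1.1 0) q.2 q.1.2 - 1 / L ^ d| := by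
    have h2 : Measurable fun q : (ℝ × S2) × (Fin d → ℝ) => ρ (max q.1.1 0) q.2 q.1.2 :=
      hρ.comp (((measurable_fst.comp measurable_fst).max measurable_const).prodMk
        (measurable_snd.prodMk (measurable_snd.comp measurable_fst)))
    exact continuous_abs.measurable.comp (h2.sub_const _)
  exact h1.stronglyMeasurable.integral_prod_right.measurable

lemma measurable_deviation_right
    (hρ : Measurable fun p : ℝ × (Fin d → ℝ) × S2 => ρ p.1 p.2.1 p.2.2) (t : ℝ) :
    Measurable (deviation L ρ t) :=
  (measurable_deviation hρ).comp measurable_prodMk_left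

lemma measurable_avgDeviation (hρ : Measurable fun p : ℝ × (Fin d → ℝ) × S2 => ρ p.1 p.2.1 p.2.2) :
    Measurable fun p : ℝ × S2 => avgDeviation L ρ p.1 p.2 := by
  have h1 : Measurable fun q : (ℝ × S2) × Metric.sphere (0 : E2) 1 =>
      deviation L ρ q.1.1 (equatorParam (q.1.2, q.2)) :=
    (measurable_deviation hρ).comp ((measurable_fst.comp measurable_fst).prodMk
      (measurable_equatorParam.comp ((measurable_snd.comp measurable_fst).prodMk measurable_snd)))
  exact h1.stronglyMeasurable.integral_prod_right.measurable

lemma deviation_nonneg (t : ℝ) (ξ : S2) : 0 ≤ deviation L ρ t ξ :=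
  integral_nonneg fun _ => abs_nonneg _

lemma avgDeviation_eq (hρ : Measurable fun p : ℝ × (Fin d → ℝ) × S2 => ρ p.1 p.2.1 p.2.2) (t : ℝ)
    (ξ : S2) : sphericalAverage (deviation L ρ t) ξ = avgDeviation L ρ t ξ :=
  sphericalAverage_eq (measurable_deviation_right hρ t).aestronglyMeasurable

lemma SolvesAt.continuous_deviation (h : SolvesAt L κ G ρ₀ ρ ξ) :
    Continuous fun t => deviation L ρ t ξ :=
  continuous_integral_max_time (u := fun t x => ρ t x ξ) h.continuous (φ := fun y => |y - 1 / L ^ d|)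
    (by fun_prop)

lemma SolvesAt.deviation_le (hL : 0 < L) (hκ : 0 < κ) (hD : IsW2InfPotential L D G H)
    (h : SolvesAt L κ G ρ₀ ρ ξ) (h0 : IsProbDensity L fun x => ρ₀ x ξ) (t : ℝ) :
    deviation L ρ t ξ ≤ 2 := by
  have ht : 0 ≤ max t 0 := le_max_right _ _
  have hc : Continuous fun x => ρ (max t 0) x ξ :=
    continuous_slice (u := fun t x => ρ t x ξ) h.continuous ht
  have hLd : 0 < L ^ d := pow_pos hL d
  have h1 : ∀ x, |ρ (max t 0) x ξ - 1 / L ^ d| ≤ ρ (max t 0) x ξ + 1 / L ^ d := fun x => by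
    refine (abs_sub _ _).trans_eq ?_
    rw [abs_of_nonneg (h.nonneg hL hκ hD h0 _ ht x), abs_of_pos (by positivity)]
  refine (integral_mono (by fun_prop : Continuous _).integrable_cell
    (by fun_prop : Continuous _).integrable_cell h1).trans_eq ?_
  rw [integral_add hc.integrable_cell (integrable_const _), h.mass hL hκ hD h0 _ ht, integral_const,
    cellMeasure_real_univ hL, smul_eq_mul]
  field_simp
  norm_num

/-- A solution at `ξ` that starts from a probability density. -/
def IsGood (L κ : ℝ) (G : Fin d → (Fin d → ℝ) → ℝ) (ρ₀ : (Fin d → ℝ) → S2 → ℝ)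
    (ρ : ℝ → (Fin d → ℝ) → S2 → ℝ) (ξ : S2) : Prop :=
  SolvesAt L κ G ρ₀ ρ ξ ∧ IsProbDensity L fun x => ρ₀ x ξ

lemma ae_circle_of_ae_equator {P : S2 → Prop} (h : ∀ᵐ η ∂equatorMeasure ξ, P η) :
    ∀ᵐ v ∂circleMeasure, P (equatorParam (ξ, v)) := by
  rw [equatorMeasure_eq] at h
  exact ae_of_ae_map (measurable_equatorParam_right ξ).aemeasurable h

/-- Two probability densities are at `L¹` distance at most 2, and this constant dominates the
average over the equator, giving continuity in time. -/
lemma avgDeviation_bounds (hL : 0 < L) (hκ : 0 < κ) (hD : IsW2InfPotential L D G H)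
    (hρ : Measurable fun p : ℝ × (Fin d → ℝ) × S2 => ρ p.1 p.2.1 p.2.2)
    (hξ : ∀ᵐ η ∂equatorMeasure ξ, IsGood L κ G ρ₀ ρ η) :
    (Continuous fun t => avgDeviation L ρ t ξ) ∧
      ∀ t, 0 ≤ avgDeviation L ρ t ξ ∧ avgDeviation L ρ t ξ ≤ 2 := by
  have hv := ae_circle_of_ae_equator hξ
  have hm : ∀ t, AEStronglyMeasurable (fun v => deviation L ρ t (equatorParam (ξ, v)))
      circleMeasure := fun t =>
    ((measurable_deviation_right hρ t).comp (measurable_equatorParam_right ξ)).aestronglyMeasurable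
  have hb : ∀ t, ∀ᵐ v ∂circleMeasure, ‖deviation L ρ t (equatorParam (ξ, v))‖ ≤ 2 := fun t => by
    filter_upwards [hv] with v hv
    rw [Real.norm_of_nonneg (deviation_nonneg _ _)]
    exact hv.1.deviation_le hL hκ hD hv.2 t
  refine ⟨continuous_of_dominated hm hb (integrable_const 2) ?_, fun t =>
    ⟨integral_nonneg fun v => deviation_nonneg _ _, ?_⟩⟩
  · filter_upwards [hv] with v hv using hv.1.continuous_deviation
  · have := norm_integral_le_of_norm_le (integrable_const 2) (hb t)
    simp only [integral_const, probReal_univ, one_smul] at this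
    exact (le_abs_self _).trans this

/-- `abs_div_vlasov_le` with `c` the uniform density. The absolute value then passes inside the
equatorial average, and Fubini exchanges that average with the integral over the cell. -/
lemma SolvesAt.abs_div_le (hL : 0 < L) (hD : IsW2InfPotential L D G H)
    (hρ : Measurable fun p : ℝ × (Fin d → ℝ) × S2 => ρ p.1 p.2.1 p.2.2)
    (h : SolvesAt L κ G ρ₀ ρ ξ) {t : ℝ} (ht : 0 ≤ t) (x : Fin d → ℝ) :
    |∑ i, vlasovDeriv L H (ρ t) ξ i x| ≤ lapNorm L H * avgDeviation L ρ t ξ := by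
  refine (abs_div_vlasov_le hL hD (h.integrable_average ht) (1 / L ^ d) x).trans
    (mul_le_mul_of_nonneg_left ?_ ENNReal.toReal_nonneg)
  obtain ⟨C, hC⟩ := h.interaction t
  have hint := (hC t ⟨ht, le_rfl⟩).1
  have hdev : Integrable (fun p : (Fin d → ℝ) × S2 => |ρ t p.1 p.2 - 1 / L ^ d|)
      ((cellMeasure d L).prod (equatorMeasure ξ)) := (hint.sub (integrable_const _)).abs
  have h1 : ∫ y, |sphericalAverage (ρ t y) ξ - 1 / L ^ d| ∂cellMeasure d L
      ≤ ∫ y, (∫ η, |ρ t y η - 1 / L ^ d| ∂equatorMeasure ξ) ∂cellMeasure d L := by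
    refine integral_mono_ae ((h.integrable_average ht).sub (integrable_const _)).abs
      hdev.integral_prod_left ?_
    filter_upwards [hint.prod_right_ae] with y hy
    have e : sphericalAverage (ρ t y) ξ - 1 / L ^ d
        = ∫ η, (ρ t y η - 1 / L ^ d) ∂equatorMeasure ξ := by
      rw [integral_sub hy (integrable_const _), integral_const, probReal_univ, one_smul]
      rfl
    simp only [e]
    exact abs_integral_le_integral_abs
  refine h1.trans_eq ?_
  rw [integral_integral_swap hdev, ← avgDeviation_eq hρ]
  refine integral_congr_ae (ae_of_all _ fun η => ?_)
  simp only [deviation, max_eq_left ht]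

/-- Entropy inequality along a good fibre. -/
theorem fibre_entropy_le (hL : 0 < L) (hκ : 0 < κ) (hD : IsW2InfPotential L D G H)
    (hρ : Measurable fun p : ℝ × (Fin d → ℝ) × S2 => ρ p.1 p.2.1 p.2.2)
    (h : IsGood L κ G ρ₀ ρ ξ) (hξ : ∀ᵐ η ∂equatorMeasure ξ, IsGood L κ G ρ₀ ρ η) {T : ℝ}
    (hT : 0 ≤ T) :
    Real.exp (4 * Real.pi ^ 2 / L ^ 2 * T) * ∫ x, entropyDensity d L (ρ T x ξ) ∂cellMeasure d L
      ≤ (∫ x, entropyDensity d L (ρ₀ x ξ) ∂cellMeasure d L)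
        + ∫ s in (0 : ℝ)..T, Real.exp (4 * Real.pi ^ 2 / L ^ 2 * s)
          * (κ * (lapNorm L H * avgDeviation L ρ s ξ * deviation L ρ s ξ)) := by
  obtain ⟨hc, hb⟩ := avgDeviation_bounds hL hκ hD hρ hξ
  have hN : 0 ≤ lapNorm L H := ENNReal.toReal_nonneg
  have h1 := entropy_le hL hκ (h.1.isFPSolution hL hD) (h.1.nonneg hL hκ hD h.2)
    (h.1.mass hL hκ hD h.2) (B := fun t => lapNorm L H * avgDeviation L ρ t ξ) (by fun_prop)
    (C := lapNorm L H * 2) (fun t _ => mul_le_mul_of_nonneg_left (hb t).2 hN)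
    (fun t ht x => h.1.abs_div_le hL hD hρ ht.le x) hT
  have h2 : ∫ x, entropyDensity d L (ρ 0 x ξ) ∂cellMeasure d L
      = ∫ x, entropyDensity d L (ρ₀ x ξ) ∂cellMeasure d L := by
    refine integral_congr_ae ?_
    filter_upwards [h.1.initial] with x hx
    rw [hx]
  rw [h2] at h1
  exact h1

end GraphopSolution

/-! ### Averaging over the sphere and Grönwall's inequality. -/

section Decay
open Filter Topology

variable {d : ℕ} {L κ : ℝ} {D : (Fin d → ℝ) → ℝ} {G : Fin d → (Fin d → ℝ) → ℝ}
  {H : Fin d → Fin d → (Fin d → ℝ) → ℝ} {ρ₀ : (Fin d → ℝ) → S2 → ℝ}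
  {ρ : ℝ → (Fin d → ℝ) → S2 → ℝ} {ξ : S2}

/-- Grönwall's inequality in integral form for a continuous function. -/
lemma gronwall_integral {y : ℝ → ℝ} (hy : Continuous y) {a c T : ℝ} (hT : 0 ≤ T)
    (h : ∀ t ∈ Icc 0 T, y t * c ≤ (a + ∫ s in (0 : ℝ)..t, y s * c) * c) :
    a + ∫ s in (0 : ℝ)..T, y s * c ≤ a * Real.exp (c * T) := by
  let Z : ℝ → ℝ := fun t => a + ∫ s in (0 : ℝ)..t, y s * c
  have hc : Continuous fun s => y s * c := by fun_prop
  have hZ : ∀ t, HasDerivAt Z (y t * c) t := fun t =>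
    (intervalIntegral.integral_hasDerivAt_right (hc.intervalIntegrable _ _)
      (hc.stronglyMeasurableAtFilter _ _) hc.continuousAt).const_add a
  have hE : ∀ t, HasDerivAt (fun t => Real.exp (-c * t) * Z t)
      (Real.exp (-c * t) * (y t * c - c * Z t)) t := fun t => by
    have h1 : HasDerivAt (fun s : ℝ => Real.exp (-c * s)) (Real.exp (-c * t) * -c) t := by
      simpa using ((hasDerivAt_id t).const_mul (-c)).exp
    refine (h1.mul (hZ t)).congr_deriv ?_
    ring
  have hanti : AntitoneOn (fun t => Real.exp (-c * t) * Z t) (Icc 0 T) := by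
    refine antitoneOn_of_deriv_nonpos (convex_Icc 0 T)
      (fun t _ => (hE t).continuousAt.continuousWithinAt)
      (fun t _ => (hE t).differentiableAt.differentiableWithinAt) fun t ht => ?_
    rw [(hE t).deriv]
    refine mul_nonpos_of_nonneg_of_nonpos (Real.exp_pos _).le ?_
    have := h t (interior_subset ht)
    simp only [Z]
    linarith
  have h1 := hanti (left_mem_Icc.2 hT) (right_mem_Icc.2 hT) hT
  simp only [mul_zero, Real.exp_zero, one_mul] at h1
  have h2 : Z 0 = a := by simp [Z]
  rw [h2] at h1
  have h3 := mul_le_mul_of_nonneg_left h1 (Real.exp_pos (c * T)).le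
  rw [← mul_assoc, ← Real.exp_add, show c * T + -c * T = 0 by ring, Real.exp_zero, one_mul] at h3
  linarith

/-- From `z log z ≥ z - 1 ≥ -1` the density is at least `-1 / L ^ d`. Integrable fibre entropies
therefore give joint integrability. -/
lemma abs_entropyDensity_le (d : ℕ) (hL : 0 < L) {y : ℝ} (hy : 0 ≤ y) :
    |entropyDensity d L y| ≤ entropyDensity d L y + 2 / L ^ d := by
  have hLd : 0 < L ^ d := pow_pos hL d
  have h1 : -(1 / L ^ d) ≤ entropyDensity d L y := by
    have h2 := InformationTheory.klFun_nonneg (mul_nonneg hLd.le hy)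
    rw [InformationTheory.klFun_apply] at h2
    have h3 : entropyDensity d L y = (1 / L ^ d) * (L ^ d * y * Real.log (L ^ d * y)) := by
      rw [entropyDensity, div_div_eq_mul_div, div_one, mul_comm y (L ^ d)]
      field_simp
    rw [h3, ← mul_neg_one]
    refine mul_le_mul_of_nonneg_left ?_ (by positivity)
    nlinarith [mul_nonneg hLd.le hy]
  rw [abs_le]
  have h4 : (0 : ℝ) < 1 / L ^ d := by positivity
  have h5 : 2 / L ^ d = 2 * (1 / L ^ d) := by ring
  constructor <;> linarith

/-- Entropy on a fibre. -/
def fibreEntropy (L : ℝ) (v : (Fin d → ℝ) → S2 → ℝ) (ξ : S2) : ℝ :=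
  ∫ x, entropyDensity d L (v x ξ) ∂cellMeasure d L

/-- Mean square deviation from the uniform density. -/
def meanSqDeviation (L : ℝ) (ρ : ℝ → (Fin d → ℝ) → S2 → ℝ) (t : ℝ) : ℝ :=
  ∫ ξ, deviation L ρ t ξ ^ 2 ∂sphereMeasure

lemma sq_deviation_le (hL : 0 < L) (hκ : 0 < κ) (hD : IsW2InfPotential L D G H)
    (h : IsGood L κ G ρ₀ ρ ξ) {t : ℝ} (ht : 0 ≤ t) :
    deviation L ρ t ξ ^ 2 ≤ 2 * fibreEntropy L (ρ t) ξ := by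
  have h1 := sq_integral_abs_sub_le hL (continuous_slice (u := fun t x => ρ t x ξ) h.1.continuous ht)
    (h.1.nonneg hL hκ hD h.2 t ht) (h.1.mass hL hκ hD h.2 t ht)
  rw [deviation, max_eq_left ht]
  exact h1

lemma norm_deviation_sq_le (hL : 0 < L) (hκ : 0 < κ) (hD : IsW2InfPotential L D G H)
    (h : IsGood L κ G ρ₀ ρ ξ) (t : ℝ) : ‖deviation L ρ t ξ ^ 2‖ ≤ 4 := by
  have h1 := h.1.deviation_le hL hκ hD h.2 t
  have h2 := deviation_nonneg (L := L) (ρ := ρ) t ξ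
  rw [Real.norm_of_nonneg (sq_nonneg _)]
  nlinarith

lemma continuous_meanSqDeviation (hL : 0 < L) (hκ : 0 < κ) (hD : IsW2InfPotential L D G H)
    (hρ : Measurable fun p : ℝ × (Fin d → ℝ) × S2 => ρ p.1 p.2.1 p.2.2)
    (hg : ∀ᵐ ξ ∂sphereMeasure, IsGood L κ G ρ₀ ρ ξ) : Continuous (meanSqDeviation L ρ) := by
  refine continuous_of_dominated (bound := fun _ => 4)
    (fun t => ((measurable_deviation_right hρ t).pow_const 2).aestronglyMeasurable) (fun t => ?_)
    (integrable_const _) ?_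
  · filter_upwards [hg] with ξ h using norm_deviation_sq_le hL hκ hD h t
  · filter_upwards [hg] with ξ h using h.1.continuous_deviation.pow 2

/-- `2ab ≤ a² + b²` and the `L²` contraction of the averaging operator; this is where that
contraction enters the decay estimate. -/
lemma integral_avg_mul_deviation_le (hL : 0 < L) (hκ : 0 < κ) (hD : IsW2InfPotential L D G H)
    (hρ : Measurable fun p : ℝ × (Fin d → ℝ) × S2 => ρ p.1 p.2.1 p.2.2)
    (hg : ∀ᵐ ξ ∂sphereMeasure, IsGood L κ G ρ₀ ρ ξ) (t : ℝ) :
    ∫ ξ, avgDeviation L ρ t ξ * deviation L ρ t ξ ∂sphereMeasure ≤ meanSqDeviation L ρ t := by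
  have hm := measurable_deviation_right (L := L) hρ t
  have hp2 : MemLp (deviation L ρ t) 2 sphereMeasure := by
    refine (memLp_two_iff_integrable_sq hm.aestronglyMeasurable).2
      ((integrable_const (4 : ℝ)).mono' (hm.pow_const 2).aestronglyMeasurable ?_)
    filter_upwards [hg] with ξ h using norm_deviation_sq_le hL hκ hD h t
  have e : sphericalAverage (deviation L ρ t) = avgDeviation L ρ t := funext (avgDeviation_eq hρ t)
  obtain ⟨hq2, hle⟩ := memLp_sphericalAverage hp2
  rw [e] at hq2 hle
  have i1 := hp2.integrable_sq
  have i2 := hq2.integrable_sq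
  have h1 : ∫ ξ, avgDeviation L ρ t ξ * deviation L ρ t ξ ∂sphereMeasure
      ≤ ∫ ξ, (1 / 2 * avgDeviation L ρ t ξ ^ 2 + 1 / 2 * deviation L ρ t ξ ^ 2) ∂sphereMeasure := by
    refine integral_mono (hq2.integrable_mul hp2)
      ((i2.const_mul _).add (i1.const_mul _)) fun ξ => ?_
    have := sq_nonneg (avgDeviation L ρ t ξ - deviation L ρ t ξ)
    simp only
    nlinarith
  rw [integral_add (i2.const_mul _) (i1.const_mul _), integral_const_mul, integral_const_mul] at h1
  rw [meanSqDeviation]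
  linarith

lemma measurable_fibreEntropy (hL : 0 < L) {v : (Fin d → ℝ) → S2 → ℝ}
    (hv : Measurable fun p : (Fin d → ℝ) × S2 => v p.1 p.2) :
    Measurable (fibreEntropy L v) := by
  have h1 : Measurable fun p : S2 × (Fin d → ℝ) => entropyDensity d L (v p.2 p.1) :=
    (continuous_entropyDensity d hL).measurable.comp (hv.comp measurable_swap)
  exact h1.stronglyMeasurable.integral_prod_right.measurable

/-- Entropy bound after averaging over the sphere. -/
lemma averaged_entropy (hL : 0 < L) (hκ : 0 < κ) (hD : IsW2InfPotential L D G H)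
    (hρ : Measurable fun p : ℝ × (Fin d → ℝ) × S2 => ρ p.1 p.2.1 p.2.2)
    (hg : ∀ᵐ ξ ∂sphereMeasure, IsGood L κ G ρ₀ ρ ξ) (h0 : FiniteEntropy L ρ₀) {T : ℝ}
    (hT : 0 ≤ T) :
    FiniteEntropy L (ρ T) ∧
      Real.exp (4 * Real.pi ^ 2 / L ^ 2 * T) * relEntropy L (ρ T) ≤ relEntropy L ρ₀
        + ∫ s in (0 : ℝ)..T, κ * lapNorm L H
          * (Real.exp (4 * Real.pi ^ 2 / L ^ 2 * s) * meanSqDeviation L ρ s) := by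
  set lam := 4 * Real.pi ^ 2 / L ^ 2 with hlam
  have hlam0 : 0 ≤ lam := by positivity
  have hN : 0 ≤ lapNorm L H := ENNReal.toReal_nonneg
  have hslice : Measurable fun p : (Fin d → ℝ) × S2 => ρ T p.1 p.2 := hρ.comp measurable_prodMk_left
  have hgg := ae_equatorMeasure_of_ae hg
  have hE0 : Integrable (fibreEntropy L ρ₀) sphereMeasure := h0.integral_prod_right
  let F : S2 × ℝ → ℝ := fun z => Real.exp (lam * z.2)
    * (κ * (lapNorm L H * avgDeviation L ρ z.2 z.1 * deviation L ρ z.2 z.1))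
  have hFm : Measurable F := by
    have h1 := (measurable_avgDeviation (L := L) hρ).comp (measurable_swap (α := S2) (β := ℝ))
    have h2 := (measurable_deviation (L := L) hρ).comp (measurable_swap (α := S2) (β := ℝ))
    have h3 : Measurable fun z : S2 × ℝ => Real.exp (lam * z.2) := by fun_prop
    exact h3.mul ((((measurable_const (a := lapNorm L H)).mul h1).mul h2).const_mul κ)
  have hFint : Integrable F (sphereMeasure.prod (volume.restrict (Ioc 0 T))) := by
    refine (integrable_const (Real.exp (lam * T) * (κ * (lapNorm L H * 2 * 2)))).mono'
      hFm.aestronglyMeasurable ?_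
    have h1 : ∀ᵐ z ∂sphereMeasure.prod (volume.restrict (Ioc 0 T)), IsGood L κ G ρ₀ ρ z.1 ∧
        ∀ᵐ η ∂equatorMeasure z.1, IsGood L κ G ρ₀ ρ η :=
      Measure.quasiMeasurePreserving_fst.ae (hg.and hgg)
    have h2 : ∀ᵐ z ∂sphereMeasure.prod (volume.restrict (Ioc 0 T)), z.2 ∈ Ioc 0 T :=
      Measure.quasiMeasurePreserving_snd.ae (ae_restrict_mem measurableSet_Ioc)
    filter_upwards [h1, h2] with z hz hz2
    have b1 := (avgDeviation_bounds hL hκ hD hρ hz.2).2 z.2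
    have b2 := hz.1.1.deviation_le hL hκ hD hz.1.2 z.2
    have b3 := deviation_nonneg (L := L) (ρ := ρ) z.2 z.1
    have b4 := b1.1
    rw [Real.norm_of_nonneg (by positivity)]
    have b5 : lam * z.2 ≤ lam * T := mul_le_mul_of_nonneg_left hz2.2 hlam0
    have b6 := b1.2
    simp only [F]
    gcongr
  have hI : Integrable (fun ξ => ∫ s in (0 : ℝ)..T, F (ξ, s)) sphereMeasure := by
    simp only [intervalIntegral.integral_of_le hT]
    exact hFint.integral_prod_left
  have hfib : ∀ᵐ ξ ∂sphereMeasure, Real.exp (lam * T) * fibreEntropy L (ρ T) ξ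
      ≤ fibreEntropy L ρ₀ ξ + ∫ s in (0 : ℝ)..T, F (ξ, s) := by
    filter_upwards [hg, hgg] with ξ h1 h2 using fibre_entropy_le hL hκ hD hρ h1 h2 hT
  have hEm := measurable_fibreEntropy hL hslice
  have hEpos : ∀ᵐ ξ ∂sphereMeasure, 0 ≤ fibreEntropy L (ρ T) ξ := by
    filter_upwards [hg] with ξ h
    have := sq_deviation_le hL hκ hD h hT
    nlinarith [sq_nonneg (deviation L ρ T ξ)]
  -- Fibre entropies are nonnegative by Pinsker and the exponential factor is at least one, so the
  -- fibrewise inequality itself provides the dominating function.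
  have hET : Integrable (fibreEntropy L (ρ T)) sphereMeasure := by
    refine (hE0.add hI).mono' hEm.aestronglyMeasurable ?_
    filter_upwards [hfib, hEpos] with ξ h1 h2
    rw [Real.norm_of_nonneg h2]
    refine le_trans ?_ h1
    exact le_mul_of_one_le_left h2 (Real.one_le_exp (mul_nonneg hlam0 hT))
  constructor
  · have hem : Measurable fun p : (Fin d → ℝ) × S2 => entropyDensity d L (ρ T p.1 p.2) :=
      (continuous_entropyDensity d hL).measurable.comp hslice
    refine (integrable_prod_iff' hem.aestronglyMeasurable).2 ⟨?_, ?_⟩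
    · filter_upwards [hg] with ξ h
      exact ((continuous_entropyDensity d hL).comp
        (continuous_slice (u := fun t x => ρ t x ξ) h.1.continuous hT)).integrable_cell
    · have hnm : Measurable fun p : S2 × (Fin d → ℝ) => ‖entropyDensity d L (ρ T p.2 p.1)‖ :=
        hem.norm.comp measurable_swap
      refine (hET.add (integrable_const 2)).mono'
        hnm.stronglyMeasurable.integral_prod_right.aestronglyMeasurable ?_
      filter_upwards [hg] with ξ h
      rw [Real.norm_of_nonneg (integral_nonneg fun _ => norm_nonneg _)]
      have hc : Continuous fun x => entropyDensity d L (ρ T x ξ) :=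
        (continuous_entropyDensity d hL).comp
          (continuous_slice (u := fun t x => ρ t x ξ) h.1.continuous hT)
      have h1 : ∫ x, ‖entropyDensity d L (ρ T x ξ)‖ ∂cellMeasure d L
          ≤ ∫ x, (entropyDensity d L (ρ T x ξ) + 2 / L ^ d) ∂cellMeasure d L :=
        integral_mono hc.integrable_cell.norm (hc.integrable_cell.add (integrable_const _))
          fun x => abs_entropyDensity_le d hL (h.1.nonneg hL hκ hD h.2 T hT x)
      rw [integral_add hc.integrable_cell (integrable_const _), integral_const,
        cellMeasure_real_univ hL, smul_eq_mul, mul_div_cancel₀ _ (pow_pos hL d).ne'] at h1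
      exact h1
  · have h1 := integral_mono_ae (hET.const_mul (Real.exp (lam * T))) (hE0.add hI) hfib
    rw [integral_const_mul] at h1
    have h2 : ∫ ξ, (fibreEntropy L ρ₀ + fun ξ => ∫ s in (0 : ℝ)..T, F (ξ, s)) ξ ∂sphereMeasure
        = relEntropy L ρ₀ + ∫ ξ, (∫ s in (0 : ℝ)..T, F (ξ, s)) ∂sphereMeasure :=
      integral_add hE0 hI
    rw [h2] at h1
    refine h1.trans (add_le_add_right ?_ _)
    simp only [intervalIntegral.integral_of_le hT]
    rw [integral_integral_swap hFint]
    have hSc := continuous_meanSqDeviation hL hκ hD hρ hg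
    refine integral_mono hFint.integral_prod_right
      ((by fun_prop : Continuous _).intervalIntegrable 0 T).1 fun s => ?_
    have h3 := integral_avg_mul_deviation_le hL hκ hD hρ hg s
    have e : ∀ ξ, F (ξ, s) = κ * lapNorm L H * Real.exp (lam * s)
        * (avgDeviation L ρ s ξ * deviation L ρ s ξ) := fun ξ => by simp only [F]; ring
    simp only [e]
    rw [integral_const_mul, ← mul_assoc]
    exact mul_le_mul_of_nonneg_left h3 (by positivity)

/-- Exponential decay of the relative entropy. -/
theorem relEntropy_decay (hL : 0 < L) (hκ : 0 < κ) (hD : IsW2InfPotential L D G H)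
    (hρ : Measurable fun p : ℝ × (Fin d → ℝ) × S2 => ρ p.1 p.2.1 p.2.2)
    (hg : ∀ᵐ ξ ∂sphereMeasure, IsGood L κ G ρ₀ ρ ξ) (h0 : FiniteEntropy L ρ₀) {T : ℝ}
    (hT : 0 ≤ T) :
    relEntropy L (ρ T) ≤ Real.exp (-(4 * Real.pi ^ 2 / L ^ 2 - 2 * κ * lapNorm L H) * T)
      * relEntropy L ρ₀ := by
  set lam := 4 * Real.pi ^ 2 / L ^ 2 with hlam
  have hN : 0 ≤ lapNorm L H := ENNReal.toReal_nonneg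
  have hSc := continuous_meanSqDeviation hL hκ hD hρ hg
  -- Grönwall is applied to the mean square deviation, which is continuous in time; no continuity of
  -- the entropy has been established. Pinsker bounds `y` by the weighted entropy, and `key` then
  -- transfers the estimate back.
  let y : ℝ → ℝ := fun s => Real.exp (lam * s) * meanSqDeviation L ρ s / 2
  have hyc : Continuous y := by fun_prop
  have hS : ∀ t, 0 ≤ t → meanSqDeviation L ρ t ≤ 2 * relEntropy L (ρ t) := fun t ht => by
    have hEt : Integrable (fibreEntropy L (ρ t)) sphereMeasure :=
      Integrable.integral_prod_right (averaged_entropy hL hκ hD hρ hg h0 ht).1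
    have h1 : meanSqDeviation L ρ t ≤ ∫ ξ, 2 * fibreEntropy L (ρ t) ξ ∂sphereMeasure := by
      refine integral_mono_ae ?_ (hEt.const_mul 2) ?_
      · refine (integrable_const (4 : ℝ)).mono'
          ((measurable_deviation_right hρ t).pow_const 2).aestronglyMeasurable ?_
        filter_upwards [hg] with ξ h using norm_deviation_sq_le hL hκ hD h t
      · filter_upwards [hg] with ξ h using sq_deviation_le hL hκ hD h ht
    rw [integral_const_mul] at h1
    exact h1
  have key : ∀ t, 0 ≤ t → Real.exp (lam * t) * relEntropy L (ρ t)
      ≤ relEntropy L ρ₀ + ∫ s in (0 : ℝ)..t, y s * (2 * κ * lapNorm L H) := fun t ht => by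
    refine (averaged_entropy hL hκ hD hρ hg h0 ht).2.trans_eq ?_
    congr 2
    ext s
    simp only [y]
    ring
  have hgr := gronwall_integral hyc (a := relEntropy L ρ₀) (c := 2 * κ * lapNorm L H) hT
    fun t ht => by
      refine mul_le_mul_of_nonneg_right (le_trans ?_ (key t ht.1)) (by positivity)
      have := mul_le_mul_of_nonneg_left (hS t ht.1) (Real.exp_pos (lam * t)).le
      simp only [y]
      linarith
  have h1 := (key T hT).trans hgr
  have h2 := mul_le_mul_of_nonneg_left h1 (Real.exp_pos (-lam * T)).le
  rw [← mul_assoc, ← Real.exp_add, show -lam * T + lam * T = 0 by ring, Real.exp_zero, one_mul] at h2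
  refine h2.trans_eq ?_
  rw [mul_comm (relEntropy L ρ₀), ← mul_assoc, ← Real.exp_add]
  congr 2
  ring

end Decay

end

theorem proposition5p1 :
    -- the spherical graphop is a bounded operator on `L²(𝕊²)`, of operator norm `1`
    (∃ A : Lp ℝ 2 sphereMeasure →L[ℝ] Lp ℝ 2 sphereMeasure,
      (∀ (f : S2 → ℝ) (hf : MemLp f 2 sphereMeasure),
        A (hf.toLp f) =ᵐ[sphereMeasure] sphericalAverage f) ∧ ‖A‖ = 1) ∧
    -- exponential decay of the relative entropy of solutions
    (∀ (d : ℕ) (_ : 0 < d) (L κ : ℝ) (_ : 0 < L) (_ : 0 < κ)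
      (D : (Fin d → ℝ) → ℝ) (G : Fin d → (Fin d → ℝ) → ℝ)
      (H : Fin d → Fin d → (Fin d → ℝ) → ℝ) (_ : IsW2InfPotential L D G H)
      -- `κ < 2π² / (L² ‖ΔD‖)`, which is no condition if `‖ΔD‖ = 0`
      (_ : κ * (L ^ 2 * lapNorm L H) < 2 * Real.pi ^ 2)
      (ρ₀ : (Fin d → ℝ) → S2 → ℝ) (_ : IsAdmissible L ρ₀) (_ : FiniteEntropy L ρ₀)
      (ρ : ℝ → (Fin d → ℝ) → S2 → ℝ) (_ : IsClassicalSolution L κ G ρ₀ ρ),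
      0 < 4 * Real.pi ^ 2 / L ^ 2 - 2 * κ * lapNorm L H ∧
      ∀ t : ℝ, 0 ≤ t → FiniteEntropy L (ρ t) ∧
        relEntropy L (ρ t) ≤
          Real.exp (-(4 * Real.pi ^ 2 / L ^ 2 - 2 * κ * lapNorm L H) * t) *
            relEntropy L ρ₀) := by
  refine ⟨exists_sphericalGraphop, ?_⟩
  intro d _ L κ hL hκ D G H hD hsmall ρ₀ hρ₀ h0 ρ hρ
  have hg : ∀ᵐ ξ ∂sphereMeasure, IsGood L κ G ρ₀ ρ ξ := by
    filter_upwards [hρ.solves, hρ₀.sobolev] with ξ h1 h2 using ⟨h1, h2.2⟩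
  refine ⟨?_, fun t ht => ⟨(averaged_entropy hL hκ hD hρ.measurable hg h0 ht).1,
    relEntropy_decay hL hκ hD hρ.measurable hg h0 ht⟩⟩
  -- Positivity of the rate is twice the smallness condition, divided by `L ^ 2`.
  rw [sub_pos, lt_div_iff₀ (by positivity)]
  linarith
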